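/- All vector spaces are over $\mathbb C$; repeated indices are summed. Let $D=3$. Let $\Gamma^i_{\alpha\beta}$ and $\Gamma^{\alpha\beta\, i}$ ($i=1,2,3$; $\alpha,\beta=1,2$) be symmetric in $\alpha,\beta$ and satisfy $\Gamma^i_{\alpha\gamma}\Gamma^{\gamma\beta j}+\Gamma^j_{\alpha\gamma}\Gamma^{\gamma\beta i}=\delta_\alpha^\beta\delta^{ij}$. Let $YM$ be the quotient of the free Lie superalgebra on even generators $A_1,A_2,A_3$ and odd generators $\psi^1,\psi^2$ by the ideal generated by $$[A_i,[A_i,A_m]]-\tfrac12\Gamma^m_{\alpha\beta}\{\psi^\alpha,\psi^\beta\},\qquad \Gamma^i_{\alpha\beta}[A_i,\psi^\beta].$$ Put $\Gamma_\alpha^{\beta ij}=\Gamma^i_{\alpha\gamma}\Gamma^{\gamma\beta j}-\Gamma^j_{\alpha\gamma}\Gamma^{\gamma\beta i}$. The supersymmetries are the odd derivations $\theta_1,\theta_2$ of $YM$ with $$\theta_\alpha(A_i)=\Gamma^i_{\alpha\beta}\psi^\beta,\qquad \theta_\alpha(\psi^\beta)=-\tfrac12\Gamma_\alpha^{\beta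 ij}[A_i,A_j],$$ and the supersymmetry algebra $L$ is the Lie sub-superalgebra of $\mathrm{Der}(YM)$ generated by them. Let $W$ be a two-dimensional space with basis $w_1,w_2$ and a nondegenerate skew-symmetric form with matrix $\epsilon_{\alpha\beta}$ and inverse matrix $\epsilon^{\alpha\beta}$. Let $\mathrm{Free}(\Pi W)$ be the free Lie superalgebra on $W$ placed in odd parity, and let $I$ be its ideal generated by $$z_\alpha=\epsilon^{\beta\beta'}\epsilon^{\gamma\gamma'}\{w_\beta,\{w_{\beta'},\{w_\gamma,\{w_{\gamma'},w_\alpha\}\}\}\}\qquad(\alpha=1,2).$$ In $\mathrm{Free}(\Pi W)/I$ put $\tilde A_{\alpha\beta}=\{w_\alpha,w_\beta\}$, $\tilde\chi^\alpha=\epsilon^{\alpha\delta}\epsilon^{\beta\gamma}[w_\beta,\tilde A_{\gamma\delta}]$ and $\tilde\chi_\alpha=\epsilon_{\alpha\beta}\tilde\chi^\beta$. In $YM$ put $A_{\alpha\beta}=-2\Gamma^i_{\alpha\beta}A_i$ and $\chi_\alpha=\kappa\,\epsilon_{\alpha\beta}\psi^\beta$, with $\kappa=-2\det(\epsilon^{\alpha\beta})\sum_i\det(\Gamma^i_{\alpha\beta})$.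 Then: 1. The elements $z_1,z_2$ are linearly independent and span an $\mathfrak{sl}_2$-invariant subspace isomorphic to $W$: for every traceless matrix $a$, the action $w_\alpha\mapsto a_{\beta\alpha}w_\beta$ extends to an even derivation of $\mathrm{Free}(\Pi W)$ that maps $z_\alpha$ to $a_{\beta\alpha}z_\beta$. 2. The derivations $\theta_1,\theta_2$ exist, and there is an isomorphism of Lie superalgebras $\Phi:\mathrm{Free}(\Pi W)/I\to L$ with $\Phi(w_\alpha)=\theta_\alpha$. 3. The elements $A_{\alpha\beta}$ and $\chi_\alpha$ generate $YM$, and the formula $$A_{\alpha\beta}\mapsto\tilde A_{\alpha\beta},\qquad \chi_\alpha\mapsto\tilde\chi_\alpha$$ defines an injective homomorphism of Lie superalgebras $\iota:YM\to\mathrm{Free}(\Pi W)/I$. Moreover $\Phi(\iota(y))=\mathrm{ad}(y)$ for all $y\in YM$. -/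

import Mathlib

open scoped Matrix

noncomputable section

/-! ## Superalgebras and Lie superalgebras over the complex numbers -/

/-- The sign `(-1) ^ (i * j)` attached to two parities. -/
def superSign (i j : ZMod 2) : ℂ := if i = 1 ∧ j = 1 then -1 else 1

theorem zmod_two_cases : ∀ i : ZMod 2, i = 0 ∨ i = 1 := by decide

/-- A (not necessarily associative) superalgebra over `ℂ`: a complex vector space with a
`ℤ/2`-grading, given by its two complementary projections `proj 0` (even part) and `proj 1`
(odd part), and a bilinear product `br` compatible with the grading. -/
class SuperAlgebra (A : Type*) [AddCommGroup A] [Module ℂ A] where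
  proj : ZMod 2 → A →ₗ[ℂ] A
  proj_proj : ∀ i j x, proj i (proj j x) = if i = j then proj j x else 0
  proj_add : ∀ x, proj 0 x + proj 1 x = x
  br : A →ₗ[ℂ] A →ₗ[ℂ] A
  proj_br : ∀ i j x y, proj (i + j) (br (proj i x) (proj j y)) = br (proj i x) (proj j y)

namespace SuperAlgebra

variable {A : Type*} [AddCommGroup A] [Module ℂ A] [SuperAlgebra A]

/-- The homogeneous component of parity `i`. -/
def gr (A : Type*) [AddCommGroup A] [Module ℂ A] [SuperAlgebra A] (i : ZMod 2) :
    Submodule ℂ A := LinearMap.range (proj (A := A) i)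

theorem mem_gr {i : ZMod 2} {x : A} : x ∈ gr A i ↔ proj i x = x := by
  constructor
  · rintro ⟨y, rfl⟩
    simp [proj_proj]
  · intro h
    exact ⟨x, h⟩

theorem proj_mem (i : ZMod 2) (x : A) : proj i x ∈ gr A i := ⟨x, rfl⟩

theorem br_mem {i j : ZMod 2} {x y : A} (hx : x ∈ gr A i) (hy : y ∈ gr A j) :
    br x y ∈ gr A (i + j) := by
  rw [mem_gr] at hx hy ⊢
  rw [← hx, ← hy]
  exact proj_br i j x y

end SuperAlgebra

open SuperAlgebra

/-- A Lie superalgebra over `ℂ`: super skew symmetry and the super Jacobi identity. -/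
class LieSuperalgebra (A : Type*) [AddCommGroup A] [Module ℂ A] [SuperAlgebra A] : Prop where
  skew : ∀ (i j : ZMod 2) (x y : A), x ∈ gr A i → y ∈ gr A j →
    br x y = -(superSign i j • br y x)
  jacobi : ∀ (i j k : ZMod 2) (x y z : A), x ∈ gr A i → y ∈ gr A j → z ∈ gr A k →
    br x (br y z) = br (br x y) z + superSign i j • br y (br x z)

/-- Homomorphisms of superalgebras: even linear maps preserving the product. -/
structure SuperHom (A B : Type*) [AddCommGroup A] [Module ℂ A] [SuperAlgebra A]
    [AddCommGroup B] [Module ℂ B] [SuperAlgebra B] where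
  toLin : A →ₗ[ℂ] B
  map_proj : ∀ i x, toLin (proj i x) = proj i (toLin x)
  map_br : ∀ x y, toLin (br x y) = br (toLin x) (toLin y)

instance {A B : Type*} [AddCommGroup A] [Module ℂ A] [SuperAlgebra A]
    [AddCommGroup B] [Module ℂ B] [SuperAlgebra B] : CoeFun (SuperHom A B) (fun _ => A → B) :=
  ⟨fun f => f.toLin⟩

/-! ## Graded ideals and quotients -/

/-- A graded two-sided ideal. -/
structure SuperIdeal (A : Type*) [AddCommGroup A] [Module ℂ A] [SuperAlgebra A] where
  carrier : Submodule ℂ A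
  proj_mem' : ∀ i x, x ∈ carrier → proj i x ∈ carrier
  br_left' : ∀ x y, y ∈ carrier → br x y ∈ carrier
  br_right' : ∀ x y, x ∈ carrier → br x y ∈ carrier

namespace SuperIdeal

variable {A : Type*} [AddCommGroup A] [Module ℂ A] [SuperAlgebra A]

/-- The graded ideal generated by a set. -/
def span (s : Set A) : SuperIdeal A where
  carrier := sInf {I | s ⊆ I ∧ ∃ J : SuperIdeal A, J.carrier = I}
  proj_mem' i x hx := by
    rw [Submodule.mem_sInf] at hx ⊢
    rintro _ ⟨hs, J, rfl⟩
    exact J.proj_mem' i x (hx _ ⟨hs, J, rfl⟩)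
  br_left' x y hy := by
    rw [Submodule.mem_sInf] at hy ⊢
    rintro _ ⟨hs, J, rfl⟩
    exact J.br_left' x y (hy _ ⟨hs, J, rfl⟩)
  br_right' x y hx := by
    rw [Submodule.mem_sInf] at hx ⊢
    rintro _ ⟨hs, J, rfl⟩
    exact J.br_right' x y (hx _ ⟨hs, J, rfl⟩)

theorem subset_span (s : Set A) : s ⊆ ((span s).carrier : Set A) := by
  intro x hx
  change x ∈ (sInf _ : Submodule ℂ A)
  rw [Submodule.mem_sInf]
  rintro _ ⟨hs, -⟩
  exact hs hx

theorem span_le {s : Set A} {J : SuperIdeal A} (h : s ⊆ (J.carrier : Set A)) :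
    (span s).carrier ≤ J.carrier := sInf_le ⟨h, J, rfl⟩

/-- The quotient of a superalgebra by a graded ideal. -/
def Quotient (I : SuperIdeal A) : Type _ := A ⧸ I.carrier

instance (I : SuperIdeal A) : AddCommGroup I.Quotient :=
  inferInstanceAs (AddCommGroup (A ⧸ I.carrier))

instance (I : SuperIdeal A) : Module ℂ I.Quotient :=
  inferInstanceAs (Module ℂ (A ⧸ I.carrier))

/-- The projection onto the quotient. -/
def toQuot (I : SuperIdeal A) : A →ₗ[ℂ] I.Quotient := I.carrier.mkQ

theorem toQuot_surjective (I : SuperIdeal A) : Function.Surjective I.toQuot :=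
  Submodule.mkQ_surjective _

theorem toQuot_eq_zero {I : SuperIdeal A} {x : A} : I.toQuot x = 0 ↔ x ∈ I.carrier :=
  Submodule.Quotient.mk_eq_zero _

/-- The projections onto the even and odd part of the quotient. -/
def quotProj (I : SuperIdeal A) (i : ZMod 2) : I.Quotient →ₗ[ℂ] I.Quotient :=
  I.carrier.mapQ I.carrier (proj i) (fun x hx => I.proj_mem' i x hx)

/-- The product of the quotient. -/
def quotBr (I : SuperIdeal A) : I.Quotient →ₗ[ℂ] I.Quotient →ₗ[ℂ] I.Quotient :=
  I.carrier.liftQ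
    (LinearMap.mk₂ ℂ
      (fun x (y : I.Quotient) =>
        (I.carrier.mapQ I.carrier (br x) (fun y hy => I.br_left' x y hy) : _ →ₗ[ℂ] _) y)
      (by
        intro x x' y
        obtain ⟨y, rfl⟩ := I.toQuot_surjective y
        change I.toQuot (br (x + x') y) = I.toQuot (br x y) + I.toQuot (br x' y)
        rw [map_add, LinearMap.add_apply, map_add])
      (by
        intro c x y
        obtain ⟨y, rfl⟩ := I.toQuot_surjective y
        change I.toQuot (br (c • x) y) = c • I.toQuot (br x y)
        rw [map_smul, LinearMap.smul_apply, map_smul])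
      (by intro x y y'; exact map_add _ y y')
      (by intro c x y; exact map_smul _ c y))
    (by
      intro x hx
      rw [LinearMap.mem_ker]
      ext y
      obtain ⟨y, rfl⟩ := I.toQuot_surjective y
      exact toQuot_eq_zero.2 (I.br_right' x y hx))

theorem quotProj_toQuot (I : SuperIdeal A) (i : ZMod 2) (x : A) :
    I.quotProj i (I.toQuot x) = I.toQuot (proj i x) := rfl

theorem quotBr_toQuot (I : SuperIdeal A) (x y : A) :
    I.quotBr (I.toQuot x) (I.toQuot y) = I.toQuot (br x y) := rfl

instance (I : SuperIdeal A) : SuperAlgebra I.Quotient where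
  proj := I.quotProj
  proj_proj i j x := by
    obtain ⟨x, rfl⟩ := I.toQuot_surjective x
    simp only [quotProj_toQuot, proj_proj]
    split_ifs <;> simp
  proj_add x := by
    obtain ⟨x, rfl⟩ := I.toQuot_surjective x
    simp only [quotProj_toQuot]
    rw [← map_add, proj_add]
  br := I.quotBr
  proj_br i j x y := by
    obtain ⟨x, rfl⟩ := I.toQuot_surjective x
    obtain ⟨y, rfl⟩ := I.toQuot_surjective y
    simp only [quotProj_toQuot, quotBr_toQuot, proj_br]

theorem proj_toQuot (I : SuperIdeal A) (i : ZMod 2) (x : A) :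
    proj i (I.toQuot x) = I.toQuot (proj i x) := rfl

theorem br_toQuot (I : SuperIdeal A) (x y : A) : br (I.toQuot x) (I.toQuot y) = I.toQuot (br x y) := rfl

theorem exists_of_mem_gr (I : SuperIdeal A) {i : ZMod 2} {x : I.Quotient}
    (hx : x ∈ gr I.Quotient i) : ∃ a ∈ gr A i, I.toQuot a = x := by
  obtain ⟨y, rfl⟩ := hx
  obtain ⟨y, rfl⟩ := I.toQuot_surjective y
  exact ⟨proj i y, proj_mem i y, rfl⟩

instance (I : SuperIdeal A) [LieSuperalgebra A] : LieSuperalgebra I.Quotient where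
  skew i j x y hx hy := by
    obtain ⟨a, ha, rfl⟩ := I.exists_of_mem_gr hx
    obtain ⟨b, hb, rfl⟩ := I.exists_of_mem_gr hy
    simp only [br_toQuot, LieSuperalgebra.skew i j a b ha hb, map_neg, map_smul]
  jacobi i j k x y z hx hy hz := by
    obtain ⟨a, ha, rfl⟩ := I.exists_of_mem_gr hx
    obtain ⟨b, hb, rfl⟩ := I.exists_of_mem_gr hy
    obtain ⟨c, hc, rfl⟩ := I.exists_of_mem_gr hz
    simp only [br_toQuot, LieSuperalgebra.jacobi i j k a b c ha hb hc, map_add, map_smul]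

end SuperIdeal

/-! ## Graded subalgebras -/

/-- A graded subalgebra. -/
structure SubSuperalgebra (A : Type*) [AddCommGroup A] [Module ℂ A] [SuperAlgebra A] where
  carrier : Submodule ℂ A
  proj_mem' : ∀ i x, x ∈ carrier → proj i x ∈ carrier
  br_mem' : ∀ x y, x ∈ carrier → y ∈ carrier → br x y ∈ carrier

namespace SubSuperalgebra

variable {A : Type*} [AddCommGroup A] [Module ℂ A] [SuperAlgebra A]

/-- The graded subalgebra generated by a set. -/
def closure (s : Set A) : SubSuperalgebra A where
  carrier := sInf {I | s ⊆ I ∧ ∃ J : SubSuperalgebra A, J.carrier = I}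
  proj_mem' i x hx := by
    rw [Submodule.mem_sInf] at hx ⊢
    rintro _ ⟨hs, J, rfl⟩
    exact J.proj_mem' i x (hx _ ⟨hs, J, rfl⟩)
  br_mem' x y hx hy := by
    rw [Submodule.mem_sInf] at hx hy ⊢
    rintro _ ⟨hs, J, rfl⟩
    exact J.br_mem' x y (hx _ ⟨hs, J, rfl⟩) (hy _ ⟨hs, J, rfl⟩)

instance (S : SubSuperalgebra A) : SuperAlgebra S.carrier where
  proj i := (proj i).restrict (S.proj_mem' i)
  proj_proj i j x := by
    apply Subtype.ext
    have := proj_proj i j (x : A)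
    split_ifs at this ⊢ with h <;> simpa using this
  proj_add x := by
    apply Subtype.ext
    simpa using proj_add (x : A)
  br := LinearMap.mk₂ ℂ (fun x y => (⟨br (x : A) (y : A), S.br_mem' _ _ x.2 y.2⟩ : S.carrier))
    (by intros; apply Subtype.ext; simp) (by intros; apply Subtype.ext; simp)
    (by intros; apply Subtype.ext; simp) (by intros; apply Subtype.ext; simp)
  proj_br i j x y := by
    apply Subtype.ext
    simpa using proj_br i j (x : A) (y : A)

end SubSuperalgebra

/-! ## Free Lie superalgebras -/

section Free

variable {X : Type*}

/-- The free nonassociative algebra on `X`, where the generator `x` has parity `p x`. -/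
def FreeSuper (_p : X → ZMod 2) : Type _ := FreeNonUnitalNonAssocAlgebra ℂ X

instance (p : X → ZMod 2) : NonUnitalNonAssocRing (FreeSuper p) :=
  inferInstanceAs (NonUnitalNonAssocRing (FreeNonUnitalNonAssocAlgebra ℂ X))

instance (p : X → ZMod 2) : Module ℂ (FreeSuper p) :=
  inferInstanceAs (Module ℂ (FreeNonUnitalNonAssocAlgebra ℂ X))

instance (p : X → ZMod 2) : IsScalarTower ℂ (FreeSuper p) (FreeSuper p) :=
  inferInstanceAs (IsScalarTower ℂ (FreeNonUnitalNonAssocAlgebra ℂ X)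
    (FreeNonUnitalNonAssocAlgebra ℂ X))

instance (p : X → ZMod 2) : SMulCommClass ℂ (FreeSuper p) (FreeSuper p) :=
  inferInstanceAs (SMulCommClass ℂ (FreeNonUnitalNonAssocAlgebra ℂ X)
    (FreeNonUnitalNonAssocAlgebra ℂ X))

namespace FreeSuper

/-- The generators. -/
def of (p : X → ZMod 2) (x : X) : FreeSuper p := FreeNonUnitalNonAssocAlgebra.of ℂ x

/-- The sign of a parity. -/
def sgn (i : ZMod 2) : ℂ := if i = 1 then -1 else 1

/-- The parity automorphism, which multiplies the generator `x` by `(-1) ^ p x`. -/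
def parityAut (p : X → ZMod 2) : FreeSuper p →ₙₐ[ℂ] FreeSuper p :=
  FreeNonUnitalNonAssocAlgebra.lift ℂ (fun x => sgn (p x) • of p x)

theorem parityAut_of (p : X → ZMod 2) (x : X) :
    parityAut p (of p x) = sgn (p x) • of p x :=
  FreeNonUnitalNonAssocAlgebra.lift_of_apply ℂ _ x

theorem sgn_mul_self (i : ZMod 2) : sgn i * sgn i = 1 := by
  unfold sgn; split_ifs <;> norm_num

theorem parityAut_parityAut (p : X → ZMod 2) (x : FreeSuper p) :
    parityAut p (parityAut p x) = x := by
  have : (parityAut p).comp (parityAut p) = NonUnitalAlgHom.id ℂ (FreeSuper p) := by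
    apply FreeNonUnitalNonAssocAlgebra.hom_ext
    intro x
    change parityAut p (parityAut p (of p x)) = of p x
    rw [parityAut_of, map_smul, parityAut_of, smul_smul, sgn_mul_self, one_smul]
  exact congrArg (fun f => f x) this

/-- The projections `(1 ± σ) / 2` onto the eigenspaces of the parity automorphism `σ`. -/
def projection (p : X → ZMod 2) (i : ZMod 2) : FreeSuper p →ₗ[ℂ] FreeSuper p :=
  (1 / 2 : ℂ) • (LinearMap.id + sgn i • (parityAut p : FreeSuper p →ₗ[ℂ] FreeSuper p))

theorem projection_apply (p : X → ZMod 2) (i : ZMod 2) (x : FreeSuper p) :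
    projection p i x = (1 / 2 : ℂ) • (x + sgn i • parityAut p x) := rfl

instance (p : X → ZMod 2) : SuperAlgebra (FreeSuper p) where
  proj := projection p
  proj_proj i j x := by
    simp only [projection_apply, map_smul, map_add, parityAut_parityAut]
    rcases zmod_two_cases i with rfl | rfl <;> rcases zmod_two_cases j with rfl | rfl <;> simp [sgn] <;> module
  proj_add x := by
    simp only [projection_apply]
    simp [sgn]
    module
  br := LinearMap.mul ℂ (FreeSuper p)
  proj_br i j x y := by
    change projection p (i + j) (projection p i x * projection p j y) =
      projection p i x * projection p j y
    simp only [projection_apply, map_smul, map_add, map_mul,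
      parityAut_parityAut, smul_mul_assoc, mul_smul_comm, add_mul, mul_add]
    generalize parityAut p x = x'
    generalize parityAut p y = y'
    have h2 : (1 : ZMod 2) + 1 = 0 := by decide
    rcases zmod_two_cases i with rfl | rfl <;> rcases zmod_two_cases j with rfl | rfl <;> simp [sgn, h2] <;> module

end FreeSuper

/-- The ideal of the free nonassociative superalgebra generated by the axioms of a Lie
superalgebra. -/
def lieIdeal (p : X → ZMod 2) : SuperIdeal (FreeSuper p) := SuperIdeal.span
  ({u | ∃ (i j : ZMod 2) (x y : FreeSuper p), x ∈ gr (FreeSuper p) i ∧ y ∈ gr (FreeSuper p) j ∧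
      u = br x y + superSign i j • br y x} ∪
   {u | ∃ (i j k : ZMod 2) (x y z : FreeSuper p), x ∈ gr (FreeSuper p) i ∧
      y ∈ gr (FreeSuper p) j ∧ z ∈ gr (FreeSuper p) k ∧
      u = br x (br y z) - (br (br x y) z + superSign i j • br y (br x z))})

/-- The free Lie superalgebra on the set `X`, where the generator `x` has parity `p x`. -/
abbrev FreeLieSuper (p : X → ZMod 2) : Type _ := (lieIdeal p).Quotient

/-- The generators of the free Lie superalgebra. -/
def FreeLieSuper.of (p : X → ZMod 2) (x : X) : FreeLieSuper p :=
  (lieIdeal p).toQuot (FreeSuper.of p x)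

instance (p : X → ZMod 2) : LieSuperalgebra (FreeLieSuper p) where
  skew i j x y hx hy := by
    obtain ⟨a, ha, rfl⟩ := (lieIdeal p).exists_of_mem_gr hx
    obtain ⟨b, hb, rfl⟩ := (lieIdeal p).exists_of_mem_gr hy
    rw [← sub_eq_zero, sub_neg_eq_add]
    simp only [SuperIdeal.br_toQuot, ← (lieIdeal p).toQuot.map_smul,
      ← (lieIdeal p).toQuot.map_add]
    exact SuperIdeal.toQuot_eq_zero.2
      (SuperIdeal.subset_span _ (Or.inl ⟨i, j, a, b, ha, hb, rfl⟩))
  jacobi i j k x y z hx hy hz := by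
    obtain ⟨a, ha, rfl⟩ := (lieIdeal p).exists_of_mem_gr hx
    obtain ⟨b, hb, rfl⟩ := (lieIdeal p).exists_of_mem_gr hy
    obtain ⟨c, hc, rfl⟩ := (lieIdeal p).exists_of_mem_gr hz
    rw [← sub_eq_zero]
    simp only [SuperIdeal.br_toQuot, ← (lieIdeal p).toQuot.map_smul,
      ← (lieIdeal p).toQuot.map_add, ← (lieIdeal p).toQuot.map_sub]
    exact SuperIdeal.toQuot_eq_zero.2
      (SuperIdeal.subset_span _ (Or.inr ⟨i, j, k, a, b, c, ha, hb, hc, rfl⟩))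

end Free

/-! ## Superderivations -/

section Derivations

variable {A : Type*} [AddCommGroup A] [Module ℂ A] [SuperAlgebra A]

/-- The component of parity `i` of an endomorphism of a super vector space. -/
def endProj (i : ZMod 2) : Module.End ℂ A →ₗ[ℂ] Module.End ℂ A where
  toFun D := proj i ∘ₗ D ∘ₗ proj 0 + proj (i + 1) ∘ₗ D ∘ₗ proj 1
  map_add' D E := by ext x; simp; abel
  map_smul' c D := by ext x; simp

theorem endProj_apply (i : ZMod 2) (D : Module.End ℂ A) (x : A) :
    endProj i D x = proj i (D (proj 0 x)) + proj (i + 1) (D (proj 1 x)) := rfl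

/-- The supercommutator `D E - (-1) ^ (|D| |E|) E D`. -/
def superComm : Module.End ℂ A →ₗ[ℂ] Module.End ℂ A →ₗ[ℂ] Module.End ℂ A :=
  LinearMap.mk₂ ℂ
    (fun D E => ∑ i : ZMod 2, ∑ j : ZMod 2,
      (endProj i D * endProj j E - superSign i j • (endProj j E * endProj i D)))
    (by
      intro D D' E
      simp only [map_add, add_mul, mul_add, smul_add, ← Finset.sum_add_distrib]
      refine Finset.sum_congr rfl fun i _ => Finset.sum_congr rfl fun j _ => ?_
      abel)
    (by
      intro c D E
      simp only [map_smul, Finset.smul_sum]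
      refine Finset.sum_congr rfl fun i _ => Finset.sum_congr rfl fun j _ => ?_
      rw [smul_mul_assoc, mul_smul_comm, smul_sub, smul_comm c (superSign i j)])
    (by
      intro D E E'
      simp only [map_add, add_mul, mul_add, smul_add, ← Finset.sum_add_distrib]
      refine Finset.sum_congr rfl fun i _ => Finset.sum_congr rfl fun j _ => ?_
      abel)
    (by
      intro c D E
      simp only [map_smul, Finset.smul_sum]
      refine Finset.sum_congr rfl fun i _ => Finset.sum_congr rfl fun j _ => ?_
      rw [smul_mul_assoc, mul_smul_comm, smul_sub, smul_comm c (superSign i j)])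

theorem endProj_endProj (i j : ZMod 2) (D : Module.End ℂ A) :
    endProj i (endProj j D) = if i = j then endProj j D else 0 := by
  have h2 : (1 : ZMod 2) + 1 = 0 := by decide
  ext x
  rcases zmod_two_cases i with rfl | rfl <;> rcases zmod_two_cases j with rfl | rfl <;> simp [endProj_apply, proj_proj, h2]

theorem endProj_mul (i j : ZMod 2) (D E : Module.End ℂ A) :
    endProj (i + j) (endProj i D * endProj j E) = endProj i D * endProj j E := by
  have h2 : (1 : ZMod 2) + 1 = 0 := by decide
  ext x
  rcases zmod_two_cases i with rfl | rfl <;> rcases zmod_two_cases j with rfl | rfl <;> simp [endProj_apply, proj_proj, h2, add_comm]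

/-- Endomorphisms of a super vector space, with the supercommutator. -/
instance : SuperAlgebra (Module.End ℂ A) where
  proj := endProj
  proj_proj := endProj_endProj
  proj_add D := by
    have h2 : (1 : ZMod 2) + 1 = 0 := by decide
    ext x
    have hx : D x = D (proj 0 x) + D (proj 1 x) := by rw [← map_add, proj_add]
    rw [hx, ← proj_add (D (proj 0 x)), ← proj_add (D (proj 1 x))]
    simp [endProj_apply, h2]
    abel
  br := superComm
  proj_br i j D E := by
    have h : ∀ i' j' : ZMod 2, endProj (i + j)
        (endProj i' (endProj i D) * endProj j' (endProj j E) -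
          superSign i' j' • (endProj j' (endProj j E) * endProj i' (endProj i D))) =
        endProj i' (endProj i D) * endProj j' (endProj j E) -
          superSign i' j' • (endProj j' (endProj j E) * endProj i' (endProj i D)) := by
      intro i' j'
      rw [endProj_endProj, endProj_endProj]
      split_ifs with h1 h2
      · subst h1 h2
        rw [map_sub, map_smul, endProj_mul, add_comm i' j', endProj_mul]
      all_goals simp
    simp only [superComm, LinearMap.mk₂_apply, map_sum, h]

/-- `D` is a derivation of parity `i` of the superalgebra `A`. -/
def IsSuperDerivation (i : ZMod 2) (D : Module.End ℂ A) : Prop :=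
  (∀ (j : ZMod 2) (x : A), x ∈ gr A j → D x ∈ gr A (i + j)) ∧
  ∀ (j : ZMod 2) (x y : A), x ∈ gr A j →
    D (br x y) = br (D x) y + superSign i j • br x (D y)

end Derivations

/-! ## The Yang-Mills algebra and its supersymmetries -/

/-- `Γ`-matrices of a SUSY data with `dim V = n` and `dim S = s`, in an orthonormal basis of `V`:
`lo i α β` is `Γ^i_{αβ}` and `up i α β` is `Γ^{αβ i}`. -/
structure GammaMatrices (n s : ℕ) where
  lo : Fin n → Matrix (Fin s) (Fin s) ℂ
  up : Fin n → Matrix (Fin s) (Fin s) ℂ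
  lo_symm : ∀ i, (lo i)ᵀ = lo i
  up_symm : ∀ i, (up i)ᵀ = up i
  clifford : ∀ i j, lo i * up j + lo j * up i = if i = j then 1 else 0

namespace GammaMatrices

variable {n s : ℕ}

/-- The parities of the generators `A_1, …, A_n` (even) and `ψ^1, …, ψ^s` (odd). -/
def par (n s : ℕ) : Fin n ⊕ Fin s → ZMod 2 := Sum.elim (fun _ => 0) (fun _ => 1)

/-- The generator `A_i` of the free Lie superalgebra. -/
def freeA (n s : ℕ) (i : Fin n) : FreeLieSuper (par n s) := FreeLieSuper.of _ (Sum.inl i)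

/-- The generator `ψ^α` of the free Lie superalgebra. -/
def freePsi (n s : ℕ) (α : Fin s) : FreeLieSuper (par n s) := FreeLieSuper.of _ (Sum.inr α)

/-- The relation `∑ [A_i, [A_i, A_m]] - (1/2) ∑ Γ^m_{αβ} {ψ^α, ψ^β}`. -/
def relA (G : GammaMatrices n s) (m : Fin n) : FreeLieSuper (par n s) :=
  ∑ i, br (freeA n s i) (br (freeA n s i) (freeA n s m)) -
    (1 / 2 : ℂ) • ∑ α, ∑ β, G.lo m α β • br (freePsi n s α) (freePsi n s β)

/-- The relation `∑ Γ^i_{αβ} [A_i, ψ^β]`. -/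
def relPsi (G : GammaMatrices n s) (α : Fin s) : FreeLieSuper (par n s) :=
  ∑ i, ∑ β, G.lo i α β • br (freeA n s i) (freePsi n s β)

/-- The ideal of relations of the Yang-Mills algebra. -/
def ymIdeal (G : GammaMatrices n s) : SuperIdeal (FreeLieSuper (par n s)) :=
  SuperIdeal.span (Set.range G.relA ∪ Set.range G.relPsi)

/-- The Yang-Mills algebra. -/
abbrev YM (G : GammaMatrices n s) : Type := G.ymIdeal.Quotient

/-- The generator `A_i` of the Yang-Mills algebra. -/
def A (G : GammaMatrices n s) (i : Fin n) : G.YM := G.ymIdeal.toQuot (freeA n s i)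

/-- The generator `ψ^α` of the Yang-Mills algebra. -/
def psi (G : GammaMatrices n s) (α : Fin s) : G.YM := G.ymIdeal.toQuot (freePsi n s α)

/-- The supersymmetry `θ_α`: the odd derivation of the Yang-Mills algebra with
`θ_α(A_i) = Γ_{αβ i} ψ^β` and `θ_α(ψ^β) = -(1/2) Γ_α^{β ij} [A_i, A_j]`, where
`Γ_α^{β ij} = Γ^i_{αγ} Γ^{γβ j} - Γ^j_{αγ} Γ^{γβ i}`. -/
def IsSupersymmetry (G : GammaMatrices n s) (α : Fin s) (D : Module.End ℂ G.YM) : Prop :=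
  IsSuperDerivation 1 D ∧
  (∀ i, D (G.A i) = ∑ β, G.lo i α β • G.psi β) ∧
  ∀ β, D (G.psi β) = -(1 / 2 : ℂ) •
    ∑ i, ∑ j, (G.lo i * G.up j - G.lo j * G.up i) α β • br (G.A i) (G.A j)

/-- The algebra of supersymmetries: the Lie superalgebra of operators (with the
supercommutator) generated by the derivations `θ_α` of the Yang-Mills algebra. -/
def susy (G : GammaMatrices n s) : SubSuperalgebra (Module.End ℂ G.YM) :=
  SubSuperalgebra.closure {D | ∃ α, G.IsSupersymmetry α D}

end GammaMatrices

/-! ## Two odd generators and the quintic relations -/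

/-- The free Lie superalgebra on the odd two-dimensional space `ΠW`. -/
abbrev FreeW : Type := FreeLieSuper (fun _ : Fin 2 => (1 : ZMod 2))

/-- The basis `w_α` of `ΠW`. -/
def wFree (α : Fin 2) : FreeW := FreeLieSuper.of _ α

/-- The element `z_α = ε^{ββ'} ε^{γγ'} {w_β, {w_β', {w_γ, {w_γ', w_α}}}}`, where `ε^{αβ}` is the
matrix inverse to `ε_{αβ}`. -/
def quintic (ε : Matrix (Fin 2) (Fin 2) ℂ) (α : Fin 2) : FreeW :=
  ∑ β, ∑ β', ∑ γ, ∑ γ', (ε⁻¹ β β' * ε⁻¹ γ γ') •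
    br (wFree β) (br (wFree β') (br (wFree γ) (br (wFree γ') (wFree α))))

/-- The ideal generated by the quintic relations. -/
def quinticIdeal (ε : Matrix (Fin 2) (Fin 2) ℂ) : SuperIdeal FreeW :=
  SuperIdeal.span (Set.range (quintic ε))

/-- The quotient `Free(ΠW) / I`. -/
abbrev FreeWModI (ε : Matrix (Fin 2) (Fin 2) ℂ) : Type := (quinticIdeal ε).Quotient

/-- The class of `w_α` in `Free(ΠW) / I`. -/
def wBar (ε : Matrix (Fin 2) (Fin 2) ℂ) (α : Fin 2) : FreeWModI ε :=
  (quinticIdeal ε).toQuot (wFree α)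

/-- `Ã_{αβ} = {w_α, w_β}`. -/
def ATilde (ε : Matrix (Fin 2) (Fin 2) ℂ) (α β : Fin 2) : FreeWModI ε :=
  br (wBar ε α) (wBar ε β)

/-- `χ̃^α = ε^{αδ} ε^{βγ} [w_β, Ã_{γδ}]`. -/
def chiTildeUp (ε : Matrix (Fin 2) (Fin 2) ℂ) (α : Fin 2) : FreeWModI ε :=
  ∑ δ, ∑ β, ∑ γ, (ε⁻¹ α δ * ε⁻¹ β γ) • br (wBar ε β) (ATilde ε γ δ)

/-- `χ̃_α = ε_{αβ} χ̃^β`. -/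
def chiTilde (ε : Matrix (Fin 2) (Fin 2) ℂ) (α : Fin 2) : FreeWModI ε :=
  ∑ β, ε α β • chiTildeUp ε β

namespace GammaMatrices

/-- The generators `A_{αβ} = -2 Γ^i_{αβ} A_i` of the Yang-Mills algebra in dimension three. -/
def ASpinor (G : GammaMatrices 3 2) (α β : Fin 2) : G.YM :=
  ∑ i, (-2 * G.lo i α β) • G.A i

/-- The generators `χ_α = κ ε_{αβ} ψ^β` of the Yang-Mills algebra in dimension three, with the
(nonzero) constant `κ = -2 det(ε^{αβ}) ∑ det Γ^i`. -/
def chi (G : GammaMatrices 3 2) (ε : Matrix (Fin 2) (Fin 2) ℂ) (α : Fin 2) : G.YM :=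
  (-2 * (ε⁻¹).det * ∑ i, (G.lo i).det) • ∑ β, ε α β • G.psi β

end GammaMatrices

end

/-! Write X, C, Y for `ASpinor 0 0`, `ASpinor 0 1`, `ASpinor 1 1`, and p, q for the two spinor
generators rescaled. In these coordinates YM is presented by `SpinorRelations`. For odd elements x =
w_0, y = w_1 put X = {x,x}, C = {x,y}, Y = {y,y}, p = [x,C], q = [y,C]. Up to a nonzero factor z_0
is then the Dirac equation [X,q] + [C,p], z_1 is its mirror image, and the three vector equations
follow by applying ad x and ad y. This gives ι.

Conversely, the formulas for ad x and ad y on X, C, Y, p, q define odd derivations D and E of YM.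
These are the supersymmetries, and they satisfy [D,D] = ad X, [D,E] = ad C, [E,E] = ad Y. The
quintic elements in D, E are therefore ad of the Dirac equations, hence zero. This gives Φ, with Φ ∘
ι = ad. Since ι intertwines D, E with ad x, ad y, the algebra Free(ΠW)/I is the sum of span(w_0,
w_1) and ι(YM).

Injectivity of both ι and Φ is thus reduced to one statement (`FiberAlgebra.faithful`): a D + b E +
ad y = 0 on YM forces a = b = 0 and y = 0. Setting C = 0 in Free(ΠW)/I leaves only x, y, X, Y, which
suggests the letters ad(x)^n c, ad(y)^(n+1) c, ad(x) ad(y) c. The free Lie superalgebra F on these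
letters carries two odd derivations satisfying the quintic relations, so Free(ΠW)/I acts on F by
some Ψ; it also maps to YM by some κ with c ↦ C. The composite Ψ ∘ ι ∘ κ is the adjoint
representation of F, which is faithful because a free Lie superalgebra on at least two generators
has trivial center. So κ is injective. Moreover YM = ℂX + ℂY + κ(F), and for y = uX + vY + κ(k) the
relation pulls back to a D + b E + 2u D² + 2v E² + ad k = 0 on F. In the abelianization of F it
yields a = b = u = v = 0; then k is central, hence zero.

The center is computed without the Poincaré-Birkhoff-Witt theorem, from the action on words by left
multiplication and the Dynkin-Specht-Wever identity. -/

set_option linter.unusedSectionVars false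

open SuperAlgebra

noncomputable section

/-! ## Generalities on superalgebras -/

section General

variable {A B C : Type*} [AddCommGroup A] [Module ℂ A] [SuperAlgebra A]
  [AddCommGroup B] [Module ℂ B] [SuperAlgebra B] [AddCommGroup C] [Module ℂ C] [SuperAlgebra C]

theorem zmod_two_one_add_one : (1 : ZMod 2) + 1 = 0 := by decide

theorem superSign_zero_left (j : ZMod 2) : superSign 0 j = 1 := by simp [superSign]

theorem superSign_zero_right (j : ZMod 2) : superSign j 0 = 1 := by simp [superSign]

theorem superSign_one_one : superSign 1 1 = -1 := by simp [superSign]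

namespace SuperAlgebra

theorem proj_of_mem {i j : ZMod 2} {x : A} (hx : x ∈ gr A j) :
    proj i x = if i = j then x else 0 := by
  rw [← mem_gr.1 hx, proj_proj]

theorem proj_zero_br (x y : A) :
    proj 0 (br x y) = br (proj 0 x) (proj 0 y) + br (proj 1 x) (proj 1 y) := by
  conv_lhs => rw [← proj_add x, ← proj_add y]
  simp only [map_add, LinearMap.add_apply]
  rw [proj_of_mem (br_mem (proj_mem 0 x) (proj_mem 0 y)),
    proj_of_mem (br_mem (proj_mem 0 x) (proj_mem 1 y)),
    proj_of_mem (br_mem (proj_mem 1 x) (proj_mem 0 y)),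
    proj_of_mem (br_mem (proj_mem 1 x) (proj_mem 1 y))]
  simp [zmod_two_one_add_one]

theorem proj_one_br (x y : A) :
    proj 1 (br x y) = br (proj 0 x) (proj 1 y) + br (proj 1 x) (proj 0 y) := by
  conv_lhs => rw [← proj_add x, ← proj_add y]
  simp only [map_add, LinearMap.add_apply]
  rw [proj_of_mem (br_mem (proj_mem 0 x) (proj_mem 0 y)),
    proj_of_mem (br_mem (proj_mem 0 x) (proj_mem 1 y)),
    proj_of_mem (br_mem (proj_mem 1 x) (proj_mem 0 y)),
    proj_of_mem (br_mem (proj_mem 1 x) (proj_mem 1 y))]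
  simp [zmod_two_one_add_one]
  abel

/-- Two linear maps which agree on homogeneous elements are equal. -/
theorem linearMap_ext_gr {M : Type*} [AddCommGroup M] [Module ℂ M] {f g : A →ₗ[ℂ] M}
    (h : ∀ i, ∀ x ∈ gr A i, f x = g x) : f = g := by
  ext x
  rw [← proj_add x, map_add, map_add, h 0 _ (proj_mem 0 x), h 1 _ (proj_mem 1 x)]

/-- A set generates a superalgebra if every subspace containing it and closed under products of
homogeneous elements is everything. -/
def Generates (s : Set A) : Prop :=
  ∀ S : Submodule ℂ A, s ⊆ S →
    (∀ i j x y, x ∈ gr A i → y ∈ gr A j → x ∈ S → y ∈ S → br x y ∈ S) → S = ⊤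

/-- A subspace closed only under products of homogeneous elements is replaced by the elements whose
two components both lie in it. That subspace is closed under all products, because each component of
a product is a sum of products of components. -/
theorem generates_of_homogeneous {s : Set A} (hs : ∀ x ∈ s, ∃ i, x ∈ gr A i)
    (h : ∀ S : Submodule ℂ A, s ⊆ S → (∀ x y, x ∈ S → y ∈ S → br x y ∈ S) → S = ⊤) :
    Generates s := by
  intro S hsS hS
  have := h (S.comap (proj 0) ⊓ S.comap (proj 1)) ?_ ?_
  · rw [eq_top_iff]
    intro x _
    have hx : x ∈ S.comap (proj 0) ⊓ S.comap (proj 1) := this ▸ Submodule.mem_top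
    rw [← proj_add x]
    exact S.add_mem hx.1 hx.2
  · intro x hx
    obtain ⟨i, hi⟩ := hs x hx
    constructor <;> simp only [Submodule.mem_comap, SetLike.mem_coe, proj_of_mem hi] <;>
      split_ifs <;> first | exact hsS hx | exact S.zero_mem
  · rintro x y ⟨hx0, hx1⟩ ⟨hy0, hy1⟩
    constructor
    · change proj 0 _ ∈ S
      rw [proj_zero_br]
      exact S.add_mem (hS _ _ _ _ (proj_mem _ _) (proj_mem _ _) hx0 hy0)
        (hS _ _ _ _ (proj_mem _ _) (proj_mem _ _) hx1 hy1)
    · change proj 1 _ ∈ S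
      rw [proj_one_br]
      exact S.add_mem (hS _ _ _ _ (proj_mem _ _) (proj_mem _ _) hx0 hy1)
        (hS _ _ _ _ (proj_mem _ _) (proj_mem _ _) hx1 hy0)

end SuperAlgebra

/-! ### Homomorphisms, kernels and quotients. -/

namespace SuperHom

theorem map_gr (f : SuperHom A B) {i : ZMod 2} {x : A} (hx : x ∈ gr A i) : f x ∈ gr B i := by
  rw [mem_gr] at hx ⊢
  rw [← f.map_proj, hx]

/-- A linear map which preserves parities and products is a homomorphism. -/
def ofGr (f : A →ₗ[ℂ] B) (hgr : ∀ i x, x ∈ gr A i → f x ∈ gr B i)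
    (hbr : ∀ i j x y, x ∈ gr A i → y ∈ gr A j → f (br x y) = br (f x) (f y)) : SuperHom A B where
  toLin := f
  map_proj i x := by
    have h0 := hgr 0 _ (proj_mem 0 x)
    have h1 := hgr 1 _ (proj_mem 1 x)
    conv_rhs => rw [← proj_add x, map_add, map_add, proj_of_mem h0, proj_of_mem h1]
    rcases zmod_two_cases i with rfl | rfl <;> simp
  map_br x y := by
    conv_lhs => rw [← proj_add x, ← proj_add y]
    conv_rhs => rw [← proj_add x, ← proj_add y]
    simp only [map_add, LinearMap.add_apply]
    rw [hbr _ _ _ _ (proj_mem 0 x) (proj_mem 0 y), hbr _ _ _ _ (proj_mem 0 x) (proj_mem 1 y),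
      hbr _ _ _ _ (proj_mem 1 x) (proj_mem 0 y), hbr _ _ _ _ (proj_mem 1 x) (proj_mem 1 y)]

/-- Composition of homomorphisms. -/
def comp (g : SuperHom B C) (f : SuperHom A B) : SuperHom A C where
  toLin := g.toLin ∘ₗ f.toLin
  map_proj i x := by simp [f.map_proj, g.map_proj]
  map_br x y := by simp [f.map_br, g.map_br]

theorem comp_apply (g : SuperHom B C) (f : SuperHom A B) (x : A) : (g.comp f) x = g (f x) := rfl

theorem eq_of_generates {s : Set A} (hs : Generates s) {f g : SuperHom A B}
    (h : ∀ x ∈ s, f x = g x) (x : A) : f x = g x := by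
  have := hs (LinearMap.eqLocus f.toLin g.toLin) h (by
    intro i j x y _ _ hx hy
    rw [LinearMap.mem_eqLocus] at *
    rw [f.map_br, g.map_br, hx, hy])
  exact (this ▸ Submodule.mem_top : x ∈ LinearMap.eqLocus f.toLin g.toLin)

theorem generates_image {s : Set A} (hs : Generates s) (f : SuperHom A B)
    (hf : Function.Surjective f) : Generates (f '' s) := by
  intro S hsS hS
  have := hs (S.comap f.toLin) (fun x hx => hsS ⟨x, hx, rfl⟩) (by
    intro i j x y hi hj hx hy
    rw [Submodule.mem_comap] at *
    rw [f.map_br]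
    exact hS i j _ _ (f.map_gr hi) (f.map_gr hj) hx hy)
  rw [eq_top_iff]
  intro y _
  obtain ⟨x, rfl⟩ := hf y
  exact (this ▸ Submodule.mem_top : x ∈ S.comap f.toLin)

end SuperHom

namespace SuperIdeal

/-- The projection onto a quotient, as a homomorphism. -/
def toQuotHom (I : SuperIdeal A) : SuperHom A I.Quotient where
  toLin := I.toQuot
  map_proj _ _ := rfl
  map_br _ _ := rfl

theorem toQuot_mem_gr (I : SuperIdeal A) {i : ZMod 2} {x : A} (hx : x ∈ gr A i) :
    I.toQuot x ∈ gr I.Quotient i := I.toQuotHom.map_gr hx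

/-- The kernel of a homomorphism. -/
def ker (f : SuperHom A B) : SuperIdeal A where
  carrier := LinearMap.ker f.toLin
  proj_mem' i x hx := by
    rw [LinearMap.mem_ker] at *
    rw [f.map_proj, hx, map_zero]
  br_left' x y hy := by
    rw [LinearMap.mem_ker] at *
    rw [f.map_br, hy, map_zero]
  br_right' x y hx := by
    rw [LinearMap.mem_ker] at *
    rw [f.map_br, hx, map_zero, LinearMap.zero_apply]

/-- The homomorphism from a quotient induced by one which kills the ideal's generators. -/
def liftSpan {s : Set A} (f : SuperHom A B) (h : ∀ x ∈ s, f x = 0) :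
    SuperHom (span s).Quotient B where
  toLin := (span s).carrier.liftQ f.toLin (span_le (J := ker f) h)
  map_proj i x := by
    obtain ⟨x, rfl⟩ := (span s).toQuot_surjective x
    exact f.map_proj i x
  map_br x y := by
    obtain ⟨x, rfl⟩ := (span s).toQuot_surjective x
    obtain ⟨y, rfl⟩ := (span s).toQuot_surjective y
    exact f.map_br x y

theorem toQuot_eq_zero_of_mem {s : Set A} {x : A} (hx : x ∈ s) : (span s).toQuot x = 0 :=
  toQuot_eq_zero.2 (subset_span s hx)

end SuperIdeal

/-! ## Skew symmetry and the Jacobi identity by parities -/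

namespace LieSuperalgebra

variable [LieSuperalgebra A]

theorem br_even_left {x : A} (hx : x ∈ gr A 0) (y : A) : br x y = -br y x := by
  rw [← proj_add y, map_add, map_add, LinearMap.add_apply,
    skew 0 0 _ _ hx (proj_mem 0 y), skew 0 1 _ _ hx (proj_mem 1 y)]
  simp only [superSign_zero_left, one_smul, neg_add]

theorem br_odd_odd {x y : A} (hx : x ∈ gr A 1) (hy : y ∈ gr A 1) : br x y = br y x := by
  rw [skew 1 1 _ _ hx hy, superSign_one_one]
  simp

theorem br_self_even {x : A} (hx : x ∈ gr A 0) : br x x = 0 := by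
  have h := br_even_left hx x
  have h2 : (2 : ℂ) • br x x = 0 := by
    rw [two_smul]
    nth_rewrite 1 [h]
    simp
  simpa using h2

/-- The sign does not involve the parity of the third argument, so that argument may be
inhomogeneous. This turns Jacobi into an identity between operators. -/
theorem jacobi' (i j : ZMod 2) (x y z : A) (hx : x ∈ gr A i) (hy : y ∈ gr A j) :
    br x (br y z) = br (br x y) z + superSign i j • br y (br x z) := by
  rw [← proj_add z]
  simp only [map_add]
  rw [jacobi i j 0 _ _ _ hx hy (proj_mem 0 z), jacobi i j 1 _ _ _ hx hy (proj_mem 1 z), smul_add]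
  abel

theorem jacobi_even_left {i : ZMod 2} {x y : A} (hx : x ∈ gr A 0) (hy : y ∈ gr A i) (z : A) :
    br x (br y z) = br (br x y) z + br y (br x z) := by
  rw [jacobi' 0 i x y z hx hy, superSign_zero_left, one_smul]

theorem jacobi_even_right {i : ZMod 2} {x y : A} (hx : x ∈ gr A i) (hy : y ∈ gr A 0) (z : A) :
    br x (br y z) = br (br x y) z + br y (br x z) := by
  rw [jacobi' i 0 x y z hx hy, superSign_zero_right, one_smul]

theorem jacobi_odd_odd {x y : A} (hx : x ∈ gr A 1) (hy : y ∈ gr A 1) (z : A) :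
    br x (br y z) = br (br x y) z - br y (br x z) := by
  rw [jacobi' 1 1 x y z hx hy, superSign_one_one, neg_one_smul, sub_eq_add_neg]

end LieSuperalgebra

/-! ## Free Lie superalgebras -/

namespace FreeLieSuper

variable {X : Type*} (p : X → ZMod 2)

theorem _root_.FreeSuper.of_mem_gr (x : X) : FreeSuper.of p x ∈ gr (FreeSuper p) (p x) := by
  rw [mem_gr]
  change FreeSuper.projection p (p x) _ = _
  rw [FreeSuper.projection_apply, FreeSuper.parityAut_of, smul_smul, FreeSuper.sgn_mul_self]
  module

theorem _root_.FreeSuper.eq_top (S : Submodule ℂ (FreeSuper p)) (hof : ∀ x, FreeSuper.of p x ∈ S)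
    (hS : ∀ x y, x ∈ S → y ∈ S → br x y ∈ S) : S = ⊤ := by
  let S' : NonUnitalSubalgebra ℂ (FreeSuper p) :=
    { S with mul_mem' := fun {a b} ha hb => hS a b ha hb }
  let f : FreeSuper p →ₙₐ[ℂ] S' :=
    FreeNonUnitalNonAssocAlgebra.lift ℂ (fun x => (⟨FreeSuper.of p x, hof x⟩ : S'))
  have h : (NonUnitalSubalgebraClass.subtype S').comp f = NonUnitalAlgHom.id ℂ (FreeSuper p) := by
    apply FreeNonUnitalNonAssocAlgebra.hom_ext
    intro x
    change ((f (FreeSuper.of p x) : S') : FreeSuper p) = FreeSuper.of p x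
    have : f (FreeSuper.of p x) = ⟨FreeSuper.of p x, hof x⟩ :=
      FreeNonUnitalNonAssocAlgebra.lift_of_apply ℂ _ x
    rw [this]
  rw [eq_top_iff]
  intro x _
  have hx : ((f x : S') : FreeSuper p) = x := congrArg (fun g => g x) h
  rw [← hx]
  exact (f x).2

theorem _root_.FreeSuper.generates : Generates (Set.range (FreeSuper.of p)) := by
  apply generates_of_homogeneous
  · rintro _ ⟨x, rfl⟩
    exact ⟨p x, FreeSuper.of_mem_gr p x⟩
  · intro S hs hS
    exact FreeSuper.eq_top p S (fun x => hs ⟨x, rfl⟩) hS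

theorem of_mem_gr (x : X) : of p x ∈ gr (FreeLieSuper p) (p x) :=
  (lieIdeal p).toQuot_mem_gr (FreeSuper.of_mem_gr p x)

theorem generates : Generates (Set.range (of p)) := by
  have := SuperHom.generates_image (FreeSuper.generates p) (lieIdeal p).toQuotHom
    (lieIdeal p).toQuot_surjective
  rwa [← Set.range_comp] at this

variable {p}

/-- The linear map underlying the homomorphism from the free superalgebra. -/
def freeLiftLin (f : X → B) : FreeSuper p →ₗ[ℂ] B :=
  -- The bracket of `B` is made a multiplication only locally, to apply the universal property of
  -- the free nonassociative algebra.
  letI : NonUnitalNonAssocSemiring B :=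
    { (inferInstance : AddCommGroup B) with
      mul := fun x y => br x y
      left_distrib := fun x y z => map_add (br x) y z
      right_distrib := fun x y z => LinearMap.map_add₂ br x y z
      zero_mul := fun x => LinearMap.map_zero₂ br x
      mul_zero := fun x => map_zero (br x) }
  haveI : IsScalarTower ℂ B B := ⟨fun c x y => LinearMap.map_smul₂ br c x y⟩
  haveI : SMulCommClass ℂ B B := ⟨fun c x y => (map_smul (br x) c y).symm⟩
  ((FreeNonUnitalNonAssocAlgebra.lift ℂ f : FreeNonUnitalNonAssocAlgebra ℂ X →ₙₐ[ℂ] B) :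
    FreeNonUnitalNonAssocAlgebra ℂ X →ₗ[ℂ] B)

theorem freeLiftLin_of (f : X → B) (x : X) : freeLiftLin f (FreeSuper.of p x) = f x :=
  letI : NonUnitalNonAssocSemiring B :=
    { (inferInstance : AddCommGroup B) with
      mul := fun x y => br x y
      left_distrib := fun x y z => map_add (br x) y z
      right_distrib := fun x y z => LinearMap.map_add₂ br x y z
      zero_mul := fun x => LinearMap.map_zero₂ br x
      mul_zero := fun x => map_zero (br x) }
  haveI : IsScalarTower ℂ B B := ⟨fun c x y => LinearMap.map_smul₂ br c x y⟩
  haveI : SMulCommClass ℂ B B := ⟨fun c x y => (map_smul (br x) c y).symm⟩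
  FreeNonUnitalNonAssocAlgebra.lift_of_apply ℂ f x

theorem freeLiftLin_br (f : X → B) (x y : FreeSuper p) :
    freeLiftLin f (br x y) = br (freeLiftLin f x) (freeLiftLin f y) :=
  letI : NonUnitalNonAssocSemiring B :=
    { (inferInstance : AddCommGroup B) with
      mul := fun x y => br x y
      left_distrib := fun x y z => map_add (br x) y z
      right_distrib := fun x y z => LinearMap.map_add₂ br x y z
      zero_mul := fun x => LinearMap.map_zero₂ br x
      mul_zero := fun x => map_zero (br x) }
  haveI : IsScalarTower ℂ B B := ⟨fun c x y => LinearMap.map_smul₂ br c x y⟩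
  haveI : SMulCommClass ℂ B B := ⟨fun c x y => (map_smul (br x) c y).symm⟩
  map_mul (FreeNonUnitalNonAssocAlgebra.lift ℂ f : FreeNonUnitalNonAssocAlgebra ℂ X →ₙₐ[ℂ] B) x y

/-- The homomorphism from the free superalgebra given by homogeneous values on the generators. -/
def freeLift (f : X → B) (hf : ∀ x, f x ∈ gr B (p x)) : SuperHom (FreeSuper p) B where
  toLin := freeLiftLin f
  map_br := freeLiftLin_br f
  map_proj := by
    -- Both projections are treated at once: each component of a product involves the even and the
    -- odd components of the factors.
    have h : LinearMap.eqLocus (freeLiftLin f ∘ₗ proj (A := FreeSuper p) 0)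
          (proj 0 ∘ₗ freeLiftLin f) ⊓
        LinearMap.eqLocus (freeLiftLin f ∘ₗ proj (A := FreeSuper p) 1)
          (proj 1 ∘ₗ freeLiftLin f) = ⊤ := by
      apply FreeSuper.eq_top
      · intro x
        constructor <;>
        · rw [SetLike.mem_coe, LinearMap.mem_eqLocus, LinearMap.comp_apply, LinearMap.comp_apply,
            freeLiftLin_of, proj_of_mem (hf x), proj_of_mem (FreeSuper.of_mem_gr p x)]
          split_ifs <;> simp [freeLiftLin_of]
      · rintro x y ⟨hx0, hx1⟩ ⟨hy0, hy1⟩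
        simp only [SetLike.mem_coe, LinearMap.mem_eqLocus, LinearMap.comp_apply] at hx0 hx1 hy0 hy1
        constructor <;>
          simp only [SetLike.mem_coe, LinearMap.mem_eqLocus, LinearMap.comp_apply, proj_zero_br,
            proj_one_br, freeLiftLin_br, map_add, hx0, hx1, hy0, hy1]
    intro i x
    have hx := h.symm ▸ (Submodule.mem_top : x ∈ (⊤ : Submodule ℂ (FreeSuper p)))
    rcases zmod_two_cases i with rfl | rfl
    · exact hx.1
    · exact hx.2

/-- The universal property of the free Lie superalgebra. -/
def lift [LieSuperalgebra B] (f : X → B) (hf : ∀ x, f x ∈ gr B (p x)) :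
    SuperHom (FreeLieSuper p) B :=
  SuperIdeal.liftSpan (freeLift f hf) (by
    rintro _ (⟨i, j, x, y, hx, hy, rfl⟩ | ⟨i, j, k, x, y, z, hx, hy, hz, rfl⟩)
    · rw [map_add, map_smul, (freeLift f hf).map_br, (freeLift f hf).map_br,
        LieSuperalgebra.skew i j _ _ ((freeLift f hf).map_gr hx) ((freeLift f hf).map_gr hy)]
      simp
    · simp only [map_sub, map_add, map_smul, (freeLift f hf).map_br]
      rw [LieSuperalgebra.jacobi i j k _ _ _ ((freeLift f hf).map_gr hx)
        ((freeLift f hf).map_gr hy) ((freeLift f hf).map_gr hz), sub_self])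

theorem lift_of [LieSuperalgebra B] (f : X → B) (hf : ∀ x, f x ∈ gr B (p x)) (x : X) :
    lift f hf (of p x) = f x :=
   freeLiftLin_of f x

end FreeLieSuper

/-! ## The Lie superalgebra of endomorphisms -/

/-- The supercommutator is a double sum over components; on homogeneous operators a single term
survives. -/
theorem br_end_eq {i j : ZMod 2} {D E : Module.End ℂ A} (hD : D ∈ gr (Module.End ℂ A) i)
    (hE : E ∈ gr (Module.End ℂ A) j) : br D E = D * E - superSign i j • (E * D) := by
  have hD' : ∀ k, endProj k D = if k = i then D else 0 := fun k => proj_of_mem (i := k) hD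
  have hE' : ∀ k, endProj k E = if k = j then E else 0 := fun k => proj_of_mem (i := k) hE
  change superComm D E = _
  rw [superComm, LinearMap.mk₂_apply]
  rw [Fintype.sum_eq_single i, Fintype.sum_eq_single j]
  · simp [hD', hE']
  · intro k hk
    simp [hE', hk]
  · intro k hk
    refine Finset.sum_eq_zero fun l _ => ?_
    simp [hD', hk]

theorem mem_gr_end {i : ZMod 2} {D : Module.End ℂ A}
    (h : ∀ j, ∀ x ∈ gr A j, D x ∈ gr A (i + j)) : D ∈ gr (Module.End ℂ A) i := by
  rw [mem_gr]
  refine linearMap_ext_gr fun j x hx => ?_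
  change endProj i D x = D x
  rw [endProj_apply, proj_of_mem hx, proj_of_mem hx]
  rcases zmod_two_cases j with rfl | rfl
  · have := h 0 x hx
    rw [add_zero] at this
    simp [mem_gr.1 this]
  · simp [mem_gr.1 (h 1 x hx)]

theorem end_apply_mem {i j : ZMod 2} {D : Module.End ℂ A} (hD : D ∈ gr (Module.End ℂ A) i)
    {x : A} (hx : x ∈ gr A j) : D x ∈ gr A (i + j) := by
  rw [mem_gr] at hD
  have h : endProj i D x = D x := congrArg (fun f => f x) hD
  rw [endProj_apply, proj_of_mem hx, proj_of_mem hx] at h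
  rcases zmod_two_cases j with rfl | rfl
  · rw [← h]
    simpa using proj_mem i (D x)
  · rw [← h]
    simpa using proj_mem (i + 1) (D x)

instance : LieSuperalgebra (Module.End ℂ A) where
  skew i j D E hD hE := by
    rw [br_end_eq hD hE, br_end_eq hE hD]
    rcases zmod_two_cases i with rfl | rfl <;> rcases zmod_two_cases j with rfl | rfl <;>
      simp [superSign]
  jacobi i j k D E F hD hE hF := by
    rw [br_end_eq hD (br_mem hE hF), br_end_eq (br_mem hD hE) hF, br_end_eq hE (br_mem hD hF),
      br_end_eq hE hF, br_end_eq hD hE, br_end_eq hD hF]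
    rcases zmod_two_cases i with rfl | rfl <;> rcases zmod_two_cases j with rfl | rfl <;>
    rcases zmod_two_cases k with rfl | rfl <;>
      simp [superSign, zmod_two_one_add_one] <;> noncomm_ring

end General

/-! ## Derivations and dual numbers -/

section Derivations

variable {A B : Type*} [AddCommGroup A] [Module ℂ A] [SuperAlgebra A]
  [AddCommGroup B] [Module ℂ B] [SuperAlgebra B]

/-- Multiplication by the sign `(-1) ^ (i * j)` on the component of parity `j`. -/
def signTwist (i : ZMod 2) : A →ₗ[ℂ] A := proj 0 + superSign i 1 • proj 1

theorem signTwist_of_mem (i : ZMod 2) {j : ZMod 2} {x : A} (hx : x ∈ gr A j) :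
    signTwist i x = superSign i j • x := by
  rcases zmod_two_cases j with rfl | rfl <;>
    simp [signTwist, proj_of_mem hx, superSign_zero_right]

/-- The dual numbers `a + η b` over a superalgebra, where `η` has parity `i` and square zero. -/
def DualNumbers (_i : ZMod 2) (A : Type*) : Type _ := A × A

namespace DualNumbers

variable {i : ZMod 2}

/-- The element `a + η b`. -/
def mk (i : ZMod 2) (a b : A) : DualNumbers i A := (a, b)

theorem fst_mk (a b : A) : (mk i a b).1 = a := rfl

theorem snd_mk (a b : A) : (mk i a b).2 = b := rfl

instance : AddCommGroup (DualNumbers i A) := inferInstanceAs (AddCommGroup (A × A))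

instance : Module ℂ (DualNumbers i A) := inferInstanceAs (Module ℂ (A × A))

theorem ext {x y : DualNumbers i A} (h1 : x.1 = y.1) (h2 : x.2 = y.2) : x = y := Prod.ext h1 h2

theorem fst_add (x y : DualNumbers i A) : (x + y).1 = x.1 + y.1 := rfl

theorem snd_add (x y : DualNumbers i A) : (x + y).2 = x.2 + y.2 := rfl

theorem fst_sub (x y : DualNumbers i A) : (x - y).1 = x.1 - y.1 := rfl

theorem snd_sub (x y : DualNumbers i A) : (x - y).2 = x.2 - y.2 := rfl

theorem fst_smul (c : ℂ) (x : DualNumbers i A) : (c • x).1 = c • x.1 := rfl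

theorem snd_smul (c : ℂ) (x : DualNumbers i A) : (c • x).2 = c • x.2 := rfl

theorem snd_neg (x : DualNumbers i A) : (-x).2 = -x.2 := rfl

theorem fst_zero : (0 : DualNumbers i A).1 = 0 := rfl

theorem snd_zero : (0 : DualNumbers i A).2 = 0 := rfl

/-- The projection to the component of parity `k`. -/
def projection (i k : ZMod 2) : DualNumbers i A →ₗ[ℂ] DualNumbers i A :=
  LinearMap.prodMap (proj (A := A) k) (proj (A := A) (k + i))

/-- The product of dual numbers. -/
def product (i : ZMod 2) : DualNumbers i A →ₗ[ℂ] DualNumbers i A →ₗ[ℂ] DualNumbers i A :=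
  LinearMap.mk₂ ℂ
    (fun x y => mk i (br x.1 y.1) (br x.2 y.1 + br (signTwist i x.1) y.2))
    (fun x x' y => by
      apply ext <;> simp only [fst_add, snd_add, fst_mk, snd_mk, map_add, LinearMap.add_apply]
      abel)
    (fun c x y => by
      apply ext <;> simp only [fst_smul, snd_smul, fst_mk, snd_mk, map_smul, LinearMap.smul_apply, smul_add])
    (fun x y y' => by
      apply ext <;> simp only [fst_add, snd_add, fst_mk, snd_mk, map_add]
      abel)
    (fun c x y => by
      apply ext <;> simp only [fst_smul, snd_smul, fst_mk, snd_mk, map_smul, smul_add])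

instance : SuperAlgebra (DualNumbers i A) where
  proj := projection i
  proj_proj k l x := by
    have h := proj_proj k l x.1
    have h' := proj_proj (k + i) (l + i) x.2
    simp only [add_left_inj] at h'
    apply ext
    · change proj k (proj l x.1) = _
      rw [h]
      split_ifs <;> rfl
    · change proj (k + i) (proj (l + i) x.2) = _
      rw [h']
      split_ifs <;> rfl
  proj_add x := by
    apply ext
    · exact proj_add x.1
    · change proj (0 + i) x.2 + proj (1 + i) x.2 = x.2
      rcases zmod_two_cases i with rfl | rfl
      · exact proj_add x.2
      · rw [zero_add, zmod_two_one_add_one, add_comm]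
        exact proj_add x.2
  br := product i
  proj_br k l x y := by
    apply ext
    · exact proj_br k l x.1 y.1
    · change proj (k + l + i) (br (proj (k + i) x.2) (proj l y.1) +
          br (signTwist i (proj k x.1)) (proj (l + i) y.2)) = br (proj (k + i) x.2) (proj l y.1) +
          br (signTwist i (proj k x.1)) (proj (l + i) y.2)
      rw [signTwist_of_mem i (proj_mem k x.1), map_add, map_smul, LinearMap.smul_apply, map_smul]
      congr 1
      · rw [show k + l + i = (k + i) + l by ring]
        exact proj_br _ _ _ _
      · rw [show k + l + i = k + (l + i) by ring]
        rw [proj_br]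

theorem fst_br (x y : DualNumbers i A) : (br x y).1 = br x.1 y.1 := rfl

theorem snd_br (x y : DualNumbers i A) :
    (br x y).2 = br x.2 y.1 + br (signTwist i x.1) y.2 := rfl

theorem mem_gr_iff {k : ZMod 2} {x : DualNumbers i A} :
    x ∈ gr (DualNumbers i A) k ↔ x.1 ∈ gr A k ∧ x.2 ∈ gr A (k + i) := by
  simp only [mem_gr]
  exact Prod.ext_iff

theorem snd_br_of_mem {k : ZMod 2} {x : DualNumbers i A} (hx : x ∈ gr (DualNumbers i A) k)
    (y : DualNumbers i A) : (br x y).2 = br x.2 y.1 + superSign i k • br x.1 y.2 := by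
  rw [snd_br, signTwist_of_mem i (mem_gr_iff.1 hx).1, map_smul, LinearMap.smul_apply]

/-- The coefficient of η in each axiom is a sum of the same axiom in `A` with one argument replaced
by its η-coefficient, whose parity is shifted by `i`. The parities are finite in number and the
signs are compared case by case. -/
instance [LieSuperalgebra A] : LieSuperalgebra (DualNumbers i A) where
  skew k l x y hx hy := by
    obtain ⟨hx1, hx2⟩ := mem_gr_iff.1 hx
    obtain ⟨hy1, hy2⟩ := mem_gr_iff.1 hy
    apply ext
    · exact LieSuperalgebra.skew k l _ _ hx1 hy1
    · rw [snd_neg, snd_smul, snd_br_of_mem hx, snd_br_of_mem hy,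
        LieSuperalgebra.skew _ _ _ _ hx1 hy2, LieSuperalgebra.skew _ _ _ _ hx2 hy1]
      rcases zmod_two_cases i with rfl | rfl <;> rcases zmod_two_cases k with rfl | rfl <;>
        rcases zmod_two_cases l with rfl | rfl <;>
        simp [superSign, zmod_two_one_add_one]
  jacobi k l m x y z hx hy hz := by
    obtain ⟨hx1, hx2⟩ := mem_gr_iff.1 hx
    obtain ⟨hy1, hy2⟩ := mem_gr_iff.1 hy
    obtain ⟨hz1, hz2⟩ := mem_gr_iff.1 hz
    apply ext
    · exact LieSuperalgebra.jacobi k l m _ _ _ hx1 hy1 hz1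
    · rw [snd_add, snd_smul, snd_br_of_mem hx, snd_br_of_mem hy, snd_br_of_mem hy,
        snd_br_of_mem (br_mem hx hy), snd_br_of_mem hx, snd_br_of_mem hx]
      simp only [fst_br, map_add, map_smul, LinearMap.add_apply, LinearMap.smul_apply]
      rw [LieSuperalgebra.jacobi' _ _ _ _ z.1 hx2 hy1, LieSuperalgebra.jacobi' _ _ _ _ z.1 hx1 hy2,
        LieSuperalgebra.jacobi' _ _ _ _ z.2 hx1 hy1]
      rcases zmod_two_cases i with rfl | rfl <;> rcases zmod_two_cases k with rfl | rfl <;>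
        rcases zmod_two_cases l with rfl | rfl <;>
        simp [superSign, zmod_two_one_add_one] <;> abel

end DualNumbers

/-! ### Superderivations: construction from dual numbers, uniqueness, supercommutators. -/

namespace IsSuperDerivation

/-- A homomorphism to the dual numbers which lifts the identity defines a derivation. -/
theorem exists_of_dualNumbers {s : Set A} (hs : Generates s) {i : ZMod 2}
    (g : SuperHom A (DualNumbers i A)) (h : ∀ x ∈ s, (g x).1 = x) :
    ∃ D : Module.End ℂ A, IsSuperDerivation i D ∧ ∀ x, D x = (g x).2 := by
  -- The constant term of `g` is an endomorphism fixing the generators, hence the identity;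
  -- multiplicativity of a + ηD(a) is then the Leibniz rule for D.
  have hg : ∀ x, (g x).1 = x := by
    let π : SuperHom (DualNumbers i A) A :=
      { toLin := LinearMap.fst ℂ A A
        map_proj := fun _ _ => rfl
        map_br := fun _ _ => rfl }
    let e : SuperHom A A := ⟨LinearMap.id, fun _ _ => rfl, fun _ _ => rfl⟩
    exact SuperHom.eq_of_generates hs (f := π.comp g) (g := e) h
  refine ⟨(LinearMap.snd ℂ A A ∘ₗ (g.toLin : A →ₗ[ℂ] A × A) : A →ₗ[ℂ] A), ⟨?_, ?_⟩,
    fun x => rfl⟩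
  · intro j x hx
    rw [add_comm]
    exact (DualNumbers.mem_gr_iff.1 (g.map_gr hx)).2
  · intro j x y hx
    change (g.toLin (br x y)).2 = br (g.toLin x).2 y + superSign i j • br x (g.toLin y).2
    rw [g.map_br, DualNumbers.snd_br_of_mem (g.map_gr hx), hg x, hg y]

theorem mem_gr_end {i : ZMod 2} {D : Module.End ℂ A} (hD : IsSuperDerivation i D) :
    D ∈ gr (Module.End ℂ A) i := _root_.mem_gr_end hD.1

theorem apply_br_even_left {i : ZMod 2} {D : Module.End ℂ A} (hD : IsSuperDerivation i D) {x : A}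
    (hx : x ∈ gr A 0) (y : A) : D (br x y) = br (D x) y + br x (D y) := by
  rw [hD.2 0 x y hx, superSign_zero_right, one_smul]

theorem apply_br_of_even {D : Module.End ℂ A} (hD : IsSuperDerivation 0 D) (x y : A) :
    D (br x y) = br (D x) y + br x (D y) := by
  conv_lhs => rw [← proj_add x, map_add, LinearMap.add_apply, map_add]
  rw [hD.2 0 _ y (proj_mem 0 x), hD.2 1 _ y (proj_mem 1 x), superSign_zero_left,
    superSign_zero_left, one_smul, one_smul]
  conv_rhs => rw [← proj_add x]
  simp only [map_add, LinearMap.add_apply]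
  abel

/-- Derivations intertwined by a homomorphism on generators are intertwined by it. -/
theorem intertwine {s : Set A} (hs : Generates s) {i : ZMod 2} {D : Module.End ℂ A}
    {D' : Module.End ℂ B} (hD : IsSuperDerivation i D) (hD' : IsSuperDerivation i D')
    (f : SuperHom A B) (h : ∀ x ∈ s, f (D x) = D' (f x)) (x : A) : f (D x) = D' (f x) := by
  have := hs (LinearMap.eqLocus (f.toLin ∘ₗ D) (D' ∘ₗ f.toLin)) h (by
    intro j k x y hj _ hx hy
    simp only [LinearMap.mem_eqLocus, LinearMap.comp_apply] at *
    rw [hD.2 j x y hj, map_add, map_smul, f.map_br, f.map_br, f.map_br,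
      hD'.2 j _ _ (f.map_gr hj), hx, hy])
  exact (this ▸ Submodule.mem_top : x ∈ LinearMap.eqLocus (f.toLin ∘ₗ D) (D' ∘ₗ f.toLin))

theorem eq_of_generates {s : Set A} (hs : Generates s) {i : ZMod 2} {D D' : Module.End ℂ A}
    (hD : IsSuperDerivation i D) (hD' : IsSuperDerivation i D') (h : ∀ x ∈ s, D x = D' x) :
    D = D' := by
  let f : SuperHom A A := ⟨LinearMap.id, fun _ _ => rfl, fun _ _ => rfl⟩
  exact LinearMap.ext fun x => intertwine hs hD hD' f h x

/-- The supercommutator of derivations is a derivation. -/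
theorem superComm {i j : ZMod 2} {D E : Module.End ℂ A} (hD : IsSuperDerivation i D)
    (hE : IsSuperDerivation j E) : IsSuperDerivation (i + j) (br D E) := by
  constructor
  · intro k x hx
    exact end_apply_mem (br_mem hD.mem_gr_end hE.mem_gr_end) hx
  · intro k x y hx
    rw [br_end_eq hD.mem_gr_end hE.mem_gr_end]
    simp only [LinearMap.sub_apply, Module.End.mul_apply, LinearMap.smul_apply]
    rw [hE.2 k x y hx, hD.2 k x y hx]
    simp only [map_add, map_smul]
    rw [hD.2 _ _ y (hE.1 k x hx), hE.2 _ _ y (hD.1 k x hx), hD.2 k x _ hx, hE.2 k x _ hx]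
    simp only [map_sub, map_smul, LinearMap.sub_apply, LinearMap.smul_apply]
    rcases zmod_two_cases i with rfl | rfl <;> rcases zmod_two_cases k with rfl | rfl <;>
      rcases zmod_two_cases j with rfl | rfl <;>
      simp [superSign, zmod_two_one_add_one] <;> abel

variable [LieSuperalgebra A]

theorem ad {i : ZMod 2} {x : A} (hx : x ∈ gr A i) : IsSuperDerivation i (br x) :=
  ⟨fun _ _ hy => br_mem hx hy,
    fun j y z hy => LieSuperalgebra.jacobi' i j x y z hx hy⟩

/-- The Leibniz rule read as an identity of operators. -/
theorem br_ad {i j : ZMod 2} {D : Module.End ℂ A} (hD : IsSuperDerivation i D) {x : A}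
    (hx : x ∈ gr A j) : br D (br x : Module.End ℂ A) = br (D x) := by
  rw [br_end_eq hD.mem_gr_end (ad hx).mem_gr_end]
  ext y
  simp only [LinearMap.sub_apply, Module.End.mul_apply, LinearMap.smul_apply]
  rw [hD.2 j x y hx, add_sub_cancel_right]

end IsSuperDerivation

/-- The adjoint representation. -/
def adHom (A : Type*) [AddCommGroup A] [Module ℂ A] [SuperAlgebra A] [LieSuperalgebra A] :
    SuperHom A (Module.End ℂ A) :=
  SuperHom.ofGr br (fun _ _ hx => (IsSuperDerivation.ad hx).mem_gr_end) (fun _ _ _ _ hx hy =>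
    ((IsSuperDerivation.ad hx).br_ad hy).symm)

theorem adHom_apply [LieSuperalgebra A] (x : A) : adHom A x = br x := rfl

/-- The derivation of the free Lie superalgebra with given values on the generators. -/
theorem FreeLieSuper.exists_derivation {X : Type*} {p : X → ZMod 2} (i : ZMod 2)
    (f : X → FreeLieSuper p) (hf : ∀ x, f x ∈ gr (FreeLieSuper p) (p x + i)) :
    ∃ D : Module.End ℂ (FreeLieSuper p), IsSuperDerivation i D ∧
      ∀ x, D (FreeLieSuper.of p x) = f x := by
  let v : X → DualNumbers i (FreeLieSuper p) :=
    fun x => DualNumbers.mk i (FreeLieSuper.of p x) (f x)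
  have hv : ∀ x, v x ∈ gr (DualNumbers i (FreeLieSuper p)) (p x) := fun x =>
    DualNumbers.mem_gr_iff.2 ⟨FreeLieSuper.of_mem_gr p x, hf x⟩
  let g := FreeLieSuper.lift v hv
  obtain ⟨D, hD, hDg⟩ := IsSuperDerivation.exists_of_dualNumbers (FreeLieSuper.generates p) g (by
    rintro _ ⟨x, rfl⟩
    rw [FreeLieSuper.lift_of]
    rfl)
  refine ⟨D, hD, fun x => ?_⟩
  rw [hDg, FreeLieSuper.lift_of]
  rfl

end Derivations

/-! ## Abelian superalgebras -/

/-- The super vector space with basis `ι`, where `a` has parity `p a`, and zero product. -/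
def AbelianSuper {ι : Type*} (_p : ι → ZMod 2) : Type _ := ι →₀ ℂ

namespace AbelianSuper

variable {ι : Type*} (p : ι → ZMod 2)

instance : AddCommGroup (AbelianSuper p) := inferInstanceAs (AddCommGroup (ι →₀ ℂ))

instance : Module ℂ (AbelianSuper p) := inferInstanceAs (Module ℂ (ι →₀ ℂ))

/-- The basis vectors. -/
def basis (a : ι) : AbelianSuper p := Finsupp.single a (1 : ℂ)

/-- The linear map with given values on the basis. -/
def constr {M : Type*} [AddCommGroup M] [Module ℂ M] (f : ι → M) : AbelianSuper p →ₗ[ℂ] M :=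
  Finsupp.linearCombination ℂ f

theorem constr_basis {M : Type*} [AddCommGroup M] [Module ℂ M] (f : ι → M) (a : ι) :
    constr p f (basis p a) = f a := by
  have h : Finsupp.linearCombination ℂ f (Finsupp.single a 1) = f a := by simp
  exact h

/-- The coordinates. -/
def coord (a : ι) : AbelianSuper p →ₗ[ℂ] ℂ := Finsupp.lapply a

theorem coord_basis [DecidableEq ι] (a b : ι) : coord p a (basis p b) = if b = a then 1 else 0 :=
  Finsupp.single_apply

theorem ext_coord {x y : AbelianSuper p} (h : ∀ a, coord p a x = coord p a y) : x = y :=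
  Finsupp.ext h

variable {p} in
theorem hom_ext {M : Type*} [AddCommGroup M] [Module ℂ M] {f g : AbelianSuper p →ₗ[ℂ] M}
    (h : ∀ a, f (basis p a) = g (basis p a)) : f = g := by
  have : (f : (ι →₀ ℂ) →ₗ[ℂ] M) = g := Finsupp.lhom_ext' fun a => LinearMap.ext_ring (h a)
  exact this

instance : SuperAlgebra (AbelianSuper p) where
  proj i := constr p (fun a => if i = p a then basis p a else 0)
  proj_proj i j x := by
    have : constr p (fun a => if i = p a then basis p a else 0) ∘ₗ
        constr p (fun a => if j = p a then basis p a else 0) =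
        if i = j then constr p (fun a => if j = p a then basis p a else 0) else 0 := by
      refine hom_ext fun a => ?_
      rw [LinearMap.comp_apply, constr_basis]
      by_cases hj : j = p a
      · rw [if_pos hj, constr_basis, ← hj]
        split_ifs <;> simp [constr_basis, hj]
      · rw [if_neg hj, map_zero]
        split_ifs <;> simp [constr_basis, hj]
    have := congrArg (fun f => f x) this
    simp only [LinearMap.comp_apply] at this
    rw [this]
    split_ifs <;> rfl
  proj_add x := by
    have : constr p (fun a => if 0 = p a then basis p a else 0) +
        constr p (fun a => if 1 = p a then basis p a else 0) = LinearMap.id := by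
      refine hom_ext fun a => ?_
      rw [LinearMap.add_apply, constr_basis, constr_basis]
      rcases zmod_two_cases (p a) with h | h <;> simp [h]
    exact congrArg (fun f => f x) this
  br := 0
  proj_br i j x y := by simp

theorem br_eq_zero (x y : AbelianSuper p) : br x y = 0 := rfl

theorem basis_mem_gr (a : ι) : basis p a ∈ gr (AbelianSuper p) (p a) := by
  rw [mem_gr]
  change constr p _ _ = _
  rw [constr_basis, if_pos rfl]

instance : LieSuperalgebra (AbelianSuper p) where
  skew _ _ x y _ _ := by simp [br_eq_zero]
  jacobi _ _ _ x y z _ _ _ := by simp [br_eq_zero]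

variable {p} in
theorem constr_mem_gr {B : Type*} [AddCommGroup B] [Module ℂ B] [SuperAlgebra B] {f : ι → B}
    {i : ZMod 2} (hf : ∀ a, f a ∈ gr B (i + p a)) {j : ZMod 2} {x : AbelianSuper p}
    (hx : x ∈ gr (AbelianSuper p) j) : constr p f x ∈ gr B (i + j) := by
  have h : constr p f ∘ₗ proj j = proj (i + j) ∘ₗ constr p f := by
    refine hom_ext fun a => ?_
    rw [LinearMap.comp_apply, LinearMap.comp_apply, constr_basis, proj_of_mem (basis_mem_gr p a),
      proj_of_mem (hf a)]
    simp only [add_right_inj]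
    split_ifs <;> simp [constr_basis]
  rw [mem_gr] at hx ⊢
  have := congrArg (fun f => f x) h
  simp only [LinearMap.comp_apply] at this
  rw [← this, hx]

end AbelianSuper

/-! ## The center of a free Lie superalgebra -/

namespace FreeLieSuper

variable {X : Type*} (p : X → ZMod 2)

/-- The underlying super vector space of the free associative superalgebra: it has a basis of
words. -/
abbrev Words : Type _ := AbelianSuper (fun l : List X => (l.map p).sum)

/-- The basis vector of a word. -/
abbrev word (l : List X) : Words p := AbelianSuper.basis _ l

/-- Left multiplication by a letter. -/
def leftMul (x : X) : Module.End ℂ (Words p) := AbelianSuper.constr _ (fun l => word p (x :: l))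

/-- Right multiplication by a letter. -/
def rightMul (x : X) : Module.End ℂ (Words p) := AbelianSuper.constr _ (fun l => word p (l ++ [x]))

theorem leftMul_word (x : X) (l : List X) : leftMul p x (word p l) = word p (x :: l) :=
  AbelianSuper.constr_basis _ _ l

theorem rightMul_word (x : X) (l : List X) : rightMul p x (word p l) = word p (l ++ [x]) :=
  AbelianSuper.constr_basis _ _ l

theorem leftMul_mem_gr (x : X) : leftMul p x ∈ gr (Module.End ℂ (Words p)) (p x) := by
  refine mem_gr_end fun j t ht => AbelianSuper.constr_mem_gr (fun l => ?_) ht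
  exact AbelianSuper.basis_mem_gr (fun l : List X => (l.map p).sum) (x :: l)

/-- The action of the free Lie superalgebra on words by left multiplication. -/
def wordAction : SuperHom (FreeLieSuper p) (Module.End ℂ (Words p)) :=
  lift (leftMul p) (leftMul_mem_gr p)

theorem wordAction_of (x : X) : wordAction p (of p x) = leftMul p x := lift_of _ _ x

theorem wordAction_br {i j : ZMod 2} {a b : FreeLieSuper p} (ha : a ∈ gr (FreeLieSuper p) i)
    (hb : b ∈ gr (FreeLieSuper p) j) (t : Words p) : wordAction p (br a b) t =
      wordAction p a (wordAction p b t) -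
        superSign i j • wordAction p b (wordAction p a t) := by
  rw [(wordAction p).map_br, br_end_eq ((wordAction p).map_gr ha) ((wordAction p).map_gr hb)]
  rfl

/-- Induction over the free Lie superalgebra for predicates defining a subspace. -/
theorem induction {P : FreeLieSuper p → Prop} (hadd : ∀ a b, P a → P b → P (a + b))
    (hsmul : ∀ (c : ℂ) a, P a → P (c • a)) (hof : ∀ x, P (of p x))
    (hbr : ∀ i j a b, a ∈ gr (FreeLieSuper p) i → b ∈ gr (FreeLieSuper p) j → P a → P b →
      P (br a b)) (h0 : P 0) (l : FreeLieSuper p) : P l := by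
  let S : Submodule ℂ (FreeLieSuper p) :=
    { carrier := {l | P l}
      add_mem' := fun ha hb => hadd _ _ ha hb
      zero_mem' := h0
      smul_mem' := fun c _ ha => hsmul c _ ha }
  have : S = ⊤ := generates p S (by rintro _ ⟨x, rfl⟩; exact hof x) hbr
  exact (this ▸ Submodule.mem_top : l ∈ S)

/-- Left and right multiplications commute. Hence the action of an element on any word is determined
by its value on the empty word, which plays the role of its image in the free associative algebra.
-/
theorem wordAction_rightMul (l : FreeLieSuper p) (x : X) (t : Words p) :
    wordAction p l (rightMul p x t) = rightMul p x (wordAction p l t) := by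
  revert t
  refine induction p (P := fun l => ∀ t, wordAction p l (rightMul p x t) =
    rightMul p x (wordAction p l t)) ?_ ?_ ?_ ?_ ?_ l
  · intro a b ha hb t
    simp only [map_add, LinearMap.add_apply, ha, hb]
  · intro c a ha t
    simp only [map_smul, LinearMap.smul_apply, ha]
  · intro y t
    rw [wordAction_of]
    have : leftMul p y ∘ₗ rightMul p x = rightMul p x ∘ₗ leftMul p y := by
      refine AbelianSuper.hom_ext fun l => ?_
      simp only [LinearMap.comp_apply, leftMul_word, rightMul_word, List.cons_append]
    exact congrArg (fun f => f t) this
  · intro i j a b hi hj ha hb t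
    simp only [wordAction_br p hi hj, ha, hb, map_sub, map_smul]
  · intro t
    simp

theorem coord_nil_leftMul (x : X) (t : Words p) :
    AbelianSuper.coord _ ([] : List X) (leftMul p x t) = 0 := by
  classical
  have : AbelianSuper.coord _ ([] : List X) ∘ₗ leftMul p x = 0 := by
    refine AbelianSuper.hom_ext fun l => ?_
    rw [LinearMap.comp_apply, leftMul_word, AbelianSuper.coord_basis]
    simp
  exact congrArg (fun f => f t) this

theorem coord_cons_leftMul (x : X) (l : List X) (t : Words p) :
    AbelianSuper.coord _ (x :: l) (leftMul p x t) = AbelianSuper.coord _ l t := by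
  classical
  have : AbelianSuper.coord _ (x :: l) ∘ₗ leftMul p x = AbelianSuper.coord _ l := by
    refine AbelianSuper.hom_ext fun l' => ?_
    rw [LinearMap.comp_apply, leftMul_word, AbelianSuper.coord_basis, AbelianSuper.coord_basis]
    simp
  exact congrArg (fun f => f t) this

theorem coord_rightMul_of_ne {x y : X} (h : x ≠ y) (l : List X) (t : Words p) :
    AbelianSuper.coord _ (l ++ [y]) (rightMul p x t) = 0 := by
  classical
  have : AbelianSuper.coord _ (l ++ [y]) ∘ₗ rightMul p x = 0 := by
    refine AbelianSuper.hom_ext fun l' => ?_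
    rw [LinearMap.comp_apply, rightMul_word, AbelianSuper.coord_basis]
    simp [h]
  exact congrArg (fun f => f t) this

theorem coord_nil_wordAction (l : FreeLieSuper p) (t : Words p) :
    AbelianSuper.coord _ ([] : List X) (wordAction p l t) = 0 := by
  revert t
  refine induction p (P := fun l => ∀ t,
    AbelianSuper.coord _ ([] : List X) (wordAction p l t) = 0) ?_ ?_ ?_ ?_ ?_ l
  · intro a b ha hb t
    simp only [map_add, LinearMap.add_apply, ha, hb, add_zero]
  · intro c a ha t
    simp only [map_smul, LinearMap.smul_apply, ha, smul_zero]
  · intro y t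
    rw [wordAction_of, coord_nil_leftMul]
  · intro i j a b hi hj ha hb t
    simp only [wordAction_br p hi hj, ha, hb, map_sub, map_smul, smul_zero, sub_zero]
  · intro t
    simp

/-- The right-nested bracket of a word. -/
def nestedBracket : List X → FreeLieSuper p
  -- This value is why the coefficient of the empty word appears as a separate term in
  -- `dynkin_wordAction`.
  | [] => 0
  | [x] => of p x
  | x :: y :: l => br (of p x) (nestedBracket (y :: l))

/-- The linear extension of the right-nested bracket. -/
def dynkin : Words p →ₗ[ℂ] FreeLieSuper p := AbelianSuper.constr _ (nestedBracket p)

/-- The derivation multiplying an element by its degree. -/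
theorem exists_euler : ∃ E : Module.End ℂ (FreeLieSuper p), IsSuperDerivation 0 E ∧
    ∀ x, E (of p x) = of p x :=
  exists_derivation 0 (of p) (fun x => by rw [add_zero]; exact of_mem_gr p x)

/-- The Dynkin-Specht-Wever identity. On the empty word it says that bracketing the associative
expansion of `l` from the right returns `E l`, that is, degree times `l` on homogeneous `l`. In the
induction over brackets the empty-word terms of the inner actions vanish, and the Euler terms
combine by the Leibniz rule. -/
theorem dynkin_wordAction {E : Module.End ℂ (FreeLieSuper p)} (hE : IsSuperDerivation 0 E)
    (hEof : ∀ x, E (of p x) = of p x) (l : FreeLieSuper p) (t : Words p) :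
    dynkin p (wordAction p l t) =
      br l (dynkin p t) + AbelianSuper.coord _ ([] : List X) t • E l := by
  revert t
  refine induction p (P := fun l => ∀ t, dynkin p (wordAction p l t) =
      br l (dynkin p t) + AbelianSuper.coord _ ([] : List X) t • E l) ?_ ?_ ?_ ?_ ?_ l
  · intro a b ha hb t
    simp only [map_add, LinearMap.add_apply, ha, hb, smul_add]
    abel
  · intro c a ha t
    simp only [map_smul, LinearMap.smul_apply, ha, smul_add]
    rw [smul_comm c]
  · intro x t
    classical
    have : dynkin p ∘ₗ leftMul p x = br (of p x) ∘ₗ dynkin p +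
        (AbelianSuper.coord _ ([] : List X)).smulRight (of p x) := by
      refine AbelianSuper.hom_ext fun l => ?_
      rw [LinearMap.comp_apply, leftMul_word]
      simp only [LinearMap.add_apply, LinearMap.comp_apply, LinearMap.smulRight_apply,
        AbelianSuper.coord_basis]
      rw [dynkin, AbelianSuper.constr_basis, AbelianSuper.constr_basis]
      cases l <;> simp [nestedBracket]
    rw [wordAction_of, hEof]
    exact congrArg (fun f => f t) this
  · intro i j a b hi hj ha hb t
    rw [wordAction_br p hi hj, map_sub, map_smul, ha, hb t, hb, ha t, coord_nil_wordAction,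
      coord_nil_wordAction, zero_smul, zero_smul, hE.apply_br_of_even]
    simp only [map_add, map_smul]
    rw [LieSuperalgebra.jacobi' i j a b (dynkin p t) hi hj,
      LieSuperalgebra.skew i j (E a) b (by simpa using hE.1 i a hi) hj]
    module
  · intro t
    simp

/-- The algebra is spanned by eigenvectors of `E` with eigenvalues at least 1, and eigenspaces for
distinct eigenvalues are independent; so nothing nonzero has eigenvalue 0. -/
theorem euler_injective {E : Module.End ℂ (FreeLieSuper p)} (hE : IsSuperDerivation 0 E)
    (hEof : ∀ x, E (of p x) = of p x) {l : FreeLieSuper p} (hl : E l = 0) : l = 0 := by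
  let s : Set (FreeLieSuper p) := {a | ∃ n : ℕ, E a = ((n : ℂ) + 1) • a}
  have hs : Submodule.span ℂ s = ⊤ := by
    refine generates p _ ?_ ?_
    · rintro _ ⟨x, rfl⟩
      exact Submodule.subset_span ⟨0, by simp [hEof]⟩
    · intro _ _ a b _ _ ha hb
      refine Submodule.span_induction₂ (p := fun a b _ _ => br a b ∈ Submodule.span ℂ s)
        ?_ ?_ ?_ ?_ ?_ ?_ ?_ ha hb
      · rintro a b ⟨m, hm⟩ ⟨n, hn⟩
        refine Submodule.subset_span ⟨m + n + 1, ?_⟩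
        rw [hE.apply_br_of_even, hm, hn, map_smul, map_smul, LinearMap.smul_apply]
        push_cast
        module
      · intro b _
        simp
      · intro a _
        simp
      · intro a b c _ _ _ h1 h2
        rw [map_add, LinearMap.add_apply]
        exact Submodule.add_mem _ h1 h2
      · intro a b c _ _ _ h1 h2
        rw [map_add]
        exact Submodule.add_mem _ h1 h2
      · intro c a b _ _ h
        rw [map_smul, LinearMap.smul_apply]
        exact Submodule.smul_mem _ c h
      · intro c a b _ _ h
        rw [map_smul]
        exact Submodule.smul_mem _ c h
  have hle : Submodule.span ℂ s ≤ ⨆ μ, ⨆ (_ : μ ≠ (0 : ℂ)), E.eigenspace μ := by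
    rw [Submodule.span_le]
    rintro a ⟨n, hn⟩
    refine Submodule.mem_iSup_of_mem ((n : ℂ) + 1) (Submodule.mem_iSup_of_mem ?_ ?_)
    · exact_mod_cast Nat.succ_ne_zero n
    · exact Module.End.mem_eigenspace_iff.2 hn
  have hdis : Disjoint (E.eigenspace 0) (⨆ μ, ⨆ (_ : μ ≠ (0 : ℂ)), E.eigenspace μ) :=
    E.eigenspaces_iSupIndep 0
  refine Submodule.disjoint_def.1 hdis l ?_ (hle (hs ▸ Submodule.mem_top))
  rw [Module.End.mem_eigenspace_iff, hl, zero_smul]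

/-- Let L be the associative expansion of `l`. Centrality gives L x = ± x L for every letter x. If y
≠ x, the words on the left never end in y, so L has no word ending in y. With at least two letters
this excludes every nonempty word, so L = 0, and the Dynkin identity together with `euler_injective`
gives `l` = 0. -/
theorem eq_zero_of_central_of_mem_gr [Nontrivial X] {i : ZMod 2} {l : FreeLieSuper p}
    (hi : l ∈ gr (FreeLieSuper p) i) (hl : ∀ x, br l (of p x) = 0) : l = 0 := by
  have hcoord : ∀ v, AbelianSuper.coord _ v (wordAction p l (word p [])) = 0 := by
    intro v
    rcases List.eq_nil_or_concat v with rfl | ⟨u, y, rfl⟩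
    · exact coord_nil_wordAction p l _
    · obtain ⟨x, hxy⟩ := exists_ne y
      have h1 : wordAction p l (word p [x]) = rightMul p x (wordAction p l (word p [])) := by
        rw [← wordAction_rightMul, rightMul_word, List.nil_append]
      have h2 := wordAction_br p hi (of_mem_gr p x) (word p [])
      rw [hl, map_zero, LinearMap.zero_apply, wordAction_of, leftMul_word, h1] at h2
      have h3 := congrArg (AbelianSuper.coord _ ((x :: u) ++ [y])) h2
      rw [map_zero, map_sub, map_smul, coord_rightMul_of_ne p hxy, List.cons_append,
        coord_cons_leftMul] at h3
      have hsgn : superSign i (p x) ≠ 0 := by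
        unfold superSign
        split_ifs <;> norm_num
      simpa [hsgn] using h3
  have hzero : wordAction p l (word p []) = 0 :=
    AbelianSuper.ext_coord _ fun v => by rw [hcoord v, map_zero]
  obtain ⟨E, hE, hEof⟩ := exists_euler p
  refine euler_injective p hE hEof ?_
  classical
  have := dynkin_wordAction p hE hEof l (word p [])
  rw [hzero, map_zero, AbelianSuper.coord_basis, if_pos rfl, one_smul, dynkin,
    AbelianSuper.constr_basis] at this
  simpa [nestedBracket] using this.symm

/-- A free Lie superalgebra on at least two generators has trivial center. -/
theorem eq_zero_of_central [Nontrivial X] {l : FreeLieSuper p} (hl : ∀ m, br l m = 0) :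
    l = 0 := by
  have h : ∀ x, br (proj 0 l) (of p x) = 0 ∧ br (proj 1 l) (of p x) = 0 := by
    intro x
    have h0 := proj_zero_br l (of p x)
    have h1 := proj_one_br l (of p x)
    rw [hl, map_zero, proj_of_mem (of_mem_gr p x), proj_of_mem (of_mem_gr p x)] at h0 h1
    rcases zmod_two_cases (p x) with hx | hx <;> simp [hx] at h0 h1 <;>
      first | exact ⟨h0.symm, h1.symm⟩ | exact ⟨h1.symm, h0.symm⟩
  rw [← proj_add l, eq_zero_of_central_of_mem_gr p (proj_mem 0 l) fun x => (h x).1,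
    eq_zero_of_central_of_mem_gr p (proj_mem 1 l) fun x => (h x).2, add_zero]

end FreeLieSuper

/-! ## Identities for two odd elements -/

section Identities

variable {A : Type*} [AddCommGroup A] [Module ℂ A] [SuperAlgebra A] [LieSuperalgebra A]

namespace LieSuperalgebra

theorem br_odd_odd_mem {x y : A} (hx : x ∈ gr A 1) (hy : y ∈ gr A 1) : br x y ∈ gr A 0 :=
  br_mem hx hy

theorem br_odd_even_mem {x y : A} (hx : x ∈ gr A 1) (hy : y ∈ gr A 0) : br x y ∈ gr A 1 :=
  br_mem hx hy

theorem br_even_odd_mem {x y : A} (hx : x ∈ gr A 0) (hy : y ∈ gr A 1) : br x y ∈ gr A 1 :=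
  br_mem hx hy

theorem br_even_even_mem {x y : A} (hx : x ∈ gr A 0) (hy : y ∈ gr A 0) : br x y ∈ gr A 0 :=
  br_mem hx hy

theorem br_even_right (x : A) {y : A} (hy : y ∈ gr A 0) : br x y = -br y x := by
  rw [br_even_left hy x, neg_neg]

/-- The Jacobi identity for nesting brackets on the right. -/
theorem br_br_even {i : ZMod 2} {x y : A} (hx : x ∈ gr A 0) (hy : y ∈ gr A i) (z : A) :
    br (br x y) z = br x (br y z) - br y (br x z) := by
  rw [jacobi_even_left hx hy, add_sub_cancel_right]

theorem br_odd_br_odd {x y : A} (hx : x ∈ gr A 1) (hy : y ∈ gr A 1) (z : A) :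
    br x (br y z) + br y (br x z) = br (br x y) z := by
  rw [jacobi_odd_odd hx hy, sub_add_cancel]

theorem br_odd_br_self {x : A} (hx : x ∈ gr A 1) (z : A) :
    br x (br x z) = (1 / 2 : ℂ) • br (br x x) z := by
  rw [← br_odd_br_odd hx hx]
  module

/-- By Jacobi and skew symmetry the element equals minus one half of itself. -/
theorem br_odd_self_self {x : A} (hx : x ∈ gr A 1) : br x (br x x) = 0 := by
  have h := br_odd_br_self hx x
  rw [br_even_left (br_odd_odd_mem hx hx)] at h
  have h3 : (3 / 2 : ℂ) • br x (br x x) = 0 := by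
    linear_combination (norm := module) h
  simpa using h3

theorem br_odd_other_other {x y : A} (hx : x ∈ gr A 1) (hy : y ∈ gr A 1) :
    br x (br y y) = (-2 : ℂ) • br y (br x y) := by
  have h := br_odd_br_odd hx hy y
  rw [br_even_left (br_odd_odd_mem hx hy)] at h
  linear_combination (norm := module) h

/-- Both sides come from computing ad(x)² on {y,y}: once as half of ad {x,x}, once through {x,y}.
The companion `br_other_middle` then follows from [C,C] = 0 for the even element C = {x,y}. -/
theorem br_self_middle {x y : A} (hx : x ∈ gr A 1) (hy : y ∈ gr A 1) :
    br x (br y (br x y)) = (-(1 / 4) : ℂ) • br (br x x) (br y y) := by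
  have h := br_odd_br_self hx (br y y)
  rw [br_odd_other_other hx hy, map_smul] at h
  linear_combination (norm := module) (-(1 / 2) : ℂ) • h

theorem br_other_middle {x y : A} (hx : x ∈ gr A 1) (hy : y ∈ gr A 1) :
    br y (br x (br x y)) = (1 / 4 : ℂ) • br (br x x) (br y y) := by
  have h := br_odd_br_odd hx hy (br x y)
  rw [br_self_even (br_odd_odd_mem hx hy), br_self_middle hx hy] at h
  linear_combination (norm := module) h

/-- The first of the two quintic elements on two odd elements, up to a factor. -/
def quinticForm (x y : A) : A :=
  br (br x x) (br y (br x y)) + br (br x y) (br x (br x y))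

/-- The four terms are those of z_0 for a form whose inverse matrix has off-diagonal entries ∓1.
Each reduces to the two brackets [X,q] and [C,p], and these occur with the same total coefficient
-3. -/
theorem quintic_eq {x y : A} (hx : x ∈ gr A 1) (hy : y ∈ gr A 1) :
    br x (br y (br x (br y x))) - br x (br y (br y (br x x))) - br y (br x (br x (br y x)))
      + br y (br x (br y (br x x))) = (-3 : ℂ) • quinticForm x y := by
  have hX := br_odd_odd_mem hx hx
  have hC := br_odd_odd_mem hx hy
  have h1 : br x (br (br x x) (br y y)) = (-2 : ℂ) • br (br x x) (br y (br x y)) := by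
    rw [jacobi_even_right hx hX, br_odd_self_self hx, br_odd_other_other hx hy]
    simp
  have h2 : br y (br (br x x) (br x y)) = (2 : ℂ) • br (br x y) (br x (br x y)) +
      br (br x x) (br y (br x y)) := by
    rw [jacobi_even_right hy hX, br_odd_other_other hy hx, br_odd_odd hy hx, map_smul,
      LinearMap.smul_apply, br_even_right (br x (br x y)) hC]
    module
  rw [br_odd_odd hy hx, br_odd_other_other hy hx, br_odd_odd hy hx]
  simp only [map_smul]
  rw [br_other_middle hx hy, br_odd_br_self hx (br x y), map_smul, map_smul, h1, h2, quinticForm]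
  module

end LieSuperalgebra

open LieSuperalgebra

/-- The relations of the three-dimensional Yang-Mills algebra in spinor coordinates. -/
structure SpinorRelations (X C Y p q : A) : Prop where
  X_mem : X ∈ gr A 0
  C_mem : C ∈ gr A 0
  Y_mem : Y ∈ gr A 0
  p_mem : p ∈ gr A 1
  q_mem : q ∈ gr A 1
  rel_p : br X q + br C p = 0
  rel_q : br C q + br Y p = 0
  rel_X : (1 / 2 : ℂ) • br X (br Y X) - br C (br C X) + (2 : ℂ) • br p p = 0
  rel_C : (1 / 2 : ℂ) • (br X (br Y C) + br Y (br X C)) - (2 : ℂ) • br p q = 0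
  rel_Y : (1 / 2 : ℂ) • br Y (br X Y) - br C (br C Y) + (2 : ℂ) • br q q = 0

namespace SpinorRelations

/-- Exchanging the two spinor indices is a symmetry, so the second supersymmetry needs no
computation of its own. -/
theorem swap {X C Y p q : A} (h : SpinorRelations X C Y p q) : SpinorRelations Y C X q p where
  X_mem := h.Y_mem
  C_mem := h.C_mem
  Y_mem := h.X_mem
  p_mem := h.q_mem
  q_mem := h.p_mem
  rel_p := by rw [add_comm, h.rel_q]
  rel_q := by rw [add_comm, h.rel_p]
  rel_X := h.rel_Y
  rel_C := by rw [add_comm, br_odd_odd h.q_mem h.p_mem, h.rel_C]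
  rel_Y := h.rel_X

/-- Two odd elements which satisfy the quintic relations define a solution. -/
theorem of_odd_pair {x y : A} (hx : x ∈ gr A 1) (hy : y ∈ gr A 1) (h1 : quinticForm x y = 0)
    (h2 : quinticForm y x = 0) :
    SpinorRelations (br x x) (br x y) (br y y) (br x (br x y)) (br y (br x y)) := by
  have hX := br_odd_odd_mem hx hx
  have hC := br_odd_odd_mem hx hy
  have hY := br_odd_odd_mem hy hy
  -- The equation for X is twice ad(x) of the Dirac equation; exchanging x and y gives the equation
  -- for Y.
  have key : ∀ {x y : A}, x ∈ gr A 1 → y ∈ gr A 1 → quinticForm x y = 0 →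
      (1 / 2 : ℂ) • br (br x x) (br (br y y) (br x x)) - br (br x y) (br (br x y) (br x x)) +
        (2 : ℂ) • br (br x (br x y)) (br x (br x y)) = 0 := by
    intro x y hx hy h
    have hX := br_odd_odd_mem hx hx
    have hC := br_odd_odd_mem hx hy
    have h := congrArg (br x) h
    rw [quinticForm, map_zero, map_add, jacobi_even_right hx hX, jacobi_even_right hx hC,
      br_odd_self_self hx, br_self_middle hx hy, br_odd_br_self hx (br x y)] at h
    rw [br_even_right (br y y) hX, br_even_right (br x y) hX]
    simp only [map_zero, map_neg, LinearMap.zero_apply, map_smul] at h ⊢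
    linear_combination (norm := module) (2 : ℂ) • h
  refine ⟨hX, hC, hY, br_odd_even_mem hx hC, br_odd_even_mem hy hC, h1, ?_, key hx hy h1, ?_, ?_⟩
  · rw [quinticForm, br_odd_odd hy hx, add_comm] at h2
    exact h2
  -- The mixed equation comes from ad(y) of the same Dirac equation.
  · have h := congrArg (br y) h1
    rw [quinticForm, map_zero, map_add, jacobi_even_right hy hX, jacobi_even_right hy hC,
      br_odd_other_other hy hx, br_odd_odd hy hx, br_odd_br_self hy (br x y),
      br_other_middle hx hy,
      br_odd_odd (br_odd_even_mem hy hC) (br_odd_even_mem hx hC)] at h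
    simp only [map_smul, LinearMap.smul_apply] at h
    rw [jacobi_even_left hC hX, br_even_left hC, map_neg, LinearMap.neg_apply,
      br_even_left (br_even_even_mem hX hC), br_even_left hC (br y y), map_neg] at h
    linear_combination (norm := module) (2 : ℂ) • h
  · have := key hy hx h2
    rwa [br_odd_odd hy hx] at this

/-- The lift of a solution to the dual numbers which defines the first supersymmetry. -/
theorem dual {X C Y p q : A} (h : SpinorRelations X C Y p q) :
    SpinorRelations (DualNumbers.mk 1 X 0) (DualNumbers.mk 1 C p)
      (DualNumbers.mk 1 Y ((-2 : ℂ) • q)) (DualNumbers.mk 1 p ((1 / 2 : ℂ) • br X C))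
      (DualNumbers.mk 1 q ((-(1 / 4) : ℂ) • br X Y)) := by
  have hX := h.X_mem
  have hC := h.C_mem
  have hY := h.Y_mem
  have hp := h.p_mem
  have hq := h.q_mem
  have hXC := br_even_even_mem hX hC
  have hXY := br_even_even_mem hX hY
  have mem0 : ∀ {a b : A}, a ∈ gr A 0 → b ∈ gr A 1 →
      DualNumbers.mk 1 a b ∈ gr (DualNumbers 1 A) 0 := fun ha hb =>
    DualNumbers.mem_gr_iff.2 ⟨ha, hb⟩
  have mem1 : ∀ {a b : A}, a ∈ gr A 1 → b ∈ gr A 0 →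
      DualNumbers.mk 1 a b ∈ gr (DualNumbers 1 A) 1 := fun ha hb =>
    DualNumbers.mem_gr_iff.2 ⟨ha, hb⟩
  have t0 : ∀ {a : A}, a ∈ gr A 0 → signTwist 1 a = a := fun ha => by
    rw [signTwist_of_mem 1 ha, superSign_zero_right, one_smul]
  have t1 : ∀ {a : A}, a ∈ gr A 1 → signTwist 1 a = -a := fun ha => by
    rw [signTwist_of_mem 1 ha, superSign_one_one, neg_one_smul]
  have eXp : br X q = -br C p := eq_neg_of_add_eq_zero_left h.rel_p
  have eYp : br C q = -br Y p := eq_neg_of_add_eq_zero_left h.rel_q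
  refine ⟨mem0 hX (Submodule.zero_mem _), mem0 hC hp, mem0 hY (Submodule.smul_mem _ _ hq),
    mem1 hp (Submodule.smul_mem _ _ hXC), mem1 hq (Submodule.smul_mem _ _ hXY), ?_, ?_, ?_, ?_, ?_⟩
  -- The first components are the given relations. In the second components, the derivatives of the
  -- Dirac equations are half of the vector equations for X and C, and the derivatives of the vector
  -- equations are consequences of the Dirac equations.
  all_goals
    apply DualNumbers.ext
  all_goals
    simp only [DualNumbers.fst_add, DualNumbers.snd_add, DualNumbers.fst_sub, DualNumbers.snd_sub,
      DualNumbers.fst_smul, DualNumbers.snd_smul, DualNumbers.fst_br, DualNumbers.snd_br,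
      DualNumbers.fst_mk, DualNumbers.snd_mk, DualNumbers.fst_zero, DualNumbers.snd_zero,
      t0 hX, t0 hC, t0 hY, t1 hp, t1 hq, map_zero, LinearMap.zero_apply, map_smul, map_neg,
      map_add, LinearMap.smul_apply, LinearMap.neg_apply]
  · exact h.rel_p
  · have h1 := h.rel_X
    rw [br_even_left hY X, br_even_left hC X, map_neg, map_neg] at h1
    linear_combination (norm := module) (1 / 2 : ℂ) • h1
  · exact h.rel_q
  · have h1 := h.rel_C
    have h2 := jacobi_even_left hC hX Y
    rw [br_even_left hC X, map_neg, LinearMap.neg_apply, br_even_left hXC Y,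
      br_even_left hC Y, map_neg] at h2
    rw [br_odd_odd hq hp]
    linear_combination (norm := module) (1 / 2 : ℂ) • h1 - (1 / 4 : ℂ) • h2
  · exact h.rel_X
  · rw [br_even_right q hX, br_even_right p (br_even_even_mem hC hX), br_even_right p hX,
      br_even_right p hXC, br_br_even hC hX, br_br_even hX hC]
    simp only [map_neg, eXp]
    module
  · exact h.rel_C
  · rw [br_even_right q hC, br_even_right q hXC, br_even_right p hXY, br_br_even hX hC,
      br_br_even hX hY]
    simp only [map_neg, eXp, eYp]
    module
  · exact h.rel_Y
  · rw [br_even_right q hXY, br_even_right p (br_even_even_mem hC hY), br_even_right p hY,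
      br_br_even hX hY, br_br_even hC hY]
    simp only [map_neg, eXp, eYp]
    module

end SpinorRelations

end Identities

theorem SuperAlgebra.Generates.of_subset_span {A : Type*} [AddCommGroup A] [Module ℂ A]
    [SuperAlgebra A] {s t : Set A} (hs : Generates s)
    (h : s ⊆ (Submodule.span ℂ t : Set A)) : Generates t :=
  fun S htS hS => hs S (h.trans (Submodule.span_le.2 htS)) hS

namespace GammaMatrices

/-! ## Gamma matrices in dimension three -/

section Frame

variable (G : GammaMatrices 3 2)

theorem lo_one_zero (i : Fin 3) : G.lo i 1 0 = G.lo i 0 1 :=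
  congrFun (congrFun (G.lo_symm i) 0) 1

theorem det_lo (i : Fin 3) : (G.lo i).det = G.lo i 0 0 * G.lo i 1 1 - G.lo i 0 1 * G.lo i 0 1 := by
  rw [Matrix.det_fin_two, G.lo_one_zero]

theorem lo_mul_up (i : Fin 3) : G.lo i * ((2 : ℂ) • G.up i) = 1 := by
  have h := G.clifford i i
  rw [if_pos rfl] at h
  rw [mul_smul_comm, two_smul, h]

theorem det_lo_ne_zero (i : Fin 3) : (G.lo i).det ≠ 0 := by
  intro h
  have := congrArg Matrix.det (G.lo_mul_up i)
  rw [Matrix.det_mul, h, zero_mul, Matrix.det_one] at this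
  exact zero_ne_one this

theorem up_eq (i : Fin 3) : G.up i = (2 * (G.lo i).det)⁻¹ • (G.lo i).adjugate := by
  have h := congrArg (fun M => (G.lo i).adjugate * M) (G.lo_mul_up i)
  simp only [← mul_assoc, Matrix.adjugate_mul, mul_one, smul_mul_assoc, one_mul] at h
  rw [← h, smul_smul, smul_smul, mul_assoc, mul_comm (G.lo i).det 2, inv_mul_cancel₀, one_smul]
  exact mul_ne_zero two_ne_zero (G.det_lo_ne_zero i)

/-- The polarization of twice the determinant. -/
def polar (i j : Fin 3) : ℂ :=
  G.lo i 0 0 * G.lo j 1 1 + G.lo i 1 1 * G.lo j 0 0 - 2 * (G.lo i 0 1 * G.lo j 0 1)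

theorem lo_mul_up_apply (i j : Fin 3) (α β : Fin 2) :
    (G.lo i * G.up j) α β = (2 * (G.lo j).det)⁻¹ * (G.lo i * (G.lo j).adjugate) α β := by
  rw [G.up_eq j, mul_smul_comm, Matrix.smul_apply, smul_eq_mul]

theorem clifford_apply {i j : Fin 3} (hij : i ≠ j) (α β : Fin 2) :
    (G.lo i).det * (G.lo i * (G.lo j).adjugate) α β +
      (G.lo j).det * (G.lo j * (G.lo i).adjugate) α β = 0 := by
  have h := congrFun (congrFun (G.clifford i j) α) β
  rw [if_neg hij, Matrix.add_apply, lo_mul_up_apply, lo_mul_up_apply, Matrix.zero_apply] at h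
  have hi := G.det_lo_ne_zero i
  have hj := G.det_lo_ne_zero j
  field_simp at h
  linear_combination h

theorem polar_eq_zero {i j : Fin 3} (hij : i ≠ j) (h : (G.lo i).det = (G.lo j).det) :
    G.polar i j = 0 := by
  have h0 := G.clifford_apply hij 0 0
  rw [h, ← mul_add, mul_eq_zero, or_iff_right (G.det_lo_ne_zero j)] at h0
  simp only [Matrix.adjugate_fin_two, Matrix.mul_apply, Fin.sum_univ_two, Matrix.of_apply,
    Matrix.cons_val_zero, Matrix.cons_val_one, G.lo_one_zero] at h0
  rw [polar]
  simp at h0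
  linear_combination h0

/-- The entries of the Clifford relation that are antisymmetric under exchange of `i` and `j` are
(det Γ^i - det Γ^j) times the 2 × 2 minors of the coordinate vectors of Γ^i and Γ^j, so unequal
determinants make these vectors parallel. The trace of the relation is the polarization times the
sum of the determinants, and the polarization of parallel invertible matrices does not vanish. -/
theorem proportional {i j : Fin 3} (hij : i ≠ j) (h : (G.lo i).det ≠ (G.lo j).det) :
    (∃ c : ℂ, c ≠ 0 ∧ G.lo i = c • G.lo j) ∧ (G.lo i).det = -(G.lo j).det := by
  have e00 := G.clifford_apply hij 0 0
  have e01 := G.clifford_apply hij 0 1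
  have e10 := G.clifford_apply hij 1 0
  have e11 := G.clifford_apply hij 1 1
  simp only [Matrix.adjugate_fin_two, Matrix.mul_apply, Fin.sum_univ_two, Matrix.of_apply,
    Matrix.cons_val_zero, Matrix.cons_val_one, G.lo_one_zero] at e00 e01 e10 e11
  simp at e00 e01 e10 e11
  have hsub := sub_ne_zero.2 h
  have m01 : G.lo i 0 1 * G.lo j 0 0 = G.lo i 0 0 * G.lo j 0 1 := by
    apply mul_left_cancel₀ hsub
    linear_combination e01
  have m12 : G.lo i 0 1 * G.lo j 1 1 = G.lo i 1 1 * G.lo j 0 1 := by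
    apply mul_left_cancel₀ hsub
    linear_combination e10
  have m02 : G.lo i 0 0 * G.lo j 1 1 = G.lo i 1 1 * G.lo j 0 0 := by
    apply mul_left_cancel₀ hsub
    linear_combination e00 - e11
  have hdj := G.det_lo_ne_zero j
  have hdi := G.det_lo_ne_zero i
  have hprop : G.lo i = ((G.polar i j) / (2 * (G.lo j).det)) • G.lo j := by
    have key : ∀ α β, G.lo i α β = (G.polar i j) / (2 * (G.lo j).det) * G.lo j α β := by
      intro α β
      rw [div_mul_eq_mul_div, eq_div_iff (mul_ne_zero two_ne_zero hdj), G.det_lo, polar]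
      fin_cases α <;> fin_cases β <;> simp only [Fin.zero_eta, Fin.mk_one, Fin.isValue,
        G.lo_one_zero]
      · linear_combination G.lo j 0 0 * m02 - 2 * G.lo j 0 1 * m01 * (-1)
      · linear_combination G.lo j 1 1 * m01 + G.lo j 0 0 * m12
      · linear_combination G.lo j 1 1 * m01 + G.lo j 0 0 * m12
      · linear_combination -G.lo j 1 1 * m02 + 2 * G.lo j 0 1 * m12
    ext α β
    exact key α β
  have hc : (G.polar i j) / (2 * (G.lo j).det) ≠ 0 := by
    intro h0
    rw [h0, zero_smul] at hprop
    apply hdi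
    rw [hprop]
    simp
  refine ⟨⟨_, hc, hprop⟩, ?_⟩
  have hp : G.polar i j ≠ 0 := fun h0 => hc (by rw [h0, zero_div])
  have : G.polar i j * ((G.lo i).det + (G.lo j).det) = 0 := by
    rw [polar]
    linear_combination e00 + e11
  rcases mul_eq_zero.1 this with h0 | h0
  · exact absurd h0 hp
  · exact eq_neg_of_add_eq_zero_left h0

theorem polar_smul {i j : Fin 3} {c : ℂ} (h : G.lo i = c • G.lo j) :
    G.polar i j = 2 * c * (G.lo j).det := by
  rw [polar, h, G.det_lo]
  simp only [Matrix.smul_apply, smul_eq_mul]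
  ring

/-- If the determinants differed, they would be opposite and Γ^i, Γ^j parallel. The third matrix
then shares its determinant with one of the two and is parallel to the other, hence to both; but
equal determinants force orthogonality, which parallel invertible matrices violate. -/
theorem det_lo_eq_of_distinct {i j k : Fin 3} (hij : i ≠ j) (hki : k ≠ i) (hkj : k ≠ j) :
    (G.lo i).det = (G.lo j).det := by
  by_contra h
  obtain ⟨⟨c, hc, hcij⟩, hd⟩ := G.proportional hij h
  by_cases hk : (G.lo k).det = (G.lo i).det
  · obtain ⟨⟨b, hb, hbkj⟩, -⟩ := G.proportional hkj (hk ▸ h)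
    have h1 := G.polar_eq_zero hki hk
    have h2 : G.lo k = (b * c⁻¹) • G.lo i := by
      rw [hcij, hbkj, smul_smul, mul_assoc, inv_mul_cancel₀ hc, mul_one]
    rw [G.polar_smul h2] at h1
    simp [hb, hc, G.det_lo_ne_zero i] at h1
  · obtain ⟨⟨b, hb, hbki⟩, hdk⟩ := G.proportional hki hk
    have h1 := G.polar_eq_zero hkj (by rw [hdk, hd, neg_neg])
    have h2 : G.lo k = (b * c) • G.lo j := by
      rw [hbki, hcij, smul_smul]
    rw [G.polar_smul h2] at h1
    simp [hb, hc, G.det_lo_ne_zero j] at h1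

/-- The common determinant of the gamma matrices. -/
def normConst : ℂ := (G.lo 0).det

theorem normConst_ne_zero : G.normConst ≠ 0 := G.det_lo_ne_zero 0

theorem det_lo_eq (i : Fin 3) : (G.lo i).det = G.normConst := by
  fin_cases i
  · rfl
  · exact G.det_lo_eq_of_distinct (k := 2) (by decide) (by decide) (by decide)
  · exact G.det_lo_eq_of_distinct (k := 1) (by decide) (by decide) (by decide)

theorem polar_eq (i j : Fin 3) : G.polar i j = if i = j then 2 * G.normConst else 0 := by
  split_ifs with h
  · subst h
    rw [← G.det_lo_eq i, G.det_lo, polar]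
    ring
  · exact G.polar_eq_zero h (by rw [G.det_lo_eq, G.det_lo_eq])

/-- Orthogonality of the Γ^i for the polarized determinant says V N = 1 for square matrices, since
the symmetric 2 × 2 matrices have dimension three, equal to the number of gamma matrices. The
identities are entries of N V = 1. -/
theorem completeness :
    (∑ i, G.lo i 0 0 * G.lo i 0 0 = 0 ∧ ∑ i, G.lo i 0 0 * G.lo i 0 1 = 0 ∧
      ∑ i, G.lo i 0 0 * G.lo i 1 1 = 2 * G.normConst) ∧
    ∑ i, G.lo i 0 1 * G.lo i 0 1 = -G.normConst ∧ ∑ i, G.lo i 0 1 * G.lo i 1 1 = 0 ∧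
      ∑ i, G.lo i 1 1 * G.lo i 1 1 = 0 := by
  have hd := G.normConst_ne_zero
  let V : Matrix (Fin 3) (Fin 3) ℂ := Matrix.of fun i => ![G.lo i 0 0, G.lo i 0 1, G.lo i 1 1]
  let N : Matrix (Fin 3) (Fin 3) ℂ := Matrix.of fun r i =>
    ![G.lo i 1 1 / (2 * G.normConst), -G.lo i 0 1 / G.normConst, G.lo i 0 0 / (2 * G.normConst)] r
  have hVN : V * N = 1 := by
    ext i j
    have h := G.polar_eq i j
    rw [Matrix.mul_apply, Fin.sum_univ_three, Matrix.one_apply]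
    have : V i 0 * N 0 j + V i 1 * N 1 j + V i 2 * N 2 j = G.polar i j / (2 * G.normConst) := by
      simp [V, N, polar]
      field_simp
      ring
    rw [this, h]
    split_ifs
    · exact div_self (mul_ne_zero two_ne_zero hd)
    · exact zero_div _
  have hNV := mul_eq_one_comm.1 hVN
  have h := fun r s => congrFun (congrFun hNV r) s
  have h20 := h 2 0
  have h21 := h 2 1
  have h22 := h 2 2
  have h11 := h 1 1
  have h12 := h 1 2
  have h02 := h 0 2
  simp [V, N, Matrix.mul_apply, Fin.sum_univ_three] at h20 h21 h22 h11 h12 h02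
  field_simp at h20 h21 h22 h11 h12 h02
  simp only [Fin.sum_univ_three]
  refine ⟨⟨?_, ?_, ?_⟩, ?_, ?_, ?_⟩
  · linear_combination h20
  · linear_combination h21
  · linear_combination h22
  · linear_combination -h11
  · linear_combination -h12
  · linear_combination h02

end Frame

end GammaMatrices

namespace GammaMatrices

/-! ## The Yang-Mills algebra in spinor coordinates -/

section Spinor

variable (G : GammaMatrices 3 2)

section Relations

variable {B : Type*} [AddCommGroup B] [Module ℂ B] [SuperAlgebra B]

/-- The vector with spinor coordinates `X`, `C`, `Y`. -/
def vectorOf (X C Y : B) (i : Fin 3) : B :=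
  (-(2 * G.normConst)⁻¹) • ((G.lo i 1 1 / 2) • X + (G.lo i 0 0 / 2) • Y - G.lo i 0 1 • C)

/-- The spinor with rescaled coordinates `q`, `p`. -/
def spinorOf (p q : B) (α : Fin 2) : B := (2 * G.normConst)⁻¹ • ![q, p] α

/-- This is completeness, while `eq_vectorOf` is orthogonality: together they invert the passage
from A_i to A_{αβ}. -/
theorem sum_smul_vectorOf (X C Y : B) (α β : Fin 2) :
    ∑ i, (-2 * G.lo i α β) • G.vectorOf X C Y i = !![X, C; C, Y] α β := by
  have hd := G.normConst_ne_zero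
  obtain ⟨⟨h00, h01, h02⟩, h11, h12, h22⟩ := G.completeness
  simp only [Fin.sum_univ_three] at *
  unfold vectorOf
  have e : (2 * G.normConst) * (2 * G.normConst)⁻¹ = 1 :=
    mul_inv_cancel₀ (mul_ne_zero two_ne_zero hd)
  generalize (2 * G.normConst)⁻¹ = t at *
  fin_cases α <;> fin_cases β <;> simp [G.lo_one_zero]
  · linear_combination (norm := module) (t * h02) • X + (t * h00) • Y - (2 * t * h01) • C + e • X
  · linear_combination (norm := module) (t * h12) • X + (t * h01) • Y - (2 * t * h11) • C + e • C
  · linear_combination (norm := module) (t * h12) • X + (t * h01) • Y - (2 * t * h11) • C + e • C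
  · linear_combination (norm := module) (t * h22) • X + (t * h02) • Y - (2 * t * h12) • C + e • Y

theorem eq_vectorOf (A : Fin 3 → B) (i : Fin 3) :
    A i = G.vectorOf (∑ j, (-2 * G.lo j 0 0) • A j) (∑ j, (-2 * G.lo j 0 1) • A j)
      (∑ j, (-2 * G.lo j 1 1) • A j) i := by
  have hd := G.normConst_ne_zero
  have h0 := G.polar_eq i 0
  have h1 := G.polar_eq i 1
  have h2 := G.polar_eq i 2
  have e : (2 * G.normConst)⁻¹ * (2 * G.normConst) = 1 :=
    inv_mul_cancel₀ (mul_ne_zero two_ne_zero hd)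
  unfold vectorOf
  generalize (2 * G.normConst)⁻¹ = t at *
  simp only [polar] at h0 h1 h2
  simp only [Fin.sum_univ_three]
  fin_cases i <;> simp at h0 h1 h2 ⊢
  · linear_combination (norm := module) (-(t * h0)) • A 0 - (t * h1) • A 1 - (t * h2) • A 2 -
      e • A 0
  · linear_combination (norm := module) (-(t * h0)) • A 0 - (t * h1) • A 1 - (t * h2) • A 2 -
      e • A 1
  · linear_combination (norm := module) (-(t * h0)) • A 0 - (t * h1) • A 1 - (t * h2) • A 2 -
      e • A 2

/-- Contraction with Γ^m and completeness isolate each of the three unknowns; this separates the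
vector equation into its spinor components. -/
theorem eq_zero_of_forall_vector {U V W : B}
    (h : ∀ m, (G.lo m 1 1 / 2) • U + (G.lo m 0 0 / 2) • V - G.lo m 0 1 • W = 0) :
    U = 0 ∧ W = 0 ∧ V = 0 := by
  have hd := G.normConst_ne_zero
  obtain ⟨⟨h00, h01, h02⟩, h11, h12, h22⟩ := G.completeness
  simp only [Fin.sum_univ_three] at h00 h01 h02 h11 h12 h22
  refine ⟨(smul_eq_zero_iff_right hd).1 ?_, (smul_eq_zero_iff_right hd).1 ?_,
    (smul_eq_zero_iff_right hd).1 ?_⟩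
  · linear_combination (norm := module) G.lo 0 0 0 • h 0 + G.lo 1 0 0 • h 1 + G.lo 2 0 0 • h 2 -
      (1 / 2 * h02) • U - (1 / 2 * h00) • V + h01 • W
  · linear_combination (norm := module) G.lo 0 0 1 • h 0 + G.lo 1 0 1 • h 1 + G.lo 2 0 1 • h 2 -
      (1 / 2 * h12) • U - (1 / 2 * h01) • V + h11 • W
  · linear_combination (norm := module) G.lo 0 1 1 • h 0 + G.lo 1 1 1 • h 1 + G.lo 2 1 1 • h 2 -
      (1 / 2 * h22) • U - (1 / 2 * h02) • V + h12 • W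

/-- By completeness the Laplacian Σ ad(A_i)² becomes the polarized determinant of the matrix with
entries X, C, C, Y. -/
theorem sum_br_vectorOf (X C Y T : B) :
    ∑ i, br (G.vectorOf X C Y i) (br (G.vectorOf X C Y i) T) = (4 * G.normConst)⁻¹ •
      ((1 / 2 : ℂ) • (br X (br Y T) + br Y (br X T)) - br C (br C T)) := by
  have hd := G.normConst_ne_zero
  obtain ⟨⟨h00, h01, h02⟩, h11, h12, h22⟩ := G.completeness
  have e : (2 * G.normConst)⁻¹ * (2 * G.normConst) = 1 :=
    inv_mul_cancel₀ (mul_ne_zero two_ne_zero hd)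
  have e4 : (4 * G.normConst)⁻¹ = (2 * G.normConst)⁻¹ / 2 := by
    rw [show (4 * G.normConst) = (2 * G.normConst) * 2 by ring, mul_inv, div_eq_mul_inv]
  rw [e4]
  unfold vectorOf
  generalize (2 * G.normConst)⁻¹ = t at *
  simp only [Fin.sum_univ_three] at *
  simp only [map_add, map_sub, map_smul, LinearMap.add_apply, LinearMap.sub_apply,
    LinearMap.smul_apply]
  linear_combination (norm := module) (t ^ 2 / 4 * h22) • br X (br X T) +
    (t ^ 2 / 4 * h00) • br Y (br Y T) + (t ^ 2 * h11) • br C (br C T) +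
    (t ^ 2 / 4 * h02) • (br X (br Y T) + br Y (br X T)) -
    (t ^ 2 / 2 * h12) • (br X (br C T) + br C (br X T)) -
    (t ^ 2 / 2 * h01) • (br Y (br C T) + br C (br Y T)) +
    (t / 4 * e) • (br X (br Y T) + br Y (br X T)) - (t / 2 * e) • br C (br C T)

/-- The left-hand side of the vector relation of the Yang-Mills algebra. -/
def vectorRelation (A : Fin 3 → B) (ψ : Fin 2 → B) (m : Fin 3) : B :=
  ∑ i, br (A i) (br (A i) (A m)) - (1 / 2 : ℂ) • ∑ α, ∑ β, G.lo m α β • br (ψ α) (ψ β)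

/-- The left-hand side of the spinor relation of the Yang-Mills algebra. -/
def spinorRelation (A : Fin 3 → B) (ψ : Fin 2 → B) (α : Fin 2) : B :=
  ∑ i, ∑ β, G.lo i α β • br (A i) (ψ β)

theorem spinorRelation_eq (X C Y p q : B) (α : Fin 2) :
    G.spinorRelation (G.vectorOf X C Y) (G.spinorOf p q) α =
      (-(4 * G.normConst)⁻¹) • ![br X q + br C p, br C q + br Y p] α := by
  have e4 : (4 * G.normConst)⁻¹ = (2 * G.normConst)⁻¹ / 2 := by
    rw [show (4 * G.normConst) = (2 * G.normConst) * 2 by ring, mul_inv, div_eq_mul_inv]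
  have h : ∀ α β, ∑ i, G.lo i α β • G.vectorOf X C Y i =
      (-(1 / 2) : ℂ) • !![X, C; C, Y] α β := by
    intro α β
    rw [← G.sum_smul_vectorOf, Finset.smul_sum]
    refine Finset.sum_congr rfl fun i _ => ?_
    rw [smul_smul]
    congr 1
    ring
  rw [spinorRelation, Finset.sum_comm]
  have h2 : ∀ β, ∑ i, G.lo i α β • br (G.vectorOf X C Y i) (G.spinorOf p q β) =
      (-(1 / 2) : ℂ) • br (!![X, C; C, Y] α β) (G.spinorOf p q β) := by
    intro β
    rw [← LinearMap.smul_apply, ← map_smul, ← h, map_sum, LinearMap.sum_apply]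
    simp
  rw [Fin.sum_univ_two, h2, h2, e4]
  simp only [spinorOf]
  fin_cases α <;> simp <;> module

variable [LieSuperalgebra B]

theorem vectorRelation_eq {X C Y p q : B} (hX : X ∈ gr B 0) (hC : C ∈ gr B 0) (hY : Y ∈ gr B 0)
    (hp : p ∈ gr B 1) (hq : q ∈ gr B 1) (m : Fin 3) :
    G.vectorRelation (G.vectorOf X C Y) (G.spinorOf p q) m = (-(2 * (2 * G.normConst) ^ 2)⁻¹) •
      ((G.lo m 1 1 / 2) •
          ((1 / 2 : ℂ) • br X (br Y X) - br C (br C X) + (2 : ℂ) • br p p) +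
        (G.lo m 0 0 / 2) •
          ((1 / 2 : ℂ) • br Y (br X Y) - br C (br C Y) + (2 : ℂ) • br q q) -
        G.lo m 0 1 •
          ((1 / 2 : ℂ) • (br X (br Y C) + br Y (br X C)) - (2 : ℂ) • br p q)) := by
  have e4 : (4 * G.normConst)⁻¹ = (2 * G.normConst)⁻¹ / 2 := by
    rw [show (4 * G.normConst) = (2 * G.normConst) * 2 by ring, mul_inv, div_eq_mul_inv]
  have e8 : (2 * (2 * G.normConst) ^ 2)⁻¹ = (2 * G.normConst)⁻¹ ^ 2 / 2 := by
    rw [mul_inv, inv_pow]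
    ring
  rw [vectorRelation, sum_br_vectorOf, e4, e8]
  simp only [vectorOf, spinorOf, Fin.sum_univ_two, G.lo_one_zero]
  generalize (2 * G.normConst)⁻¹ = t
  simp only [map_add, map_sub, map_smul, LinearMap.smul_apply, Matrix.cons_val_zero,
    Matrix.cons_val_one, LieSuperalgebra.br_self_even hX, LieSuperalgebra.br_self_even hC,
    LieSuperalgebra.br_self_even hY, map_zero, LieSuperalgebra.br_odd_odd hq hp]
  module

end Relations

/-- The odd generator `2 d ψ²`. -/
def pGen : G.YM := (2 * G.normConst) • G.psi 1

/-- The odd generator `2 d ψ¹`. -/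
def qGen : G.YM := (2 * G.normConst) • G.psi 0

theorem A_eq (i : Fin 3) :
    G.A i = G.vectorOf (G.ASpinor 0 0) (G.ASpinor 0 1) (G.ASpinor 1 1) i :=
  G.eq_vectorOf G.A i

theorem psi_eq (α : Fin 2) : G.psi α = G.spinorOf G.pGen G.qGen α := by
  have hd : 2 * G.normConst ≠ 0 := mul_ne_zero two_ne_zero G.normConst_ne_zero
  fin_cases α <;> simp only [spinorOf, pGen, qGen] <;>
    simp only [Fin.zero_eta, Fin.mk_one, Matrix.cons_val_zero, Matrix.cons_val_one, smul_smul,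
      inv_mul_cancel₀ hd, one_smul]

theorem ASpinor_one_zero : G.ASpinor 1 0 = G.ASpinor 0 1 := by
  simp only [ASpinor, G.lo_one_zero]

theorem A_mem (i : Fin 3) : G.A i ∈ gr G.YM 0 :=
  G.ymIdeal.toQuot_mem_gr (FreeLieSuper.of_mem_gr (par 3 2) (Sum.inl i))

theorem psi_mem (α : Fin 2) : G.psi α ∈ gr G.YM 1 :=
  G.ymIdeal.toQuot_mem_gr (FreeLieSuper.of_mem_gr (par 3 2) (Sum.inr α))

theorem ASpinor_mem (α β : Fin 2) : G.ASpinor α β ∈ gr G.YM 0 :=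
  Submodule.sum_mem _ fun i _ => Submodule.smul_mem _ _ (G.A_mem i)

theorem pGen_mem : G.pGen ∈ gr G.YM 1 := Submodule.smul_mem _ _ (G.psi_mem 1)

theorem qGen_mem : G.qGen ∈ gr G.YM 1 := Submodule.smul_mem _ _ (G.psi_mem 0)

theorem vectorRelation_ym (m : Fin 3) : G.vectorRelation G.A G.psi m = 0 := by
  have h : G.ymIdeal.toQuot (G.relA m) = 0 :=
    SuperIdeal.toQuot_eq_zero_of_mem (Or.inl ⟨m, rfl⟩)
  rw [relA, map_sub, map_smul, map_sum, map_sum] at h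
  simp only [map_sum, map_smul, ← SuperIdeal.br_toQuot] at h
  exact h

theorem spinorRelation_ym (α : Fin 2) : G.spinorRelation G.A G.psi α = 0 := by
  have h : G.ymIdeal.toQuot (G.relPsi α) = 0 :=
    SuperIdeal.toQuot_eq_zero_of_mem (Or.inr ⟨α, rfl⟩)
  rw [relPsi, map_sum] at h
  simp only [map_sum, map_smul, ← SuperIdeal.br_toQuot] at h
  exact h

/-- The defining relations are invertible linear combinations of the five spinor equations, with
factors that are nonzero because the common determinant is. -/
theorem spinorRelations : SpinorRelations (G.ASpinor 0 0) (G.ASpinor 0 1) (G.ASpinor 1 1)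
    G.pGen G.qGen := by
  have hd := G.normConst_ne_zero
  have hA : G.A = G.vectorOf (G.ASpinor 0 0) (G.ASpinor 0 1) (G.ASpinor 1 1) := funext G.A_eq
  have hψ : G.psi = G.spinorOf G.pGen G.qGen := funext G.psi_eq
  have hs := G.spinorRelation_ym
  have hv := G.vectorRelation_ym
  rw [hA, hψ] at hs hv
  simp only [spinorRelation_eq] at hs
  simp only [G.vectorRelation_eq (G.ASpinor_mem 0 0) (G.ASpinor_mem 0 1) (G.ASpinor_mem 1 1)
    G.pGen_mem G.qGen_mem] at hv
  replace hv := fun m => (smul_eq_zero_iff_right (neg_ne_zero.2 (inv_ne_zero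
    (mul_ne_zero two_ne_zero (pow_ne_zero 2 (mul_ne_zero two_ne_zero hd)))))).1 (hv m)
  replace hs := fun α => (smul_eq_zero_iff_right (neg_ne_zero.2 (inv_ne_zero
    (mul_ne_zero (by norm_num) hd)))).1 (hs α)
  obtain ⟨hX, hC, hY⟩ := G.eq_zero_of_forall_vector hv
  exact ⟨G.ASpinor_mem 0 0, G.ASpinor_mem 0 1, G.ASpinor_mem 1 1, G.pGen_mem, G.qGen_mem,
    hs 0, hs 1, hX, hC, hY⟩

/-- The generators of the Yang-Mills algebra in spinor coordinates. -/
def spinorGens : Set G.YM :=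
  {G.ASpinor 0 0, G.ASpinor 0 1, G.ASpinor 1 1, G.pGen, G.qGen}

theorem generates_A_psi : Generates (Set.range G.A ∪ Set.range G.psi) := by
  have := SuperHom.generates_image (FreeLieSuper.generates (par 3 2)) G.ymIdeal.toQuotHom
    G.ymIdeal.toQuot_surjective
  rw [← Set.range_comp] at this
  refine this.of_subset_span ?_
  rintro _ ⟨i | α, rfl⟩
  · exact Submodule.subset_span (Or.inl ⟨i, rfl⟩)
  · exact Submodule.subset_span (Or.inr ⟨α, rfl⟩)

theorem generates_spinorGens : Generates G.spinorGens := by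
  refine G.generates_A_psi.of_subset_span ?_
  rintro _ (⟨i, rfl⟩ | ⟨α, rfl⟩)
  · rw [A_eq, vectorOf]
    refine Submodule.smul_mem _ _ (Submodule.sub_mem _ (Submodule.add_mem _
      (Submodule.smul_mem _ _ (Submodule.subset_span ?_))
      (Submodule.smul_mem _ _ (Submodule.subset_span ?_)))
      (Submodule.smul_mem _ _ (Submodule.subset_span ?_))) <;> simp [spinorGens]
  · rw [psi_eq, spinorOf]
    refine Submodule.smul_mem _ _ (Submodule.subset_span ?_)
    fin_cases α <;> simp [spinorGens]

/-- The universal property of the Yang-Mills algebra in spinor coordinates. -/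
theorem exists_hom {B : Type*} [AddCommGroup B] [Module ℂ B] [SuperAlgebra B] [LieSuperalgebra B]
    {X C Y p q : B} (h : SpinorRelations X C Y p q) :
    ∃ f : SuperHom G.YM B, (f (G.ASpinor 0 0) = X ∧ f (G.ASpinor 0 1) = C ∧
      f (G.ASpinor 1 1) = Y) ∧ f G.pGen = p ∧ f G.qGen = q := by
  have hd : 2 * G.normConst ≠ 0 := mul_ne_zero two_ne_zero G.normConst_ne_zero
  let g : SuperHom (FreeLieSuper (par 3 2)) B := FreeLieSuper.lift
    (Sum.elim (G.vectorOf X C Y) (G.spinorOf p q)) (by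
      rintro (i | α)
      · exact Submodule.smul_mem _ _ (Submodule.sub_mem _ (Submodule.add_mem _
          (Submodule.smul_mem _ _ h.X_mem) (Submodule.smul_mem _ _ h.Y_mem))
          (Submodule.smul_mem _ _ h.C_mem))
      · refine Submodule.smul_mem _ _ ?_
        fin_cases α
        · exact h.q_mem
        · exact h.p_mem)
  have gA : ∀ i, g (freeA 3 2 i) = G.vectorOf X C Y i := fun i => FreeLieSuper.lift_of _ _ _
  have gψ : ∀ α, g (freePsi 3 2 α) = G.spinorOf p q α := fun α => FreeLieSuper.lift_of _ _ _
  let f : SuperHom G.YM B := SuperIdeal.liftSpan g (by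
    rintro _ (⟨m, rfl⟩ | ⟨α, rfl⟩)
    · have : g (G.relA m) = G.vectorRelation (G.vectorOf X C Y) (G.spinorOf p q) m := by
        simp only [relA, map_sub, map_smul, map_sum, g.map_br, gA, gψ, vectorRelation]
      rw [this, G.vectorRelation_eq h.X_mem h.C_mem h.Y_mem h.p_mem h.q_mem, h.rel_X, h.rel_C,
        h.rel_Y]
      simp
    · have : g (G.relPsi α) = G.spinorRelation (G.vectorOf X C Y) (G.spinorOf p q) α := by
        simp only [relPsi, map_smul, map_sum, g.map_br, gA, gψ, spinorRelation]
      rw [this, G.spinorRelation_eq, h.rel_p, h.rel_q]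
      fin_cases α <;> simp)
  have fA : ∀ i, f (G.A i) = G.vectorOf X C Y i := gA
  have fψ : ∀ α, f (G.psi α) = G.spinorOf p q α := gψ
  have fS : ∀ α β, f (G.ASpinor α β) = !![X, C; C, Y] α β := by
    intro α β
    rw [← G.sum_smul_vectorOf, ASpinor, map_sum]
    simp only [map_smul, fA]
  refine ⟨f, ⟨fS 0 0, fS 0 1, fS 1 1⟩, ?_, ?_⟩
  · rw [pGen, map_smul, fψ, spinorOf, smul_smul, mul_inv_cancel₀ hd, one_smul]
    rfl
  · rw [qGen, map_smul, fψ, spinorOf, smul_smul, mul_inv_cancel₀ hd, one_smul]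
    rfl

end Spinor

end GammaMatrices

/-! ## Supersymmetries in spinor coordinates -/

section Half

open LieSuperalgebra

variable {A B : Type*} [AddCommGroup A] [Module ℂ A] [SuperAlgebra A]
  [AddCommGroup B] [Module ℂ B] [SuperAlgebra B]

/-- One half of the supersymmetries, in spinor coordinates. The other half is obtained by
exchanging `X` with `Y` and `p` with `q`. -/
structure IsHalfSusy (X C Y p q : A) (D : Module.End ℂ A) : Prop where
  der : IsSuperDerivation 1 D
  map_X : D X = 0
  map_C : D C = p
  map_Y : D Y = (-2 : ℂ) • q
  map_p : D p = (1 / 2 : ℂ) • br X C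
  map_q : D q = (-(1 / 4) : ℂ) • br X Y

/-- This model case is where the constants in `IsHalfSusy` come from. -/
theorem isHalfSusy_br [LieSuperalgebra A] {x y : A} (hx : x ∈ gr A 1) (hy : y ∈ gr A 1) :
    IsHalfSusy (br x x) (br x y) (br y y) (br x (br x y)) (br y (br x y)) (br x) where
  der := IsSuperDerivation.ad hx
  map_X := br_odd_self_self hx
  map_C := rfl
  map_Y := br_odd_other_other hx hy
  map_p := br_odd_br_self hx _
  map_q := br_self_middle hx hy

namespace IsHalfSusy

variable {X C Y p q : A} {D E : Module.End ℂ A}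

theorem intertwine (hgen : Generates ({X, C, Y, p, q} : Set A)) (hD : IsHalfSusy X C Y p q D)
    (f : SuperHom A B) {E : Module.End ℂ B} (hE : IsHalfSusy (f X) (f C) (f Y) (f p) (f q) E)
    (x : A) : f (D x) = E (f x) := by
  refine IsSuperDerivation.intertwine hgen hD.der hE.der f ?_ x
  rintro _ (rfl | rfl | rfl | rfl | rfl)
  · rw [hD.map_X, hE.map_X, map_zero]
  · rw [hD.map_C, hE.map_C]
  · rw [hD.map_Y, hE.map_Y, map_smul]
  · rw [hD.map_p, hE.map_p, map_smul, f.map_br]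
  · rw [hD.map_q, hE.map_q, map_smul, f.map_br]

theorem swap_set : ({X, C, Y, p, q} : Set A) = {Y, C, X, q, p} := by
  ext x
  simp only [Set.mem_insert_iff, Set.mem_singleton_iff]
  tauto

variable [LieSuperalgebra A]

theorem apply_apply (h : IsSuperDerivation 1 D) (x : A) : br D D x = (2 : ℂ) • D (D x) := by
  rw [br_end_eq h.mem_gr_end h.mem_gr_end, superSign_one_one]
  simp only [LinearMap.sub_apply, LinearMap.smul_apply, Module.End.mul_apply]
  module

/-- Both sides are even derivations, so comparison on the five generators suffices. The same holds
for `br_other`, where the values on p and q use the Dirac equations only through the definitions of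
D and E on the generators. -/
theorem br_self (hgen : Generates ({X, C, Y, p, q} : Set A)) (h : SpinorRelations X C Y p q)
    (hD : IsHalfSusy X C Y p q D) : br D D = br X := by
  have hXC := br_even_even_mem h.X_mem h.C_mem
  have hDD := hD.der.superComm hD.der
  rw [zmod_two_one_add_one] at hDD
  refine IsSuperDerivation.eq_of_generates hgen hDD
    (IsSuperDerivation.ad h.X_mem) ?_
  rintro _ (rfl | rfl | rfl | rfl | rfl) <;> rw [apply_apply hD.der]
  · rw [hD.map_X, map_zero, smul_zero, br_self_even h.X_mem]
  · rw [hD.map_C, hD.map_p]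
    module
  · rw [hD.map_Y, map_smul, hD.map_q]
    module
  · rw [hD.map_p, map_smul, hD.der.apply_br_even_left h.X_mem, hD.map_X, hD.map_C]
    simp only [map_zero, LinearMap.zero_apply]
    module
  · rw [hD.map_q, map_smul, hD.der.apply_br_even_left h.X_mem, hD.map_X, hD.map_Y]
    simp only [map_zero, LinearMap.zero_apply, map_smul]
    module

theorem br_other (hgen : Generates ({X, C, Y, p, q} : Set A)) (h : SpinorRelations X C Y p q)
    (hD : IsHalfSusy X C Y p q D) (hE : IsHalfSusy Y C X q p E) : br D E = br C := by
  have apply : ∀ x, br D E x = D (E x) + E (D x) := by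
    intro x
    rw [br_end_eq hD.der.mem_gr_end hE.der.mem_gr_end, superSign_one_one]
    simp
  have hDE := hD.der.superComm hE.der
  rw [zmod_two_one_add_one] at hDE
  refine IsSuperDerivation.eq_of_generates hgen hDE
    (IsSuperDerivation.ad h.C_mem) ?_
  rintro _ (rfl | rfl | rfl | rfl | rfl) <;> rw [apply]
  · rw [hD.map_X, map_zero, hE.map_Y, map_smul, hD.map_p, br_even_left h.X_mem]
    module
  · rw [hD.map_C, hE.map_C, hE.map_q, hD.map_q, br_even_left h.X_mem, br_self_even h.C_mem]
    module
  · rw [hE.map_X, map_zero, hD.map_Y, map_smul, hE.map_p, br_even_left h.Y_mem]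
    module
  · rw [hD.map_p, hE.map_q, map_smul, map_smul, hE.der.apply_br_even_left h.X_mem,
      hD.der.apply_br_even_left h.Y_mem, hD.map_X, hD.map_Y, hE.map_Y, hE.map_C]
    simp only [map_zero, map_smul, LinearMap.smul_apply]
    rw [br_even_right _ h.C_mem, br_even_right _ h.X_mem]
    module
  · rw [hD.map_q, hE.map_p, map_smul, map_smul, hE.der.apply_br_even_left h.X_mem,
      hD.der.apply_br_even_left h.Y_mem, hD.map_Y, hE.map_X, hE.map_Y, hD.map_C]
    simp only [map_zero, map_smul, LinearMap.smul_apply]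
    rw [br_even_right _ h.C_mem, br_even_right _ h.Y_mem]
    module

/-- With [D,D] = ad X and [D,E] = ad C, the quintic element in D and E is ad of the Dirac expression
[X,q] + [C,p], which vanishes. -/
theorem quinticForm_eq_zero (hgen : Generates ({X, C, Y, p, q} : Set A))
    (h : SpinorRelations X C Y p q) (hD : IsHalfSusy X C Y p q D) (hE : IsHalfSusy Y C X q p E) :
    quinticForm D E = 0 := by
  rw [quinticForm, hD.br_self hgen h, hD.br_other hgen h hE, hE.der.br_ad h.C_mem,
    hD.der.br_ad h.C_mem, hE.map_C, hD.map_C, (IsSuperDerivation.ad h.X_mem).br_ad h.q_mem,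
    (IsSuperDerivation.ad h.C_mem).br_ad h.p_mem, ← map_add, h.rel_p, map_zero]

end IsHalfSusy

end Half

/-! ### Existence and uniqueness of the supersymmetries of YM. -/

namespace GammaMatrices

variable (G : GammaMatrices 3 2)

theorem exists_isHalfSusy_left :
    ∃ D, IsHalfSusy (G.ASpinor 0 0) (G.ASpinor 0 1) (G.ASpinor 1 1) G.pGen G.qGen D := by
  obtain ⟨f, ⟨fX, fC, fY⟩, fp, fq⟩ := G.exists_hom G.spinorRelations.dual
  obtain ⟨D, hD, hDf⟩ := IsSuperDerivation.exists_of_dualNumbers G.generates_spinorGens f (by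
    rintro _ (rfl | rfl | rfl | rfl | rfl)
    · rw [fX]; rfl
    · rw [fC]; rfl
    · rw [fY]; rfl
    · rw [fp]; rfl
    · rw [fq]; rfl)
  exact ⟨D, hD, by rw [hDf, fX]; rfl, by rw [hDf, fC]; rfl, by rw [hDf, fY]; rfl,
    by rw [hDf, fp]; rfl, by rw [hDf, fq]; rfl⟩

theorem exists_isHalfSusy_right :
    ∃ D, IsHalfSusy (G.ASpinor 1 1) (G.ASpinor 0 1) (G.ASpinor 0 0) G.qGen G.pGen D := by
  obtain ⟨f, ⟨fX, fC, fY⟩, fp, fq⟩ := G.exists_hom G.spinorRelations.swap.dual.swap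
  obtain ⟨D, hD, hDf⟩ := IsSuperDerivation.exists_of_dualNumbers G.generates_spinorGens f (by
    rintro _ (rfl | rfl | rfl | rfl | rfl)
    · rw [fX]; rfl
    · rw [fC]; rfl
    · rw [fY]; rfl
    · rw [fp]; rfl
    · rw [fq]; rfl)
  exact ⟨D, hD, by rw [hDf, fY]; rfl, by rw [hDf, fC]; rfl, by rw [hDf, fX]; rfl,
    by rw [hDf, fq]; rfl, by rw [hDf, fp]; rfl⟩

theorem lo_mul_up_apply_eq (i j : Fin 3) (α β : Fin 2) :
    (G.lo i * G.up j) α β =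
      (2 * G.normConst)⁻¹ * (G.lo i α 0 * !![G.lo j 1 1, -G.lo j 0 1; -G.lo j 0 1, G.lo j 0 0] 0 β +
        G.lo i α 1 * !![G.lo j 1 1, -G.lo j 0 1; -G.lo j 0 1, G.lo j 0 0] 1 β) := by
  rw [lo_mul_up_apply, det_lo_eq, Matrix.mul_apply, Fin.sum_univ_two, Matrix.adjugate_fin_two,
    G.lo_one_zero]

/-- Only three brackets of the A_i are needed after skew symmetry; once both sides are written in
them, the formulas for θ(ψ) become comparisons of scalar coefficients. -/
theorem sum_sum_br_A (M : Fin 3 → Fin 3 → ℂ) :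
    ∑ i, ∑ j, M i j • br (G.A i) (G.A j) = (M 0 1 - M 1 0) • br (G.A 0) (G.A 1) +
      (M 0 2 - M 2 0) • br (G.A 0) (G.A 2) + (M 1 2 - M 2 1) • br (G.A 1) (G.A 2) := by
  simp only [Fin.sum_univ_three]
  rw [LieSuperalgebra.br_self_even (G.A_mem 0), LieSuperalgebra.br_self_even (G.A_mem 1),
    LieSuperalgebra.br_self_even (G.A_mem 2), LieSuperalgebra.br_even_left (G.A_mem 1) (G.A 0),
    LieSuperalgebra.br_even_left (G.A_mem 2) (G.A 0),
    LieSuperalgebra.br_even_left (G.A_mem 2) (G.A 1)]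
  module

theorem br_ASpinor (α β γ δ : Fin 2) : br (G.ASpinor α β) (G.ASpinor γ δ) =
    ∑ i, ∑ j, (4 * G.lo i α β * G.lo j γ δ) • br (G.A i) (G.A j) := by
  simp only [ASpinor, map_sum, LinearMap.sum_apply, map_smul, LinearMap.smul_apply, Finset.smul_sum, smul_smul]
  rw [Finset.sum_comm]
  refine Finset.sum_congr rfl fun i _ => Finset.sum_congr rfl fun j _ => ?_
  congr 1
  ring

theorem isSupersymmetry_left {D : Module.End ℂ G.YM}
    (h : IsHalfSusy (G.ASpinor 0 0) (G.ASpinor 0 1) (G.ASpinor 1 1) G.pGen G.qGen D) :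
    G.IsSupersymmetry 0 D := by
  refine ⟨h.der, fun i => ?_, fun β => ?_⟩
  · rw [G.A_eq, vectorOf, map_smul, map_sub, map_add, map_smul, map_smul, map_smul, h.map_X,
      h.map_C, h.map_Y, Fin.sum_univ_two, G.psi_eq 0, G.psi_eq 1]
    simp only [spinorOf, Matrix.cons_val_zero, Matrix.cons_val_one]
    module
  · rw [G.psi_eq, spinorOf, map_smul]
    simp only [Matrix.sub_apply]
    rw [sum_sum_br_A]
    simp only [lo_mul_up_apply_eq]
    fin_cases β
    · simp [h.map_q]
      rw [br_ASpinor, sum_sum_br_A, ← mul_inv_rev]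
      module
    · simp [h.map_p]
      rw [br_ASpinor, sum_sum_br_A, ← mul_inv_rev]
      module

theorem isSupersymmetry_right {D : Module.End ℂ G.YM}
    (h : IsHalfSusy (G.ASpinor 1 1) (G.ASpinor 0 1) (G.ASpinor 0 0) G.qGen G.pGen D) :
    G.IsSupersymmetry 1 D := by
  refine ⟨h.der, fun i => ?_, fun β => ?_⟩
  · rw [G.A_eq, vectorOf, map_smul, map_sub, map_add, map_smul, map_smul, map_smul, h.map_X,
      h.map_C, h.map_Y, Fin.sum_univ_two, G.psi_eq 0, G.psi_eq 1]
    simp only [spinorOf, Matrix.cons_val_zero, Matrix.cons_val_one, G.lo_one_zero]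
    module
  · rw [G.psi_eq, spinorOf, map_smul]
    simp only [Matrix.sub_apply]
    rw [sum_sum_br_A]
    simp only [lo_mul_up_apply_eq]
    fin_cases β
    · simp [h.map_p, G.lo_one_zero]
      rw [br_ASpinor, sum_sum_br_A, ← mul_inv_rev]
      module
    · simp [h.map_q, G.lo_one_zero]
      rw [br_ASpinor, sum_sum_br_A, ← mul_inv_rev]
      module

theorem IsSupersymmetry.unique {G : GammaMatrices 3 2} {α : Fin 2} {D E : Module.End ℂ G.YM}
    (hD : G.IsSupersymmetry α D) (hE : G.IsSupersymmetry α E) : D = E := by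
  refine IsSuperDerivation.eq_of_generates G.generates_A_psi hD.1 hE.1 ?_
  rintro _ (⟨i, rfl⟩ | ⟨β, rfl⟩)
  · rw [hD.2.1, hE.2.1]
  · rw [hD.2.2, hE.2.2]

end GammaMatrices

/-! ## The quintic elements -/

section Quintic

open LieSuperalgebra

variable {A B : Type*} [AddCommGroup A] [Module ℂ A] [SuperAlgebra A]
  [AddCommGroup B] [Module ℂ B] [SuperAlgebra B]

theorem SuperHom.map_quinticForm (f : SuperHom A B) (x y : A) :
    f (quinticForm x y) = quinticForm (f x) (f y) := by
  simp only [quinticForm, map_add, f.map_br]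

/-- The form has degree 3 in x and 2 in y, so under traceless matrices it has the weight of x. The
shape of `hDy` encodes tracelessness; otherwise multiples of the trace would enter. -/
theorem IsSuperDerivation.apply_quinticForm [LieSuperalgebra A] {D : Module.End ℂ A}
    (hD : IsSuperDerivation 0 D) {x y : A} (hx : x ∈ gr A 1) (hy : y ∈ gr A 1) {a b c : ℂ}
    (hDx : D x = a • x + c • y) (hDy : D y = b • x - a • y) :
    D (quinticForm x y) = a • quinticForm x y + c • quinticForm y x := by
  have hX : D (br x x) = (2 * a) • br x x + (2 * c) • br x y := by
    rw [hD.apply_br_of_even, hDx]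
    simp only [map_add, map_smul, LinearMap.add_apply, LinearMap.smul_apply, br_odd_odd hy hx]
    module
  have hC : D (br x y) = c • br y y + b • br x x := by
    rw [hD.apply_br_of_even, hDx, hDy]
    simp only [map_add, map_sub, map_smul, LinearMap.add_apply, LinearMap.smul_apply]
    module
  have hp : D (br x (br x y)) = a • br x (br x y) - c • br y (br x y) := by
    rw [hD.apply_br_of_even, hC, hDx]
    simp only [map_add, map_smul, LinearMap.add_apply, LinearMap.smul_apply,
      br_odd_self_self hx, br_odd_other_other hx hy]
    module
  have hq : D (br y (br x y)) = (-b) • br x (br x y) - a • br y (br x y) := by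
    rw [hD.apply_br_of_even, hC, hDy]
    simp only [map_add, map_sub, map_smul, LinearMap.sub_apply, LinearMap.smul_apply,
      br_odd_self_self hy, br_odd_other_other hy hx, br_odd_odd hy hx]
    module
  rw [quinticForm, quinticForm, map_add, hD.apply_br_of_even (br x x),
    hD.apply_br_of_even (br x y), hp, hq, hX, hC, br_odd_odd hy hx]
  simp only [map_add, map_sub, map_smul, LinearMap.add_apply, LinearMap.smul_apply]
  module

/-- The associative expansion of the quintic form, used to detect that it does not vanish. -/
theorem FreeLieSuper.wordAction_quinticForm {X : Type*} {p : X → ZMod 2} {x y : X} (hx : p x = 1)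
    (hy : p y = 1) :
    wordAction p (quinticForm (of p x) (of p y)) (word p []) =
      (2 : ℂ) • (word p [x, x, y, y, x] - word p [x, x, x, y, y] - word p [y, y, x, x, x] +
        word p [x, y, y, x, x]) +
      ((word p [x, y, x, x, y] + word p [y, x, x, x, y] - word p [x, y, y, x, x] -
        word p [y, x, y, x, x]) - (word p [x, x, y, x, y] + word p [x, x, y, y, x] -
        word p [y, x, x, x, y] - word p [y, x, x, y, x])) := by
  have ox : of p x ∈ gr (FreeLieSuper p) 1 := hx ▸ of_mem_gr p x
  have oy : of p y ∈ gr (FreeLieSuper p) 1 := hy ▸ of_mem_gr p y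
  have oX := br_odd_odd_mem ox ox
  have oC := br_odd_odd_mem ox oy
  rw [quinticForm, map_add, LinearMap.add_apply, wordAction_br p oX (br_odd_even_mem oy oC),
    wordAction_br p oC (br_odd_even_mem ox oC)]
  simp only [wordAction_br p ox oC, wordAction_br p oy oC, wordAction_br p ox ox,
    wordAction_br p ox oy, wordAction_of, leftMul_word, superSign_one_one, superSign_zero_left,
    superSign_zero_right, map_sub, map_smul, one_smul]
  module

end Quintic

section Epsilon

variable {ε : Matrix (Fin 2) (Fin 2) ℂ}

theorem skew_apply_self (hskew : εᵀ = -ε) (α : Fin 2) : ε α α = 0 := by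
  have h := congrFun (congrFun hskew α) α
  rw [Matrix.transpose_apply, Matrix.neg_apply] at h
  exact self_eq_neg.1 h

theorem skew_one_zero (hskew : εᵀ = -ε) : ε 1 0 = -ε 0 1 := congrFun (congrFun hskew 0) 1

theorem skew_det (hskew : εᵀ = -ε) : ε.det = ε 0 1 ^ 2 := by
  rw [Matrix.det_fin_two, skew_apply_self hskew, skew_one_zero hskew]
  ring

theorem skew_ne_zero (hskew : εᵀ = -ε) (hdet : ε.det ≠ 0) : ε 0 1 ≠ 0 := by
  rw [skew_det hskew] at hdet
  exact (pow_ne_zero_iff two_ne_zero).1 hdet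

theorem skew_inv (hskew : εᵀ = -ε) (hdet : ε.det ≠ 0) :
    ε⁻¹ = !![0, -(ε 0 1)⁻¹; (ε 0 1)⁻¹, 0] := by
  have he := skew_ne_zero hskew hdet
  rw [Matrix.inv_def, Matrix.adjugate_fin_two, skew_apply_self hskew, skew_apply_self hskew,
    skew_one_zero hskew, skew_det hskew, Ring.inverse_eq_inv']
  ext i j
  fin_cases i <;> fin_cases j <;> simp <;> field_simp

end Epsilon

theorem wFree_mem (α : Fin 2) : wFree α ∈ gr FreeW 1 := FreeLieSuper.of_mem_gr _ α

section QuinticFree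

variable {ε : Matrix (Fin 2) (Fin 2) ℂ}

theorem quintic_zero (hskew : εᵀ = -ε) (hdet : ε.det ≠ 0) : quintic ε 0 =
    (-3 * ((ε 0 1)⁻¹) ^ 2) • LieSuperalgebra.quinticForm (wFree 0) (wFree 1) := by
  rw [mul_comm, mul_smul, ← LieSuperalgebra.quintic_eq (wFree_mem 0) (wFree_mem 1), quintic,
    skew_inv hskew hdet]
  simp [Fin.sum_univ_two]
  module

theorem quintic_one (hskew : εᵀ = -ε) (hdet : ε.det ≠ 0) : quintic ε 1 =
    (-3 * ((ε 0 1)⁻¹) ^ 2) • LieSuperalgebra.quinticForm (wFree 1) (wFree 0) := by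
  rw [mul_comm, mul_smul, ← LieSuperalgebra.quintic_eq (wFree_mem 1) (wFree_mem 0), quintic,
    skew_inv hskew hdet]
  simp [Fin.sum_univ_two]
  module

theorem linearIndependent_quintic (hskew : εᵀ = -ε) (hdet : ε.det ≠ 0) : LinearIndependent ℂ (quintic ε) := by
  have he : (-3 * ((ε 0 1)⁻¹) ^ 2) ≠ 0 :=
    mul_ne_zero (by norm_num) (pow_ne_zero 2 (inv_ne_zero (skew_ne_zero hskew hdet)))
  rw [Fintype.linearIndependent_iff]
  intro g hg
  rw [Fin.sum_univ_two, quintic_zero hskew hdet, quintic_one hskew hdet, smul_comm (g 0),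
    smul_comm (g 1), ← smul_add, smul_eq_zero_iff_right he] at hg
  have key := congrArg (fun u => FreeLieSuper.wordAction (fun _ : Fin 2 => (1 : ZMod 2)) u
    (FreeLieSuper.word _ [])) hg
  simp only [map_add, map_smul, LinearMap.add_apply, LinearMap.smul_apply, map_zero,
    LinearMap.zero_apply, wFree] at key
  rw [FreeLieSuper.wordAction_quinticForm (p := fun _ : Fin 2 => (1 : ZMod 2)) rfl rfl,
    FreeLieSuper.wordAction_quinticForm (p := fun _ : Fin 2 => (1 : ZMod 2)) rfl rfl] at key
  -- The two forms have different bidegrees, so each of these words occurs in only one expansion,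
  -- with coefficient -2.
  have k0 := congrArg (AbelianSuper.coord _ [0, 0, 0, 1, 1]) key
  have k1 := congrArg (AbelianSuper.coord _ [1, 1, 1, 0, 0]) key
  simp only [map_add, map_sub, map_smul, AbelianSuper.coord_basis, map_zero] at k0 k1
  simp at k0 k1
  intro i
  fin_cases i
  · exact k0
  · exact k1

theorem exists_sl_two_derivation (hskew : εᵀ = -ε) (hdet : ε.det ≠ 0)
    (a : Matrix (Fin 2) (Fin 2) ℂ) (ha : a.trace = 0) :
    ∃ D : Module.End ℂ FreeW, IsSuperDerivation 0 D ∧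
      (∀ α, D (wFree α) = ∑ β, a β α • wFree β) ∧
      (∀ α, D (quintic ε α) = ∑ β, a β α • quintic ε β) := by
  obtain ⟨D, hD, hDw⟩ := FreeLieSuper.exists_derivation (p := fun _ : Fin 2 => (1 : ZMod 2)) 0
    (fun α => ∑ β, a β α • wFree β) (fun α => by
      rw [add_zero]
      exact Submodule.sum_mem _ fun β _ => Submodule.smul_mem _ _ (wFree_mem β))
  have ha' : a 1 1 = -a 0 0 := by
    rw [Matrix.trace_fin_two] at ha
    linear_combination ha
  have h0 : D (wFree 0) = a 0 0 • wFree 0 + a 1 0 • wFree 1 := by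
    rw [← Fin.sum_univ_two (fun β => a β 0 • wFree β)]
    exact hDw 0
  have h1 : D (wFree 1) = a 0 1 • wFree 0 + a 1 1 • wFree 1 := by
    rw [← Fin.sum_univ_two (fun β => a β 1 • wFree β)]
    exact hDw 1
  refine ⟨D, hD, hDw, fun α => ?_⟩
  rw [Fin.sum_univ_two, quintic_zero hskew hdet, quintic_one hskew hdet]
  fin_cases α
  · simp only [Fin.zero_eta, quintic_zero hskew hdet, map_smul]
    rw [hD.apply_quinticForm (wFree_mem 0) (wFree_mem 1) h0 (b := a 0 1) (by
      rw [h1, ha', neg_smul, sub_eq_add_neg])]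
    module
  · simp only [Fin.mk_one, quintic_one hskew hdet, map_smul]
    rw [hD.apply_quinticForm (wFree_mem 1) (wFree_mem 0) (a := a 1 1) (c := a 0 1) (b := a 1 0)
      (by rw [h1, add_comm]) (by rw [h0, ha']; module)]
    module

end QuinticFree

/-! ## The two homomorphisms -/

section Quotient

open LieSuperalgebra

variable {ε : Matrix (Fin 2) (Fin 2) ℂ}

theorem wBar_mem (α : Fin 2) : wBar ε α ∈ gr (FreeWModI ε) 1 :=
  (quinticIdeal ε).toQuot_mem_gr (wFree_mem α)

theorem generates_wBar : Generates (Set.range (wBar ε)) := by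
  have := SuperHom.generates_image (FreeLieSuper.generates (fun _ : Fin 2 => (1 : ZMod 2)))
    (quinticIdeal ε).toQuotHom (quinticIdeal ε).toQuot_surjective
  rwa [← Set.range_comp] at this

theorem quinticForm_wBar (hskew : εᵀ = -ε) (hdet : ε.det ≠ 0) :
    quinticForm (wBar ε 0) (wBar ε 1) = 0 ∧ quinticForm (wBar ε 1) (wBar ε 0) = 0 := by
  have he : (-3 * ((ε 0 1)⁻¹) ^ 2) ≠ 0 :=
    mul_ne_zero (by norm_num) (pow_ne_zero 2 (inv_ne_zero (skew_ne_zero hskew hdet)))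
  have h : ∀ α, (quinticIdeal ε).toQuot (quintic ε α) = 0 := fun α =>
    SuperIdeal.toQuot_eq_zero_of_mem ⟨α, rfl⟩
  have h0 := h 0
  have h1 := h 1
  rw [quintic_zero hskew hdet, map_smul, smul_eq_zero_iff_right he] at h0
  rw [quintic_one hskew hdet, map_smul, smul_eq_zero_iff_right he] at h1
  exact ⟨((quinticIdeal ε).toQuotHom.map_quinticForm _ _).symm.trans h0,
    ((quinticIdeal ε).toQuotHom.map_quinticForm _ _).symm.trans h1⟩

/-- Homomorphisms from the quotient by the quintic relations. -/
theorem FreeWModI.exists_hom (hskew : εᵀ = -ε) (hdet : ε.det ≠ 0) {B : Type*} [AddCommGroup B]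
    [Module ℂ B] [SuperAlgebra B] [LieSuperalgebra B] {x y : B} (hx : x ∈ gr B 1)
    (hy : y ∈ gr B 1) (h1 : quinticForm x y = 0) (h2 : quinticForm y x = 0) :
    ∃ f : SuperHom (FreeWModI ε) B, f (wBar ε 0) = x ∧ f (wBar ε 1) = y := by
  let g : SuperHom FreeW B := FreeLieSuper.lift ![x, y] (by
    intro α
    fin_cases α
    · exact hx
    · exact hy)
  have g0 : g (wFree 0) = x := FreeLieSuper.lift_of _ _ _
  have g1 : g (wFree 1) = y := FreeLieSuper.lift_of _ _ _
  refine ⟨SuperIdeal.liftSpan g ?_, g0, g1⟩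
  rintro _ ⟨α, rfl⟩
  fin_cases α
  · change g (quintic ε 0) = 0
    rw [quintic_zero hskew hdet, map_smul, g.map_quinticForm, g0, g1, h1, smul_zero]
  · change g (quintic ε 1) = 0
    rw [quintic_one hskew hdet, map_smul, g.map_quinticForm, g0, g1, h2, smul_zero]

theorem ATilde_one_zero : ATilde ε 1 0 = ATilde ε 0 1 := br_odd_odd (wBar_mem 1) (wBar_mem 0)

theorem chiTilde_zero (hskew : εᵀ = -ε) (hdet : ε.det ≠ 0) :
    chiTilde ε 0 = (-3 * (ε 0 1)⁻¹) • br (wBar ε 0) (br (wBar ε 0) (wBar ε 1)) := by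
  have he := skew_ne_zero hskew hdet
  simp only [chiTilde, chiTildeUp, Fin.sum_univ_two, skew_inv hskew hdet, skew_apply_self hskew]
  simp [ATilde_one_zero]
  simp only [ATilde, br_odd_other_other (wBar_mem (ε := ε) 1) (wBar_mem 0),
    br_odd_odd (wBar_mem (ε := ε) 1) (wBar_mem 0)]
  match_scalars
  field_simp
  ring

theorem chiTilde_one (hskew : εᵀ = -ε) (hdet : ε.det ≠ 0) :
    chiTilde ε 1 = (3 * (ε 0 1)⁻¹) • br (wBar ε 1) (br (wBar ε 0) (wBar ε 1)) := by
  have he := skew_ne_zero hskew hdet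
  simp only [chiTilde, chiTildeUp, Fin.sum_univ_two, skew_inv hskew hdet, skew_apply_self hskew,
    skew_one_zero hskew]
  simp
  simp only [ATilde, br_odd_other_other (wBar_mem (ε := ε) 0) (wBar_mem 1)]
  match_scalars
  field_simp
  ring

end Quotient

namespace GammaMatrices

variable (G : GammaMatrices 3 2) {ε : Matrix (Fin 2) (Fin 2) ℂ}

/-- The three determinants are all equal to d, so with e = ε_{01} the constant κ is -6d/e². Combined
with p = 2dψ² this produces the same factor -3/e as in `chiTilde_zero`, which explains the choice of
κ. -/
theorem chi_zero (hskew : εᵀ = -ε) (hdet : ε.det ≠ 0) :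
    G.chi ε 0 = (-3 * (ε 0 1)⁻¹) • G.pGen := by
  have he := skew_ne_zero hskew hdet
  simp only [chi, G.det_lo_eq, Matrix.det_nonsing_inv, skew_det hskew, Fin.sum_univ_two,
    skew_apply_self hskew, pGen, Ring.inverse_eq_inv']
  simp
  match_scalars
  field_simp

theorem chi_one (hskew : εᵀ = -ε) (hdet : ε.det ≠ 0) :
    G.chi ε 1 = (3 * (ε 0 1)⁻¹) • G.qGen := by
  have he := skew_ne_zero hskew hdet
  simp only [chi, G.det_lo_eq, Matrix.det_nonsing_inv, skew_det hskew, Fin.sum_univ_two,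
    skew_apply_self hskew, skew_one_zero hskew, qGen, Ring.inverse_eq_inv']
  simp
  match_scalars
  field_simp

theorem closure_eq_top (hskew : εᵀ = -ε) (hdet : ε.det ≠ 0) :
    (SubSuperalgebra.closure
      (Set.range (fun x : Fin 2 × Fin 2 => G.ASpinor x.1 x.2) ∪
        Set.range (G.chi ε))).carrier = ⊤ := by
  have he := skew_ne_zero hskew hdet
  refine eq_top_iff.2 (le_sInf ?_)
  rintro _ ⟨hs, J, rfl⟩
  have hA : ∀ α β, G.ASpinor α β ∈ J.carrier := fun α β => hs (Or.inl ⟨(α, β), rfl⟩)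
  have hχ : ∀ α, G.chi ε α ∈ J.carrier := fun α => hs (Or.inr ⟨α, rfl⟩)
  have h0 := hχ 0
  have h1 := hχ 1
  rw [G.chi_zero hskew hdet, J.carrier.smul_mem_iff (by simp [he])] at h0
  rw [G.chi_one hskew hdet, J.carrier.smul_mem_iff (by simp [he])] at h1
  rw [G.generates_spinorGens J.carrier ?_ (fun _ _ x y _ _ hx hy => J.br_mem' x y hx hy)]
  rintro _ (rfl | rfl | rfl | rfl | rfl)
  · exact hA 0 0
  · exact hA 0 1
  · exact hA 1 1
  · exact h0
  · exact h1

/-- The embedding of the Yang-Mills algebra. -/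
theorem exists_iota (hskew : εᵀ = -ε) (hdet : ε.det ≠ 0) :
    ∃ ι : SuperHom G.YM (FreeWModI ε), (∀ α β, ι (G.ASpinor α β) = ATilde ε α β) ∧
      ι G.pGen = br (wBar ε 0) (br (wBar ε 0) (wBar ε 1)) ∧
      ι G.qGen = br (wBar ε 1) (br (wBar ε 0) (wBar ε 1)) := by
  obtain ⟨h1, h2⟩ := quinticForm_wBar hskew hdet
  obtain ⟨ι, ⟨hX, hC, hY⟩, hp, hq⟩ :=
    G.exists_hom (SpinorRelations.of_odd_pair (wBar_mem 0) (wBar_mem 1) h1 h2)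
  refine ⟨ι, fun α β => ?_, hp, hq⟩
  fin_cases α <;> fin_cases β
  · exact hX
  · exact hC
  · change ι (G.ASpinor 1 0) = ATilde ε 1 0
    rw [G.ASpinor_one_zero, ATilde_one_zero]
    exact hC
  · exact hY

theorem iota_chi (hskew : εᵀ = -ε) (hdet : ε.det ≠ 0) {ι : SuperHom G.YM (FreeWModI ε)}
    (hp : ι G.pGen = br (wBar ε 0) (br (wBar ε 0) (wBar ε 1)))
    (hq : ι G.qGen = br (wBar ε 1) (br (wBar ε 0) (wBar ε 1))) (α : Fin 2) :
    ι (G.chi ε α) = chiTilde ε α := by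
  fin_cases α
  · change ι (G.chi ε 0) = chiTilde ε 0
    rw [G.chi_zero hskew hdet, chiTilde_zero hskew hdet, map_smul, hp]
  · change ι (G.chi ε 1) = chiTilde ε 1
    rw [G.chi_one hskew hdet, chiTilde_one hskew hdet, map_smul, hq]

end GammaMatrices

/-! ## Restricting the codomain of a homomorphism -/

namespace SubSuperalgebra

variable {A B : Type*} [AddCommGroup A] [Module ℂ A] [SuperAlgebra A]
  [AddCommGroup B] [Module ℂ B] [SuperAlgebra B]

/-- The restriction of the codomain of a homomorphism to a graded subalgebra. -/
def codRestrict (S : SubSuperalgebra B) (f : SuperHom A B) (h : ∀ x, f x ∈ S.carrier) :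
    SuperHom A S.carrier where
  toLin := f.toLin.codRestrict S.carrier h
  map_proj i x := Subtype.ext (f.map_proj i x)
  map_br x y := Subtype.ext (f.map_br x y)

/-- The range of a homomorphism. -/
def range (f : SuperHom A B) : SubSuperalgebra B where
  carrier := LinearMap.range f.toLin
  proj_mem' := by
    rintro i _ ⟨x, rfl⟩
    exact ⟨proj i x, f.map_proj i x⟩
  br_mem' := by
    rintro _ _ ⟨x, rfl⟩ ⟨y, rfl⟩
    exact ⟨br x y, f.map_br x y⟩

theorem subset_closure (s : Set B) : s ⊆ ((closure s).carrier : Set B) := by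
  intro x hx
  change x ∈ (sInf _ : Submodule ℂ B)
  rw [Submodule.mem_sInf]
  rintro _ ⟨hs, -⟩
  exact hs hx

theorem closure_le {s : Set B} {J : SubSuperalgebra B} (h : s ⊆ (J.carrier : Set B)) :
    (closure s).carrier ≤ J.carrier := sInf_le ⟨h, J, rfl⟩

end SubSuperalgebra

theorem LieSuperalgebra.br_odd_right {A : Type*} [AddCommGroup A] [Module ℂ A] [SuperAlgebra A]
    [LieSuperalgebra A] (x : A) {w : A} (hw : w ∈ gr A 1) :
    br x w = br w (proj 1 x - proj 0 x) := by
  conv_lhs => rw [← proj_add x, map_add, LinearMap.add_apply, br_even_left (proj_mem 0 x),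
    br_odd_odd (proj_mem 1 x) hw]
  rw [map_sub]
  abel

/-! ### Decomposition of Free(ΠW)/I by its generators and the image of YM. -/

namespace GammaMatrices

variable {G : GammaMatrices 3 2} {ε : Matrix (Fin 2) (Fin 2) ℂ}

/-- The quotient algebra is the sum of the span of its generators and the image of the
Yang-Mills algebra. -/
theorem exists_eq_add_iota {ι : SuperHom G.YM (FreeWModI ε)}
    (hA : ∀ α β, ι (G.ASpinor α β) = ATilde ε α β) {θ : Fin 2 → Module.End ℂ G.YM}
    (hθ : ∀ α y, ι (θ α y) = br (wBar ε α) (ι y)) (f : FreeWModI ε) :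
    ∃ (a b : ℂ) (y : G.YM), f = a • wBar ε 0 + b • wBar ε 1 + ι y := by
  let S : Submodule ℂ (FreeWModI ε) := Submodule.span ℂ (Set.range (wBar ε)) ⊔
    LinearMap.range ι.toLin
  -- The image of ι absorbs brackets: {w,w} lies in it, being some Ã, and [w, ι y] is ι of a
  -- supersymmetry applied to y.
  have hwS : ∀ x ∈ S, ∀ α, br (wBar ε α) x ∈ LinearMap.range ι.toLin := by
    intro x hx α
    obtain ⟨u, hu, v, ⟨y, rfl⟩, rfl⟩ := Submodule.mem_sup.1 hx
    rw [map_add]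
    refine Submodule.add_mem _ ?_ ⟨_, hθ α y⟩
    induction hu using Submodule.span_induction with
    | mem u hu =>
      obtain ⟨β, rfl⟩ := hu
      exact ⟨_, hA α β⟩
    | zero => simp
    | add u v _ _ hu hv =>
      rw [map_add]
      exact Submodule.add_mem _
        (hu (Submodule.add_mem_sup ‹_› ⟨y, rfl⟩)) (hv (Submodule.add_mem_sup ‹_› ⟨y, rfl⟩))
    | smul c u _ hu =>
      rw [map_smul]
      exact Submodule.smul_mem _ c (hu (Submodule.add_mem_sup ‹_› ⟨y, rfl⟩))
  have hιS : ∀ y, ∀ x ∈ S, br (ι y) x ∈ LinearMap.range ι.toLin := by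
    intro y x hx
    obtain ⟨u, hu, v, ⟨z, rfl⟩, rfl⟩ := Submodule.mem_sup.1 hx
    rw [map_add]
    refine Submodule.add_mem _ ?_ ⟨_, ι.map_br y z⟩
    induction hu using Submodule.span_induction with
    | mem u hu =>
      obtain ⟨β, rfl⟩ := hu
      rw [LieSuperalgebra.br_odd_right _ (wBar_mem β), ← ι.map_proj, ← ι.map_proj, ← map_sub]
      exact ⟨_, hθ β _⟩
    | zero => simp
    | add u v _ _ hu hv =>
      rw [map_add]
      exact Submodule.add_mem _
        (hu (Submodule.add_mem_sup ‹_› ⟨z, rfl⟩)) (hv (Submodule.add_mem_sup ‹_› ⟨z, rfl⟩))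
    | smul c u _ hu =>
      rw [map_smul]
      exact Submodule.smul_mem _ c (hu (Submodule.add_mem_sup ‹_› ⟨z, rfl⟩))
  have hS : S = ⊤ := by
    refine generates_wBar S (fun x hx => Submodule.mem_sup_left (Submodule.subset_span hx)) ?_
    intro i j x z hi _ hx hz
    refine Submodule.mem_sup_right ?_
    obtain ⟨u, hu, v, ⟨y, rfl⟩, rfl⟩ := Submodule.mem_sup.1 hx
    rw [map_add, LinearMap.add_apply]
    refine Submodule.add_mem _ ?_ (hιS y z hz)
    clear hx hi
    induction hu using Submodule.span_induction with
    | mem u hu =>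
      obtain ⟨β, rfl⟩ := hu
      exact hwS z hz β
    | zero => simp
    | add u v _ _ hu hv =>
      rw [map_add, LinearMap.add_apply]
      exact Submodule.add_mem _ hu hv
    | smul c u _ hu =>
      rw [map_smul, LinearMap.smul_apply]
      exact Submodule.smul_mem _ c hu
  obtain ⟨u, hu, v, ⟨y, rfl⟩, rfl⟩ := Submodule.mem_sup.1 (hS.symm ▸ Submodule.mem_top : f ∈ S)
  rw [Submodule.mem_span_range_iff_exists_fun] at hu
  obtain ⟨c, rfl⟩ := hu
  exact ⟨c 0, c 1, y, by rw [Fin.sum_univ_two]⟩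

end GammaMatrices

/-! ## A free Lie superalgebra with two odd derivations -/

/-- The letters `ad(x) ^ n c`, `ad(y) ^ (n + 1) c` and `ad(x) ad(y) c` for two odd elements `x`,
`y` with bracket `c`. -/
inductive FiberLetter : Type
  | left : ℕ → FiberLetter
  | right : ℕ → FiberLetter
  | mid : FiberLetter

namespace FiberLetter

/-- The parities of the letters. -/
def parity : FiberLetter → ZMod 2
  | left n => n
  | right n => n + 1
  | mid => 0

instance : Nontrivial FiberLetter := ⟨⟨mid, left 0, FiberLetter.noConfusion⟩⟩

end FiberLetter

/-- The free Lie superalgebra on letters `x_n` of parity `n`. -/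
abbrev ChainAlgebra : Type := FreeLieSuper (fun n : ℕ => (n : ZMod 2))

namespace ChainAlgebra

open LieSuperalgebra

/-- The generators. -/
def gen (n : ℕ) : ChainAlgebra := FreeLieSuper.of _ n

theorem gen_mem (n : ℕ) : gen n ∈ gr ChainAlgebra n := FreeLieSuper.of_mem_gr _ n

theorem exists_shift : ∃ d : Module.End ℂ ChainAlgebra, IsSuperDerivation 1 d ∧
    ∀ n, d (gen n) = gen (n + 1) :=
  FreeLieSuper.exists_derivation 1 (fun n => gen (n + 1)) (fun n => by
    have := gen_mem (n + 1)
    push_cast at this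
    exact this)

/-- The derivation with `x_n ↦ x_{n + 1}`. -/
def shift : Module.End ℂ ChainAlgebra := exists_shift.choose

theorem isSuperDerivation_shift : IsSuperDerivation 1 shift := exists_shift.choose_spec.1

theorem shift_gen (n : ℕ) : shift (gen n) = gen (n + 1) := exists_shift.choose_spec.2 n

/-- The value of the other derivation on `x_{n + 2}`. -/
def cross : ℕ → ChainAlgebra
  -- If x_n = E^n c and [D,E] = ad c, then D x_2 = [c, x_1] - E D x_1; the Dirac equation makes E D
  -- x_1 equal to half of [c, x_1].
  | 0 => (1 / 2 : ℂ) • br (gen 0) (gen 1)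
  -- The relation D E + E D = ad c, applied to x_{n+2}.
  | n + 1 => br (gen 0) (gen (n + 2)) - shift (cross n)

theorem cross_mem (n : ℕ) : cross n ∈ gr ChainAlgebra (n + 1 : ℕ) := by
  induction n with
  | zero =>
    have := br_mem (gen_mem 0) (gen_mem 1)
    exact Submodule.smul_mem _ _ this
  | succ n ih =>
    have h2 := isSuperDerivation_shift.1 _ _ ih
    have h1 := br_mem (gen_mem 0) (gen_mem (n + 2))
    have e1 : ((0 : ℕ) : ZMod 2) + ((n + 2 : ℕ) : ZMod 2) = ((n + 1 + 1 : ℕ) : ZMod 2) := by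
      push_cast; ring
    have e2 : (1 : ZMod 2) + ((n + 1 : ℕ) : ZMod 2) = ((n + 1 + 1 : ℕ) : ZMod 2) := by
      push_cast; ring
    rw [e1] at h1
    rw [e2] at h2
    exact Submodule.sub_mem _ h1 h2

theorem generates_gen : Generates (Set.range gen) := FreeLieSuper.generates _

variable {A : Type*} [AddCommGroup A] [Module ℂ A] [SuperAlgebra A] [LieSuperalgebra A]

theorem map_shift {f : SuperHom ChainAlgebra A} {E : Module.End ℂ A} (hE : IsSuperDerivation 1 E)
    (hf : ∀ n, f (gen (n + 1)) = E (f (gen n))) (x : ChainAlgebra) : f (shift x) = E (f x) := by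
  refine IsSuperDerivation.intertwine generates_gen isSuperDerivation_shift hE f ?_ x
  rintro _ ⟨n, rfl⟩
  rw [shift_gen, hf]

/-- The cross terms map to the values of the first supersymmetry on a chain for the second. -/
theorem map_cross {f : SuperHom ChainAlgebra A} {X C Y p q : A} {D E : Module.End ℂ A}
    (hgen : Generates ({X, C, Y, p, q} : Set A)) (h : SpinorRelations X C Y p q)
    (hD : IsHalfSusy X C Y p q D) (hE : IsHalfSusy Y C X q p E)
    (h0 : f (gen 0) = C) (hf : ∀ n, f (gen (n + 1)) = E (f (gen n))) (n : ℕ) :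
    f (cross n) = D (f (gen (n + 2))) := by
  induction n with
  | zero =>
    have hq := h.rel_q
    rw [cross, map_smul, f.map_br, hf 1, hf 0, h0, hE.map_C, hE.map_p, map_smul,
      hD.der.apply_br_even_left h.Y_mem, hD.map_Y, hD.map_C, map_smul, LinearMap.smul_apply,
      br_even_right q h.C_mem]
    linear_combination (norm := module) (-(1 / 2) : ℂ) • hq
  | succ n ih =>
    have hDE := congrArg (fun T => T (f (gen (n + 2)))) (hD.br_other hgen h hE)
    rw [br_end_eq hD.der.mem_gr_end hE.der.mem_gr_end, superSign_one_one] at hDE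
    simp only [LinearMap.sub_apply, LinearMap.smul_apply, Module.End.mul_apply] at hDE
    rw [cross, map_sub, f.map_br, map_shift hE.der hf, ih, h0, hf (n + 2), ← hDE]
    module

end ChainAlgebra

/-- The free Lie superalgebra on the letters. -/
abbrev FiberAlgebra : Type := FreeLieSuper FiberLetter.parity

namespace FiberAlgebra

open LieSuperalgebra ChainAlgebra

/-- The generator `ad(x) ^ n c`. -/
def left (n : ℕ) : FiberAlgebra := FreeLieSuper.of _ (FiberLetter.left n)

/-- The generator `ad(y) ^ (n + 1) c`. -/
def right (n : ℕ) : FiberAlgebra := FreeLieSuper.of _ (FiberLetter.right n)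

/-- The generator `ad(x) ad(y) c`. -/
def mid : FiberAlgebra := FreeLieSuper.of _ FiberLetter.mid

theorem left_mem (n : ℕ) : left n ∈ gr FiberAlgebra n :=
  FreeLieSuper.of_mem_gr _ (FiberLetter.left n)

theorem right_mem (n : ℕ) : right n ∈ gr FiberAlgebra (n + 1) :=
  FreeLieSuper.of_mem_gr _ (FiberLetter.right n)

theorem mid_mem : mid ∈ gr FiberAlgebra 0 := FreeLieSuper.of_mem_gr _ FiberLetter.mid

theorem left_zero_mem : left 0 ∈ gr FiberAlgebra 0 := by simpa using left_mem 0

theorem left_one_mem : left 1 ∈ gr FiberAlgebra 1 := by simpa using left_mem 1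

theorem right_zero_mem : right 0 ∈ gr FiberAlgebra 1 := by simpa using right_mem 0

/-- The elements of the second chain, which starts with `c`. -/
def rightChain : ℕ → FiberAlgebra
  | 0 => left 0
  | n + 1 => right n

theorem rightChain_mem (n : ℕ) : rightChain n ∈ gr FiberAlgebra n := by
  cases n with
  | zero => exact left_mem 0
  | succ n =>
    have := right_mem n
    push_cast
    exact this

/-- The inclusion of the first chain. -/
def leftHom : SuperHom ChainAlgebra FiberAlgebra := FreeLieSuper.lift left left_mem

/-- The inclusion of the second chain. -/
def rightHom : SuperHom ChainAlgebra FiberAlgebra := FreeLieSuper.lift rightChain rightChain_mem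

theorem leftHom_gen (n : ℕ) : leftHom (gen n) = left n := FreeLieSuper.lift_of _ _ n

theorem rightHom_gen (n : ℕ) : rightHom (gen n) = rightChain n := FreeLieSuper.lift_of _ _ n

/-- The values of the first derivation. -/
def leftValue : FiberLetter → FiberAlgebra
  | .left n => left (n + 1)
  | .right 0 => mid
  | .right (n + 1) => rightHom (cross n)
  -- Forced by the first quintic relation: D² = ½ ad X and [X,q] = -[C,p].
  | .mid => (-(1 / 2) : ℂ) • br (left 0) (left 1)

/-- The values of the second derivation. -/
def rightValue : FiberLetter → FiberAlgebra
  | .left 0 => right 0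
  -- D E c + E D c = [c,c] = 0, so the two mixed letters differ by a sign and one is enough.
  | .left 1 => -mid
  | .left (n + 2) => leftHom (cross n)
  | .right n => right (n + 1)
  | .mid => (1 / 2 : ℂ) • br (left 0) (right 0)

theorem two_cast : (2 : ZMod 2) = 0 := by decide

theorem leftValue_mem (x : FiberLetter) : leftValue x ∈ gr FiberAlgebra (x.parity + 1) := by
  match x with
  | .left n =>
    have := left_mem (n + 1)
    push_cast at this
    exact this
  | .right 0 =>
    have : FiberLetter.parity (.right 0) + 1 = 0 := by decide
    rw [this]
    exact mid_mem
  | .right (n + 1) =>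
    have h := rightHom.map_gr (cross_mem n)
    have : FiberLetter.parity (.right (n + 1)) + 1 = ((n + 1 : ℕ) : ZMod 2) := by
      simp only [FiberLetter.parity]
      push_cast
      linear_combination two_cast
    rw [this]
    exact h
  | .mid => exact Submodule.smul_mem _ _ (br_even_odd_mem left_zero_mem left_one_mem)

theorem rightValue_mem (x : FiberLetter) : rightValue x ∈ gr FiberAlgebra (x.parity + 1) := by
  match x with
  | .left 0 =>
    exact right_mem 0
  | .left 1 =>
    have : FiberLetter.parity (.left 1) + 1 = 0 := by decide
    rw [this]
    exact Submodule.neg_mem _ mid_mem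
  | .left (n + 2) =>
    have h := leftHom.map_gr (cross_mem n)
    have : FiberLetter.parity (.left (n + 2)) + 1 = ((n + 1 : ℕ) : ZMod 2) := by
      simp only [FiberLetter.parity]
      push_cast
      linear_combination two_cast
    rw [this]
    exact h
  | .right n =>
    have := right_mem (n + 1)
    push_cast at this
    exact this
  | .mid => exact Submodule.smul_mem _ _ (br_even_odd_mem left_zero_mem right_zero_mem)

/-- The first derivation. -/
def leftDer : Module.End ℂ FiberAlgebra :=
  (FreeLieSuper.exists_derivation 1 leftValue leftValue_mem).choose

/-- The second derivation. -/
def rightDer : Module.End ℂ FiberAlgebra :=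
  (FreeLieSuper.exists_derivation 1 rightValue rightValue_mem).choose

theorem isSuperDerivation_leftDer : IsSuperDerivation 1 leftDer :=
  (FreeLieSuper.exists_derivation 1 leftValue leftValue_mem).choose_spec.1

theorem isSuperDerivation_rightDer : IsSuperDerivation 1 rightDer :=
  (FreeLieSuper.exists_derivation 1 rightValue rightValue_mem).choose_spec.1

theorem leftDer_of (x : FiberLetter) : leftDer (FreeLieSuper.of _ x) = leftValue x :=
  (FreeLieSuper.exists_derivation 1 leftValue leftValue_mem).choose_spec.2 x

theorem rightDer_of (x : FiberLetter) : rightDer (FreeLieSuper.of _ x) = rightValue x :=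
  (FreeLieSuper.exists_derivation 1 rightValue rightValue_mem).choose_spec.2 x

theorem leftDer_left (n : ℕ) : leftDer (left n) = left (n + 1) := leftDer_of (.left n)

theorem leftDer_right_zero : leftDer (right 0) = mid := leftDer_of (.right 0)

theorem leftDer_right_succ (n : ℕ) : leftDer (right (n + 1)) = rightHom (cross n) :=
  leftDer_of (.right (n + 1))

theorem leftDer_mid : leftDer mid = (-(1 / 2) : ℂ) • br (left 0) (left 1) := leftDer_of .mid

theorem rightDer_left_zero : rightDer (left 0) = right 0 := rightDer_of (.left 0)

theorem rightDer_left_one : rightDer (left 1) = -mid := rightDer_of (.left 1)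

theorem rightDer_left_add_two (n : ℕ) : rightDer (left (n + 2)) = leftHom (cross n) :=
  rightDer_of (.left (n + 2))

theorem rightDer_right (n : ℕ) : rightDer (right n) = right (n + 1) := rightDer_of (.right n)

theorem rightDer_mid : rightDer mid = (1 / 2 : ℂ) • br (left 0) (right 0) := rightDer_of .mid

theorem leftHom_shift (x : ChainAlgebra) : leftHom (shift x) = leftDer (leftHom x) :=
  map_shift isSuperDerivation_leftDer
    (fun n => by rw [leftHom_gen, leftHom_gen, leftDer_left]) x

theorem rightHom_shift (x : ChainAlgebra) : rightHom (shift x) = rightDer (rightHom x) :=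
  map_shift isSuperDerivation_rightDer (fun n => by
    rw [rightHom_gen, rightHom_gen]
    cases n with
    | zero => exact rightDer_left_zero.symm
    | succ n => exact (rightDer_right n).symm) x

theorem br_der_apply (x : FiberAlgebra) :
    br leftDer rightDer x = leftDer (rightDer x) + rightDer (leftDer x) := by
  rw [br_end_eq isSuperDerivation_leftDer.mem_gr_end isSuperDerivation_rightDer.mem_gr_end,
    superSign_one_one]
  simp

/-- The values on the letters are chosen to make this true letter by letter; the recursion for
`cross` takes care of the two infinite chains. -/
theorem br_leftDer_rightDer : br leftDer rightDer = br (left 0) := by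
  have hder := isSuperDerivation_leftDer.superComm isSuperDerivation_rightDer
  rw [zmod_two_one_add_one] at hder
  refine IsSuperDerivation.eq_of_generates (FreeLieSuper.generates _) hder
    (IsSuperDerivation.ad left_zero_mem) ?_
  rintro _ ⟨x, rfl⟩
  rw [br_der_apply]
  match x with
  | .left 0 =>
    change leftDer (rightDer (left 0)) + rightDer (leftDer (left 0)) = br (left 0) (left 0)
    rw [rightDer_left_zero, leftDer_right_zero, leftDer_left, rightDer_left_one,
      br_self_even left_zero_mem, add_neg_cancel]
  | .left 1 =>
    change leftDer (rightDer (left 1)) + rightDer (leftDer (left 1)) = br (left 0) (left 1)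
    rw [rightDer_left_one, map_neg, leftDer_mid, leftDer_left, rightDer_left_add_two 0, cross,
      map_smul, leftHom.map_br, leftHom_gen, leftHom_gen]
    module
  | .left (n + 2) =>
    change leftDer (rightDer (left (n + 2))) + rightDer (leftDer (left (n + 2))) =
      br (left 0) (left (n + 2))
    rw [rightDer_left_add_two, leftDer_left, rightDer_left_add_two (n + 1), ← leftHom_shift, cross,
      map_sub, leftHom.map_br, leftHom_gen, leftHom_gen, add_sub_cancel]
  | .right 0 =>
    change leftDer (rightDer (right 0)) + rightDer (leftDer (right 0)) = br (left 0) (right 0)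
    rw [rightDer_right, leftDer_right_succ, leftDer_right_zero, rightDer_mid, cross, map_smul,
      rightHom.map_br, rightHom_gen, rightHom_gen, rightChain, rightChain]
    module
  | .right (n + 1) =>
    change leftDer (rightDer (right (n + 1))) + rightDer (leftDer (right (n + 1))) =
      br (left 0) (right (n + 1))
    rw [rightDer_right, leftDer_right_succ, leftDer_right_succ, ← rightHom_shift, cross, map_sub,
      rightHom.map_br, rightHom_gen, rightHom_gen, sub_add_cancel]
    rfl
  | .mid =>
    change leftDer (rightDer mid) + rightDer (leftDer mid) = br (left 0) mid
    rw [rightDer_mid, leftDer_mid, map_smul, map_smul,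
      isSuperDerivation_leftDer.apply_br_even_left left_zero_mem,
      isSuperDerivation_rightDer.apply_br_even_left left_zero_mem, leftDer_left,
      leftDer_right_zero, rightDer_left_zero, rightDer_left_one,
      br_odd_odd right_zero_mem left_one_mem, map_neg]
    module

/-- Since [D,E] = ad c, the two quintic elements are ad of 2 D(D(E c)) + [c, D c] and of 2 E(E(D c))
+ [c, E c]. The values of D and E on the letter `mid` make both vanish. -/
theorem quinticForm_der : quinticForm leftDer rightDer = 0 ∧ quinticForm rightDer leftDer = 0 := by
  have hl := isSuperDerivation_leftDer
  have hr := isSuperDerivation_rightDer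
  have hll := hl.superComm hl
  have hrr := hr.superComm hr
  have hc := left_zero_mem
  constructor
  · rw [quinticForm, br_leftDer_rightDer, hr.br_ad hc, hl.br_ad hc, rightDer_left_zero,
      leftDer_left, hll.br_ad right_zero_mem, (IsSuperDerivation.ad hc).br_ad left_one_mem,
      ← map_add, IsHalfSusy.apply_apply hl, leftDer_right_zero, leftDer_mid]
    convert map_zero (br (A := FiberAlgebra))
    module
  · rw [quinticForm, br_odd_odd hr.mem_gr_end hl.mem_gr_end, br_leftDer_rightDer, hr.br_ad hc,
      hl.br_ad hc, rightDer_left_zero, leftDer_left, hrr.br_ad left_one_mem,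
      (IsSuperDerivation.ad hc).br_ad right_zero_mem, ← map_add, IsHalfSusy.apply_apply hr,
      rightDer_left_one, map_neg, rightDer_mid]
    convert map_zero (br (A := FiberAlgebra))
    module

/-- The map to the abelianization. -/
def abelianize : SuperHom FiberAlgebra (AbelianSuper FiberLetter.parity) :=
  FreeLieSuper.lift (AbelianSuper.basis _) (AbelianSuper.basis_mem_gr _)

theorem abelianize_br (x y : FiberAlgebra) : abelianize (br x y) = 0 := abelianize.map_br x y

theorem abelianize_of (x : FiberLetter) :
    abelianize (FreeLieSuper.of _ x) = AbelianSuper.basis _ x := FreeLieSuper.lift_of _ _ x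

/-- The two derivations, their squares and the inner derivations are independent. -/
theorem eq_zero_of_combination {a b u v : ℂ} {k : FiberAlgebra}
    (h : ∀ m, a • leftDer m + b • rightDer m + u • leftDer (leftDer m) +
      v • rightDer (rightDer m) + br k m = 0) :
    (a = 0 ∧ b = 0) ∧ (u = 0 ∧ v = 0) ∧ k = 0 := by
  classical
  have hl := isSuperDerivation_leftDer
  have hr := isSuperDerivation_rightDer
  have hc := left_zero_mem
  -- On `left 2` the second derivation, and on `right 1` the first, takes a value that is a bracket
  -- and so dies in the abelianization. What remains is a·x_3 + u·x_4 on the left chain, and b, v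
  -- times two distinct letters on the right chain.
  have h1 := congrArg abelianize.toLin (h (left 2))
  have h2 := congrArg abelianize.toLin (h (right 1))
  rw [rightDer_left_add_two 0, cross, map_smul, leftHom.map_br, leftHom_gen, leftHom_gen,
    map_smul, hr.apply_br_even_left hc, leftDer_left, leftDer_left] at h1
  rw [leftDer_right_succ 0, cross, map_smul, rightHom.map_br, rightHom_gen, rightHom_gen,
    rightChain, rightChain, map_smul, hl.apply_br_even_left hc, rightDer_right,
    rightDer_right] at h2
  simp only [map_add, map_smul, abelianize_br, smul_zero, add_zero, zero_add, map_zero] at h1 h2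
  rw [left, left, abelianize_of, abelianize_of] at h1
  rw [right, right, abelianize_of, abelianize_of] at h2
  have ha := congrArg (AbelianSuper.coord _ (FiberLetter.left 3)) h1
  have hu := congrArg (AbelianSuper.coord _ (FiberLetter.left 4)) h1
  have hb := congrArg (AbelianSuper.coord _ (FiberLetter.right 2)) h2
  have hv := congrArg (AbelianSuper.coord _ (FiberLetter.right 3)) h2
  simp only [map_add, map_smul, AbelianSuper.coord_basis, map_zero] at ha hu hb hv
  simp at ha hu hb hv
  subst ha hu hb hv
  simp only [zero_smul, zero_add] at h
  exact ⟨⟨rfl, rfl⟩, ⟨rfl, rfl⟩, FreeLieSuper.eq_zero_of_central _ h⟩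

variable {A : Type*} [AddCommGroup A] [Module ℂ A] [SuperAlgebra A] [LieSuperalgebra A]

/-- The homomorphism to an algebra with supersymmetries, which intertwines the derivations. -/
theorem exists_hom {X C Y p q : A} {D E : Module.End ℂ A}
    (hgen : Generates ({X, C, Y, p, q} : Set A)) (h : SpinorRelations X C Y p q)
    (hD : IsHalfSusy X C Y p q D) (hE : IsHalfSusy Y C X q p E) :
    ∃ f : SuperHom FiberAlgebra A, f (left 0) = C ∧ (∀ m, f (leftDer m) = D (f m)) ∧
      ∀ m, f (rightDer m) = E (f m) := by
  have hgen' : Generates ({Y, C, X, q, p} : Set A) := IsHalfSusy.swap_set (A := A) ▸ hgen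
  have hDpow : ∀ n : ℕ, (D ^ n) C ∈ gr A n := by
    intro n
    induction n with
    | zero => simpa using h.C_mem
    | succ n ih =>
      rw [pow_succ', Module.End.mul_apply]
      have := hD.der.1 _ _ ih
      push_cast
      rwa [add_comm]
  have hEpow : ∀ n : ℕ, (E ^ n) C ∈ gr A n := by
    intro n
    induction n with
    | zero => simpa using h.C_mem
    | succ n ih =>
      rw [pow_succ', Module.End.mul_apply]
      have := hE.der.1 _ _ ih
      push_cast
      rwa [add_comm]
  let v : FiberLetter → A
    | .left n => (D ^ n) C
    | .right n => (E ^ (n + 1)) C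
    | .mid => D (E C)
  have hv : ∀ x, v x ∈ gr A x.parity := by
    rintro (n | n | _)
    · exact hDpow n
    · have := hEpow (n + 1)
      push_cast at this
      exact this
    · change D (E C) ∈ gr A 0
      rw [hE.map_C]
      exact hD.der.1 1 _ h.q_mem
  let f : SuperHom FiberAlgebra A := FreeLieSuper.lift v hv
  have fl : ∀ n, f (left n) = (D ^ n) C := fun n => FreeLieSuper.lift_of v hv (.left n)
  have fr : ∀ n, f (right n) = (E ^ (n + 1)) C := fun n => FreeLieSuper.lift_of v hv (.right n)
  have fm : f mid = D (E C) := FreeLieSuper.lift_of v hv .mid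
  have fl0 : f (left 0) = C := fl 0
  have fl1 : f (left 1) = p := by rw [fl 1, pow_one, hD.map_C]
  have fr0 : f (right 0) = q := by rw [fr 0, zero_add, pow_one, hE.map_C]
  -- The left chain is generated by D and crossed by E, so the lemma is used with the roles
  -- exchanged.
  have hL := map_cross (f := f.comp leftHom) hgen' h.swap hE hD
    (by rw [SuperHom.comp_apply, leftHom_gen, fl0])
    (fun n => by rw [SuperHom.comp_apply, SuperHom.comp_apply, leftHom_gen, leftHom_gen, fl, fl,
      pow_succ', Module.End.mul_apply])
  have hR := map_cross (f := f.comp rightHom) hgen h hD hE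
    (by rw [SuperHom.comp_apply, rightHom_gen]; exact fl0)
    (fun n => by
      rw [SuperHom.comp_apply, SuperHom.comp_apply, rightHom_gen, rightHom_gen]
      cases n with
      | zero =>
        change f (right 0) = E (f (left 0))
        rw [fr0, fl0, hE.map_C]
      | succ n => rw [rightChain, rightChain, fr, fr, pow_succ', Module.End.mul_apply])
  refine ⟨f, fl0, ?_, ?_⟩
  · refine IsSuperDerivation.intertwine (FreeLieSuper.generates _) isSuperDerivation_leftDer
      hD.der f ?_
    rintro _ ⟨x, rfl⟩
    match x with
    | .left n =>
      change f (leftDer (left n)) = D (f (left n))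
      rw [leftDer_left, fl, fl, pow_succ', Module.End.mul_apply]
    | .right 0 =>
      change f (leftDer (right 0)) = D (f (right 0))
      rw [leftDer_right_zero, fm, fr0, hE.map_C]
    | .right (n + 1) =>
      change f (leftDer (right (n + 1))) = D (f (right (n + 1)))
      rw [leftDer_right_succ]
      have := hR n
      rwa [SuperHom.comp_apply, SuperHom.comp_apply, rightHom_gen] at this
    | .mid =>
      change f (leftDer mid) = D (f mid)
      have hp := h.rel_p
      rw [leftDer_mid, map_smul, f.map_br, fl0, fl1, fm, hE.map_C, hD.map_q, map_smul,
        hD.der.apply_br_even_left h.X_mem, hD.map_X, hD.map_Y, map_zero, LinearMap.zero_apply,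
        map_smul]
      linear_combination (norm := module) (-(1 / 2) : ℂ) • hp
  · refine IsSuperDerivation.intertwine (FreeLieSuper.generates _) isSuperDerivation_rightDer
      hE.der f ?_
    rintro _ ⟨x, rfl⟩
    match x with
    | .left 0 =>
      change f (rightDer (left 0)) = E (f (left 0))
      rw [rightDer_left_zero, fr0, fl0, hE.map_C]
    | .left 1 =>
      change f (rightDer (left 1)) = E (f (left 1))
      rw [rightDer_left_one, map_neg, fm, fl1, hE.map_C, hE.map_q, hD.map_q,
        br_even_left h.X_mem]
      module
    | .left (n + 2) =>
      change f (rightDer (left (n + 2))) = E (f (left (n + 2)))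
      rw [rightDer_left_add_two]
      have := hL n
      rwa [SuperHom.comp_apply, SuperHom.comp_apply, leftHom_gen] at this
    | .right n =>
      change f (rightDer (right n)) = E (f (right n))
      rw [rightDer_right, fr, fr, pow_succ', Module.End.mul_apply]
    | .mid =>
      change f (rightDer mid) = E (f mid)
      have hq := h.rel_q
      rw [rightDer_mid, map_smul, f.map_br, fl0, fr0, fm, hE.map_C, hD.map_q, map_smul,
        hE.der.apply_br_even_left h.X_mem, hE.map_X, hE.map_Y, map_zero, add_zero, map_smul,
        LinearMap.smul_apply, br_even_right p h.Y_mem]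
      linear_combination (norm := module) (1 / 2 : ℂ) • hq

end FiberAlgebra

/-! ## The main theorem -/

namespace FiberAlgebra

open LieSuperalgebra

section Representation

variable {B : Type*} [AddCommGroup B] [Module ℂ B] [SuperAlgebra B]

/-- A representation by derivations restricts to the adjoint representation on the image of the
fiber algebra. -/
theorem representation_eq_ad {g : SuperHom FiberAlgebra B} {x y : B} (hl : ∀ m, g (leftDer m) = br x (g m))
    (hr : ∀ m, g (rightDer m) = br y (g m)) (h0 : g (left 0) = br x y)
    {Ψ : SuperHom B (Module.End ℂ FiberAlgebra)} (hΨx : Ψ x = leftDer) (hΨy : Ψ y = rightDer)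
    (m : FiberAlgebra) : Ψ (g m) = br m := by
  -- The property passes from m to its derivatives because [D, ad m] = ad(D m). All letters arise
  -- from c by the two derivations, so only c has to be checked.
  have hL : ∀ {i : ZMod 2} {m : FiberAlgebra}, m ∈ gr FiberAlgebra i → Ψ (g m) = br m →
      Ψ (g (leftDer m)) = br (leftDer m) := by
    intro i m hm h
    rw [hl, Ψ.map_br, hΨx, h, isSuperDerivation_leftDer.br_ad hm]
  have hR : ∀ {i : ZMod 2} {m : FiberAlgebra}, m ∈ gr FiberAlgebra i → Ψ (g m) = br m →
      Ψ (g (rightDer m)) = br (rightDer m) := by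
    intro i m hm h
    rw [hr, Ψ.map_br, hΨy, h, isSuperDerivation_rightDer.br_ad hm]
  have hleft : ∀ n, Ψ (g (left n)) = br (left n) := by
    intro n
    induction n with
    | zero => rw [h0, Ψ.map_br, hΨx, hΨy, br_leftDer_rightDer]
    | succ n ih =>
      rw [← leftDer_left]
      exact hL (left_mem n) ih
  have hright : ∀ n, Ψ (g (right n)) = br (right n) := by
    intro n
    induction n with
    | zero =>
      rw [← rightDer_left_zero]
      exact hR (left_mem 0) (hleft 0)
    | succ n ih =>
      rw [← rightDer_right]
      exact hR (right_mem n) ih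
  refine SuperHom.eq_of_generates (FreeLieSuper.generates FiberLetter.parity) (f := Ψ.comp g)
    (g := adHom FiberAlgebra) ?_ m
  rintro _ ⟨n | n | _, rfl⟩
  · exact hleft n
  · exact hright n
  · change Ψ (g mid) = br mid
    rw [← leftDer_right_zero]
    exact hL (right_mem 0) (hright 0)

end Representation

variable {A : Type*} [AddCommGroup A] [Module ℂ A] [SuperAlgebra A] [LieSuperalgebra A]
  {X C Y p q : A} {D E : Module.End ℂ A}

/-- An algebra with supersymmetries is the sum of the span of `X` and `Y` and the image of the
fiber algebra. -/
theorem exists_eq_add (hgen : Generates ({X, C, Y, p, q} : Set A))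
    (h : SpinorRelations X C Y p q) (hD : IsHalfSusy X C Y p q D) (hE : IsHalfSusy Y C X q p E)
    {f : SuperHom FiberAlgebra A} (hC : f (left 0) = C) (hl : ∀ m, f (leftDer m) = D (f m))
    (hr : ∀ m, f (rightDer m) = E (f m)) (y : A) :
    ∃ (u v : ℂ) (k : FiberAlgebra), y = u • X + v • Y + f k := by
  have hX : ∀ m, br X (f m) = f ((2 : ℂ) • leftDer (leftDer m)) := by
    intro m
    rw [map_smul, hl, hl, ← IsHalfSusy.apply_apply hD.der, hD.br_self hgen h]
  have hY : ∀ m, br Y (f m) = f ((2 : ℂ) • rightDer (rightDer m)) := by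
    intro m
    rw [map_smul, hr, hr, ← IsHalfSusy.apply_apply hE.der,
      hE.br_self (IsHalfSusy.swap_set (A := A) ▸ hgen) h.swap]
  have hq : f (right 0) = q := by rw [← rightDer_left_zero, hr, hC, hE.map_C]
  -- Obtained from D q = -¼[X,Y] and q = f(`right 0`). With ad X = 2D² and ad Y = 2E² it shows that
  -- every bracket of elements of the sum lies in the image of `f`.
  have hXY : br X Y = f ((-4 : ℂ) • mid) := by
    rw [← leftDer_right_zero, map_smul, hl, hq, hD.map_q]
    module
  let L : ℂ × ℂ × FiberAlgebra →ₗ[ℂ] A := (LinearMap.toSpanSingleton ℂ A X).coprod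
    ((LinearMap.toSpanSingleton ℂ A Y).coprod f.toLin)
  have hLapp : ∀ u v k, L (u, v, k) = u • X + v • Y + f k := by
    intro u v k
    simp [L, add_assoc]
  have hS : LinearMap.range L = ⊤ := by
    refine hgen _ ?_ ?_
    · rintro _ (rfl | rfl | rfl | rfl | rfl)
      · exact ⟨(1, 0, 0), by rw [hLapp]; simp⟩
      · exact ⟨(0, 0, left 0), by rw [hLapp, hC]; simp⟩
      · exact ⟨(0, 1, 0), by rw [hLapp]; simp⟩
      · exact ⟨(0, 0, leftDer (left 0)), by rw [hLapp, hl, hC, hD.map_C]; simp⟩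
      · exact ⟨(0, 0, right 0), by rw [hLapp, hq]; simp⟩
    · rintro _ _ _ _ _ _ ⟨⟨u, v, k⟩, rfl⟩ ⟨⟨u', v', k'⟩, rfl⟩
      refine ⟨(0, 0, u • (2 : ℂ) • leftDer (leftDer k') + v • (2 : ℂ) • rightDer (rightDer k') -
        u' • (2 : ℂ) • leftDer (leftDer k) - v' • (2 : ℂ) • rightDer (rightDer k) +
        (u * v' - v * u') • (-4 : ℂ) • mid + br k k'), ?_⟩
      simp only [hLapp, map_add, map_sub, map_smul f.toLin u, map_smul f.toLin v,
        map_smul f.toLin u', map_smul f.toLin v', map_smul f.toLin (u * v' - v * u'), ← hX, ← hY,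
        ← hXY, f.map_br, LinearMap.add_apply, map_smul, LinearMap.smul_apply]
      rw [br_self_even h.X_mem, br_self_even h.Y_mem, br_even_right _ h.X_mem,
        br_even_right (f k) h.X_mem, br_even_right (f k) h.Y_mem]
      module
  obtain ⟨⟨u, v, k⟩, hk⟩ := LinearMap.range_eq_top.1 hS y
  exact ⟨u, v, k, by rw [← hk, hLapp]⟩

/-- The supersymmetries and the inner derivations are independent if the fiber algebra embeds. -/
theorem faithful (hgen : Generates ({X, C, Y, p, q} : Set A))
    (h : SpinorRelations X C Y p q) (hD : IsHalfSusy X C Y p q D) (hE : IsHalfSusy Y C X q p E)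
    {f : SuperHom FiberAlgebra A} (hC : f (left 0) = C) (hl : ∀ m, f (leftDer m) = D (f m))
    (hr : ∀ m, f (rightDer m) = E (f m)) (hinj : ∀ m, f m = 0 → m = 0) {a b : ℂ} {y : A}
    (h0 : a • D + b • E + br y = 0) : (a = 0 ∧ b = 0) ∧ y = 0 := by
  obtain ⟨u, v, k, rfl⟩ := exists_eq_add hgen h hD hE hC hl hr y
  -- The relation applied to the elements f(m) and pulled back along the injective `f`; the factors
  -- 2 come from ad X = [D,D] = 2D² and ad Y = 2E².
  have key : ∀ m, a • leftDer m + b • rightDer m + (2 * u) • leftDer (leftDer m) +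
      (2 * v) • rightDer (rightDer m) + br k m = 0 := by
    intro m
    apply hinj
    have hm := congrArg (fun T => T (f m)) h0
    simp only [map_add, map_smul, LinearMap.add_apply, LinearMap.smul_apply,
      LinearMap.zero_apply] at hm
    rw [← hD.br_self hgen h, ← hE.br_self (IsHalfSusy.swap_set (A := A) ▸ hgen) h.swap,
      IsHalfSusy.apply_apply hD.der, IsHalfSusy.apply_apply hE.der] at hm
    simp only [map_add, map_smul, hl, hr, f.map_br]
    linear_combination (norm := module) hm
  obtain ⟨hab, ⟨hu, hv⟩, hk⟩ := eq_zero_of_combination key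
  refine ⟨hab, ?_⟩
  have hu' : u = 0 := by simpa using hu
  have hv' : v = 0 := by simpa using hv
  rw [hu', hv', hk, map_zero, zero_smul, zero_smul, add_zero, add_zero]

end FiberAlgebra

end

/-! ### Assembly of the isomorphism and the embedding. -/

theorem mainTheorem11 (G : GammaMatrices 3 2) (ε : Matrix (Fin 2) (Fin 2) ℂ)
    (hskew : εᵀ = -ε) (hdet : ε.det ≠ 0) :
    (LinearIndependent ℂ (quintic ε) ∧
      ∀ a : Matrix (Fin 2) (Fin 2) ℂ, a.trace = 0 →
        ∃ D : Module.End ℂ FreeW, IsSuperDerivation 0 D ∧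
          (∀ α, D (wFree α) = ∑ β, a β α • wFree β) ∧
          (∀ α, D (quintic ε α) = ∑ β, a β α • quintic ε β)) ∧
    (SubSuperalgebra.closure
      (Set.range (fun x : Fin 2 × Fin 2 => G.ASpinor x.1 x.2) ∪
        Set.range (G.chi ε))).carrier = ⊤ ∧
    ∃ θ : Fin 2 → Module.End ℂ G.YM, (∀ α, G.IsSupersymmetry α (θ α)) ∧
      ∃ Φ : SuperHom (FreeWModI ε) G.susy.carrier, Function.Bijective Φ ∧
        (∀ α, (Φ (wBar ε α) : Module.End ℂ G.YM) = θ α) ∧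
        ∃ ι : SuperHom G.YM (FreeWModI ε), Function.Injective ι ∧
          (∀ α β, ι (G.ASpinor α β) = ATilde ε α β) ∧
          (∀ α, ι (G.chi ε α) = chiTilde ε α) ∧
          (∀ y, (Φ (ι y) : Module.End ℂ G.YM) = SuperAlgebra.br y) := by
  refine ⟨⟨linearIndependent_quintic hskew hdet, exists_sl_two_derivation hskew hdet⟩,
    G.closure_eq_top hskew hdet, ?_⟩
  have hrel := G.spinorRelations
  have hgen : Generates ({G.ASpinor 0 0, G.ASpinor 0 1, G.ASpinor 1 1, G.pGen, G.qGen} :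
    Set G.YM) := G.generates_spinorGens
  have hgen' : Generates ({G.ASpinor 1 1, G.ASpinor 0 1, G.ASpinor 0 0, G.qGen, G.pGen} :
    Set G.YM) := IsHalfSusy.swap_set (A := G.YM) ▸ hgen
  obtain ⟨D, hD⟩ := G.exists_isHalfSusy_left
  obtain ⟨E, hE⟩ := G.exists_isHalfSusy_right
  have hθ : ∀ α, G.IsSupersymmetry α (![D, E] α) := by
    intro α
    fin_cases α
    · exact G.isSupersymmetry_left hD
    · exact G.isSupersymmetry_right hE
  obtain ⟨Φ, hΦ0, hΦ1⟩ := FreeWModI.exists_hom hskew hdet hD.der.mem_gr_end hE.der.mem_gr_end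
    (hD.quinticForm_eq_zero hgen hrel hE) (hE.quinticForm_eq_zero hgen' hrel.swap hD)
  have hΦ : ∀ α, Φ (wBar ε α) = ![D, E] α := by
    intro α
    fin_cases α
    · exact hΦ0
    · exact hΦ1
  obtain ⟨ι, hιA, hιp, hιq⟩ := G.exists_iota hskew hdet
  have hw0 := wBar_mem (ε := ε) 0
  have hw1 := wBar_mem (ε := ε) 1
  have hw10 := LieSuperalgebra.br_odd_odd hw1 hw0
  have hιD : ∀ y, ι (D y) = br (wBar ε 0) (ι y) :=
    hD.intertwine hgen ι (by
      rw [hιA, hιA, hιA, hιp, hιq]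
      exact isHalfSusy_br hw0 hw1)
  have hιE : ∀ y, ι (E y) = br (wBar ε 1) (ι y) :=
    hE.intertwine hgen' ι (by
      rw [hιA, hιA, hιA, hιp, hιq]
      simp only [ATilde, ← hw10]
      exact isHalfSusy_br hw1 hw0)
  have hιθ : ∀ α y, ι (![D, E] α y) = br (wBar ε α) (ι y) := by
    intro α
    fin_cases α
    · exact hιD
    · exact hιE
  have hΦι : ∀ y, Φ (ι y) = br y := by
    -- Both sides are homomorphisms, so the five generators suffice: on X, C, Y the claim is the
    -- value of the supercommutators of D and E, and on p, q it follows by one more bracket.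
    refine SuperHom.eq_of_generates hgen (f := Φ.comp ι) (g := adHom G.YM) ?_
    have hC := hD.br_other hgen hrel hE
    rintro _ (rfl | rfl | rfl | rfl | rfl) <;>
      simp only [SuperHom.comp_apply, adHom_apply, hιA, hιp, hιq, ATilde, Φ.map_br, hΦ0, hΦ1]
    · exact hD.br_self hgen hrel
    · exact hC
    · exact hE.br_self hgen' hrel.swap
    · rw [hC, hD.der.br_ad hrel.C_mem, hD.map_C]
    · rw [hC, hE.der.br_ad hrel.C_mem, hE.map_C]
  obtain ⟨κ, hκC, hκD, hκE⟩ := FiberAlgebra.exists_hom hgen hrel hD hE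
  obtain ⟨hq0, hq1⟩ := FiberAlgebra.quinticForm_der
  obtain ⟨Ψ, hΨ0, hΨ1⟩ := FreeWModI.exists_hom hskew hdet
    FiberAlgebra.isSuperDerivation_leftDer.mem_gr_end
    FiberAlgebra.isSuperDerivation_rightDer.mem_gr_end hq0 hq1
  have hΨκ : ∀ m, Ψ (ι (κ m)) = br m :=
    FiberAlgebra.representation_eq_ad (g := ι.comp κ)
      (fun m => by rw [SuperHom.comp_apply, hκD, hιD, SuperHom.comp_apply])
      (fun m => by rw [SuperHom.comp_apply, hκE, hιE, SuperHom.comp_apply])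
      (by rw [SuperHom.comp_apply, hκC, hιA]; rfl) hΨ0 hΨ1
  -- An element killed by κ has ad m = Ψ(ι(κ m)) = 0, hence is central in a free algebra with more
  -- than one letter.
  have hκinj : ∀ m, κ m = 0 → m = 0 := by
    intro m hm
    refine FreeLieSuper.eq_zero_of_central _ fun l => ?_
    rw [← hΨκ m, hm, map_zero, map_zero, LinearMap.zero_apply]
  have hfaith : ∀ {a b : ℂ} {y : G.YM}, a • D + b • E + br y = 0 → (a = 0 ∧ b = 0) ∧ y = 0 :=
    FiberAlgebra.faithful hgen hrel hD hE hκC hκD hκE hκinj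
  have hΦinj : ∀ f, Φ f = 0 → f = 0 := by
    intro f hf
    obtain ⟨a, b, y, rfl⟩ := GammaMatrices.exists_eq_add_iota hιA hιθ f
    rw [map_add, map_add, map_smul, map_smul, hΦ0, hΦ1, hΦι] at hf
    obtain ⟨⟨rfl, rfl⟩, rfl⟩ := hfaith hf
    simp
  -- The case a = b = 0 of faithfulness: ι y = 0 gives ad y = Φ(ι y) = 0, so y is central in YM.
  have hιinj : ∀ y, ι y = 0 → y = 0 := by
    intro y hy
    refine (hfaith (a := 0) (b := 0) ?_).2
    rw [← hΦι, hy, map_zero]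
    simp
  have hmem : ∀ f, Φ f ∈ G.susy.carrier := by
    have := generates_wBar (G.susy.carrier.comap Φ.toLin) (by
      rintro _ ⟨α, rfl⟩
      change Φ (wBar ε α) ∈ G.susy.carrier
      rw [hΦ]
      exact SubSuperalgebra.subset_closure _ ⟨α, hθ α⟩) (by
      intro _ _ x y _ _ hx hy
      rw [Submodule.mem_comap] at *
      rw [Φ.map_br]
      exact G.susy.br_mem' _ _ hx hy)
    intro f
    exact (this ▸ Submodule.mem_top : f ∈ G.susy.carrier.comap Φ.toLin)
  -- A supersymmetry is determined by its values on generators, so the generating set of `susy`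
  -- consists of D and E only.
  have hsurj : G.susy.carrier ≤ (SubSuperalgebra.range Φ).carrier := by
    refine SubSuperalgebra.closure_le ?_
    rintro T ⟨α, hT⟩
    exact ⟨wBar ε α, (hΦ α).trans ((hθ α).unique hT)⟩
  refine ⟨![D, E], hθ, G.susy.codRestrict Φ hmem, ⟨?_, ?_⟩, hΦ, ι, ?_, hιA,
    G.iota_chi hskew hdet hιp hιq, hΦι⟩
  · refine (injective_iff_map_eq_zero (G.susy.codRestrict Φ hmem).toLin).2 fun f hf => ?_
    exact hΦinj f (congrArg Subtype.val hf)
  · rintro ⟨T, hT⟩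
    obtain ⟨f, hf⟩ := hsurj hT
    exact ⟨f, Subtype.ext hf⟩
  · exact (injective_iff_map_eq_zero ι.toLin).2 hιinj
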